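/- Let $G=(V,E)$ be any graph, let $\mathcal X$ be the set of finite subsets of $V$, and for $X\in\mathcal X$ let $\mathcal C_X$ be the discrete space of components of $G-X$; for $X\subseteq X'$ let $\mathfrak c_{X',X}:\mathcal C_{X'}\to\mathcal C_X$ send each component of $G-X'$ to the component of $G-X$ including it. Write $G$ also for the 1-complex of $G$ and $\mathring E$ for its set of inner edge points. A compactification of a space $A$ is a pair $(K,h)$ with $K$ compact and $h:A\to K$ an embedding with dense image. We write $(K,h)\le(K',h')$, and call $(K,h)$ coarser and $(K',h')$ finer, if $f\circ h'=h$ for some continuous $f:K'\to K$; if $f$ can be chosen to be a homeomorphism, the two are (topologically) equivalent, and if $f$ can be chosen to be a topological quotient map, $(K,h)$ is a quotient of $(K',h')$. *Ends.* Let $\Omega$ be the set of ends of $G$ (classes of rays, where two rays are equivalent if for every $X\in\mathcal X$ they have tails in the same component of $G-X$), and let $C(X,\omega)\in\mathcal C_X$ be the component in which the rays of $\omega$ have tails. For a set $I$ of new points, $X\in\mathcal X$, $\mathcal C\subseteq\mathcal C_X$ and $P\subseteq I$ put $\mathcal O(X,\mathcal C,P)=\bigcup\mathcal C\cup\mathring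 E(X,\bigcup\mathcal C)\cup P\subseteq G\sqcup I$, where $\mathring E(X,\bigcup\mathcal C)$ is the set of inner points of edges between $X$ and $\bigcup\mathcal C$. The space $|G|_\Omega=G\sqcup\Omega$ has the topology generated by the open sets of $G$ and all sets $\mathcal O(X,\mathcal C,\{\omega: C(X,\omega)\in\mathcal C\})$. An $\Omega$-compactification of $G$ is a compactification $\alpha G$ of $|G|_\Omega$ for which $\alpha G\setminus\mathring E$ is a Hausdorff compactification of $|G|_\Omega\setminus\mathring E$. *$\mathcal C$-systems.* A $\mathcal C$-system $\mathcal C^\alpha$ is an inverse system of Hausdorff compactifications $(\alpha(\mathcal C_X),\alpha_X)$ of the spaces $\mathcal C_X$ ($X\in\mathcal X$) with continuous bonding maps $\mathfrak a_{X',X}$ satisfying $\mathfrak a_{X',X}\circ\alpha_{X'}=\alpha_X\circ\mathfrak c_{X',X}$ for all $X\subseteq X'$. It induces the space $\alpha G=G\sqcup\varprojlim\alpha(\mathcal C_X)$ with the topology generated by the open sets of $G$ and all sets $\mathcal O(X,\alpha_X^{-1}(O),\{p:p_X\in O\})$ with $O\subseteq\alpha(\mathcal C_X)$ open, and the map $|G|_\Omega\to\alpha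 G$ which is the identity on $G$ and sends an end $\omega$ to $(\alpha_X(C(X,\omega)))_X$. A $\mathcal C$-compactification of $G$ is an $\Omega$-compactification of $G$ that is, up to topological equivalence, induced by a $\mathcal C$-system. Write $\mathcal C^\alpha\le_{\mathcal C}\mathcal C^\delta$ if there are continuous maps $f_X:\delta(\mathcal C_X)\to\alpha(\mathcal C_X)$ with $f_X\circ\delta_X=\alpha_X$ for all $X$ and $f_X\circ\mathfrak d_{X',X}=\mathfrak a_{X',X}\circ f_{X'}$ for all $X\subseteq X'$. Two $\mathcal C$-systems are $\mathcal C$-equivalent if each is $\le_{\mathcal C}$ the other. *The systems $\mathcal C^\Gamma$ and $\mathcal C^{\mathcal U}$.* For $Y\subseteq X\in\mathcal X$ let $\mathcal C_X(Y)$ be the set of $C\in\mathcal C_X$ with neighbourhood $N(C)=Y$. Call $Y\in\mathcal X$ critical if $\mathcal C_Y(Y)$ is infinite, and let $\mathrm{crit}(X)$ be the set of critical subsets of $X$. Let $\mathcal C^\Gamma$ be the $\mathcal C$-system of the spaces $\Gamma_X=\mathcal C_X\sqcup\mathrm{crit}(X)$, with the topology generated by all subsets of $\mathcal C_X$ and all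 sets $\mathcal C\sqcup\{Y\}$ with $Y\in\mathrm{crit}(X)$ and $\mathcal C\subseteq\mathcal C_X(Y)$ cofinite; its bonding maps agree with $\mathfrak c_{X',X}$ on $\mathcal C_{X'}$, fix each $Y\in\mathrm{crit}(X')$ with $Y\subseteq X$, and send every other $Y\in\mathrm{crit}(X')$ to the unique component of $G-X$ meeting $Y$. Let $|G|_\Gamma$ be the space induced by $\mathcal C^\Gamma$. Let $\mathcal C^{\mathcal U}$ be the $\mathcal C$-system of the Stone–Čech compactifications $\beta(\mathcal C_X)$, with the bonding maps $\beta(\mathfrak c_{X',X})$. *Tangles.* An oriented finite order separation is a pair $(A,B)$ with $A\cup B=V$, $A\cap B$ finite and no edge between $A\setminus B$ and $B\setminus A$. Put $(A,B)\le(C,D)$ if $A\subseteq C$ and $B\supseteq D$. A star is a set of such pairs in which any two distinct $(A,B),(D,C)$ satisfy $(A,B)\le(C,D)$; its interior is the intersection of the sets $B$ over all its elements $(A,B)$. An $\aleph_0$-tangle is a set $\tau$ of oriented finite order separations that contains precisely one of $(A,B),(B,A)$ for each of them, contains no two distinct $(B,A),(C,D)$ with $(A,B)<(C,D)$, and includes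 no finite star with finite interior. Let $\Theta$ be the set of $\aleph_0$-tangles. For $\tau\in\Theta$ and $X\in\mathcal X$ let $U(\tau,X)$ be the ultrafilter of all $\mathcal C\subseteq\mathcal C_X$ with $(V\setminus V[\mathcal C],\,X\cup V[\mathcal C])\in\tau$, where $V[\mathcal C]$ is the set of vertices of the components in $\mathcal C$. The space $|G|_\Theta=G\sqcup\Theta$ has the topology generated by the open sets of $G$ and all sets $\mathcal O(X,\mathcal C,\{\tau:\mathcal C\in U(\tau,X)\})$; the space $|G|_\Omega$ is mapped to it by the identity on $G$ and $\omega\mapsto\{(A,B):C(A\cap B,\omega)\subseteq G[B\setminus A]\}$. Put $\mathcal X_\tau=\{X\in\mathcal X:U(\tau,X)\text{ is free}\}$. If $\mathcal X_\tau\ne\emptyset$, then $\tau$ is called an ultrafilter tangle, and $\mathcal X_\tau$ has a least element $X_\tau$. Let $\sim$ be the equivalence relation on $|G|_\Theta$ that identifies precisely those ultrafilter tangles $\tau,\tau'$ with $X_\tau=X_{\tau'}$. **Theorem.** The following hold up to $\mathcal C$-equivalence: (i) $\mathcal C^\Gamma$ is the least $\mathcal C$-system with respect to $\le_{\mathcal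 C}$; (ii) $\mathcal C^{\mathcal U}$ is the greatest $\mathcal C$-system with respect to $\le_{\mathcal C}$. Moreover, the following hold up to topological equivalence: (iii) $|G|_\Gamma$ is a $\mathcal C$-compactification of $G$, and it is the coarsest one: it is coarser than every $\mathcal C$-compactification, and every $\mathcal C$-compactification that is coarser than $|G|_\Gamma$ is equivalent to it; (iv) $|G|_\Theta$ is a $\mathcal C$-compactification of $G$, and it is the finest one: it is finer than every $\mathcal C$-compactification, and every $\mathcal C$-compactification that is finer than $|G|_\Theta$ is equivalent to it. Furthermore, $|G|_\Gamma$ is a quotient of every $\mathcal C$-compactification, every $\mathcal C$-compactification is a quotient of $|G|_\Theta$, and $|G|_\Gamma$ is topologically equivalent to $|G|_\Theta/{\sim}$ (as compactifications of $|G|_\Omega$). -/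

import Mathlib

universe u v w

namespace InfGraph

open Set Topology

/-! ## Component spaces -/

/-- `𝒞_X`: the set of components of `G - X`, for a finite set `X` of vertices. -/
abbrev Comp {V : Type u} (G : SimpleGraph V) (X : Finset V) : Type u :=
  G.ComponentCompl (X : Set V)

/-- The component spaces are discrete. -/
instance instTopComp {V : Type u} (G : SimpleGraph V) (X : Finset V) :
    TopologicalSpace (Comp G X) := ⊥

instance instDiscComp {V : Type u} (G : SimpleGraph V) (X : Finset V) :
    DiscreteTopology (Comp G X) := ⟨rfl⟩

/-- `𝔠_{X',X}` sends a component of `G - X'` to the component of `G - X` that includes it. -/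
def compMap {V : Type u} {G : SimpleGraph V} {X X' : Finset V} (h : X ⊆ X') (C : Comp G X') :
    Comp G X :=
  C.hom (Finset.coe_subset.2 h)

theorem subset_compMap {V : Type u} {G : SimpleGraph V} {X X' : Finset V} (h : X ⊆ X')
    (C : Comp G X') : (C : Set V) ⊆ (compMap h C : Comp G X) :=
  C.subset_hom (Finset.coe_subset.2 h)

theorem compMap_refl {V : Type u} {G : SimpleGraph V} {X : Finset V} (C : Comp G X) :
    compMap (Finset.Subset.refl X) C = C :=
  C.hom_refl

theorem compMap_trans {V : Type u} {G : SimpleGraph V} {X X' X'' : Finset V} (h : X ⊆ X')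
    (h' : X' ⊆ X'') (C : Comp G X'') : compMap (h.trans h') C = compMap h (compMap h' C) :=
  C.hom_trans (Finset.coe_subset.2 h') (Finset.coe_subset.2 h)

theorem comp_eq_of_mem {V : Type u} {G : SimpleGraph V} {X : Finset V} {C D : Comp G X} {x : V}
    (hC : x ∈ C) (hD : x ∈ D) : C = D :=
  hC.choose_spec.symm.trans hD.choose_spec

/-- `V[𝒞]`: the set of all vertices in components from `𝒞`. -/
def verts {V : Type u} {G : SimpleGraph V} {X : Finset V} (𝒞 : Set (Comp G X)) : Set V :=
  ⋃ C ∈ 𝒞, (C : Set V)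

/-! ## The 1-complex of a graph -/

/-- The points of the 1-complex of `G`: the vertices, and a copy of `(0,1)` for every edge. -/
inductive OneComplex {V : Type u} (G : SimpleGraph V) : Type u
  | vert (v : V) : OneComplex G
  | inner (e : G.edgeSet) (t : Ioo (0 : ℝ) 1) : OneComplex G

/-- The two endvertices of an edge, listed in an arbitrary (fixed) order. -/
noncomputable def ends {V : Type u} {G : SimpleGraph V} (e : G.edgeSet) : V × V :=
  Quot.out (e : Sym2 V)

/-- The topological edge `[x, y]`, parametrized by `[0,1]`. -/
noncomputable def edgePath {V : Type u} {G : SimpleGraph V} (e : G.edgeSet)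
    (t : Icc (0 : ℝ) 1) : OneComplex G :=
  if h0 : (t : ℝ) = 0 then .vert (ends e).1
  else if h1 : (t : ℝ) = 1 then .vert (ends e).2
  else .inner e ⟨t, lt_of_le_of_ne t.2.1 (Ne.symm h0), lt_of_le_of_ne t.2.2 h1⟩

/-- A set is open in the 1-complex if and only if its trace on every topological edge is open.
Equivalently, around each of its inner edge points it includes an open interval of the edge, and
around each of its vertices `v` a union of half open intervals `[v, i_e)`, one for each edge `e`
at `v`. -/
noncomputable instance instTopComplex {V : Type u} (G : SimpleGraph V) :
    TopologicalSpace (OneComplex G) :=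
  ⨆ e : G.edgeSet, TopologicalSpace.coinduced (edgePath e) inferInstance

/-- The set of inner edge points. -/
def innerPoints {V : Type u} (G : SimpleGraph V) : Set (OneComplex G) :=
  {z | ∃ e t, z = .inner e t}

/-- `⋃ 𝒞 ∪ E̊(X, ⋃ 𝒞)`: the 1-complex of the union of the components in `𝒞`, together with the
inner points of all edges between `X` and these components. -/
def region {V : Type u} {G : SimpleGraph V} (X : Finset V) (𝒞 : Set (Comp G X)) :
    Set (OneComplex G) :=
  {z | match z with
    | .vert v => ∃ C ∈ 𝒞, v ∈ C
    | .inner e _ => (∃ C ∈ 𝒞, ∀ v ∈ (e : Sym2 V), v ∈ C) ∨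
        (∃ C ∈ 𝒞, ∃ x ∈ X, ∃ y ∈ C, (e : Sym2 V) = s(x, y))}

/-- The disjoint union of the 1-complex of `G` and a set `I` of additional points. -/
inductive Ext {V : Type u} (G : SimpleGraph V) (I : Type v) : Type (max u v)
  | pt (z : OneComplex G) : Ext G I
  | lim (i : I) : Ext G I

/-- `⋃ 𝒞 ∪ E̊(X, ⋃ 𝒞) ∪ P` -/
def basicNhd {V : Type u} {G : SimpleGraph V} {I : Type v} (X : Finset V)
    (𝒞 : Set (Comp G X)) (P : Set I) : Set (Ext G I) :=
  Ext.pt '' region X 𝒞 ∪ Ext.lim '' P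

/-- The topology generated by the open sets of the 1-complex of `G` and the sets in `B`. -/
abbrev extTopology {V : Type u} {G : SimpleGraph V} {I : Type v} (B : Set (Set (Ext G I))) :
    TopologicalSpace (Ext G I) :=
  TopologicalSpace.generateFrom ({S | ∃ U : Set (OneComplex G), IsOpen U ∧ S = Ext.pt '' U} ∪ B)

/-! ## Ends -/

/-- A ray: a 1-way infinite path. -/
structure Ray {V : Type u} (G : SimpleGraph V) where
  vertex : ℕ → V
  injective : Function.Injective vertex
  adj : ∀ n, G.Adj (vertex n) (vertex (n + 1))

/-- Some tail of the ray lies in `S`. -/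
def Ray.TailIn {V : Type u} {G : SimpleGraph V} (r : Ray G) (S : Set V) : Prop :=
  ∃ N, ∀ n, N ≤ n → r.vertex n ∈ S

theorem Ray.exists_tail_avoid {V : Type u} {G : SimpleGraph V} (r : Ray G) {S : Set V}
    (hS : S.Finite) : r.TailIn Sᶜ := by
  have hfin : (r.vertex ⁻¹' S).Finite := hS.preimage r.injective.injOn
  obtain ⟨N, hN⟩ := hfin.bddAbove
  refine ⟨N + 1, fun n hn hmem => ?_⟩
  have := hN hmem
  omega

theorem Ray.TailIn.inter {V : Type u} {G : SimpleGraph V} {r : Ray G} {S T : Set V}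
    (hS : r.TailIn S) (hT : r.TailIn T) : r.TailIn (S ∩ T) := by
  obtain ⟨N, hN⟩ := hS
  obtain ⟨M, hM⟩ := hT
  exact ⟨max N M, fun n hn => ⟨hN n (le_trans (le_max_left _ _) hn),
    hM n (le_trans (le_max_right _ _) hn)⟩⟩

theorem Ray.TailIn.nonempty {V : Type u} {G : SimpleGraph V} {r : Ray G} {S : Set V}
    (hS : r.TailIn S) : S.Nonempty := by
  obtain ⟨N, hN⟩ := hS
  exact ⟨_, hN N le_rfl⟩

theorem Ray.TailIn.infinite {V : Type u} {G : SimpleGraph V} {r : Ray G} {S : Set V}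
    (hS : r.TailIn S) : S.Infinite := by
  intro hfin
  obtain ⟨x, hx, hx'⟩ := (hS.inter (r.exists_tail_avoid hfin)).nonempty
  exact hx' hx

theorem Ray.exists_comp {V : Type u} {G : SimpleGraph V} (r : Ray G) (X : Finset V) :
    ∃ C : Comp G X, r.TailIn C := by
  obtain ⟨N, hN⟩ := r.exists_tail_avoid X.finite_toSet
  refine ⟨G.componentComplMk (hN N le_rfl), N, fun n hn => ?_⟩
  induction n, hn using Nat.le_induction with
  | base => exact G.componentComplMk_mem _
  | succ n hn ih =>
    exact SimpleGraph.ComponentCompl.mem_of_adj _ _ ih (hN (n + 1) (by omega)) (r.adj n)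

theorem Ray.comp_unique {V : Type u} {G : SimpleGraph V} {r : Ray G} {X : Finset V}
    {C D : Comp G X} (hC : r.TailIn C) (hD : r.TailIn D) : C = D := by
  obtain ⟨x, hx, hx'⟩ := (hC.inter hD).nonempty
  exact comp_eq_of_mem hx hx'

/-- Two rays are equivalent if for every finite `X` both have a tail in the same component of
`G - X`. -/
def raySetoid {V : Type u} (G : SimpleGraph V) : Setoid (Ray G) where
  r r s := ∀ X : Finset V, ∃ C : Comp G X, r.TailIn C ∧ s.TailIn C
  iseqv := by
    refine ⟨fun r X => ?_, fun h X => ?_, fun h h' X => ?_⟩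
    · obtain ⟨C, hC⟩ := r.exists_comp X
      exact ⟨C, hC, hC⟩
    · obtain ⟨C, hC, hC'⟩ := h X
      exact ⟨C, hC', hC⟩
    · obtain ⟨C, hC, hC'⟩ := h X
      obtain ⟨D, hD, hD'⟩ := h' X
      obtain rfl := Ray.comp_unique hC' hD
      exact ⟨C, hC, hD'⟩

/-- The set `Ω` of ends of `G`. -/
def Ends {V : Type u} (G : SimpleGraph V) : Type u := Quotient (raySetoid G)

/-- `C(X, ω)`: the component of `G - X` in which every ray of `ω` has a tail. -/
noncomputable def Ends.comp {V : Type u} {G : SimpleGraph V} (X : Finset V) (ω : Ends G) :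
    Comp G X :=
  Quotient.lift (s := raySetoid G) (fun r => (r.exists_comp X).choose) (by
    intro r s hrs
    obtain ⟨C, hC, hC'⟩ := hrs X
    exact (Ray.comp_unique (r.exists_comp X).choose_spec hC).trans
      (Ray.comp_unique hC' (s.exists_comp X).choose_spec)) ω

theorem Ends.tailIn_comp {V : Type u} {G : SimpleGraph V} (X : Finset V) (r : Ray G) :
    r.TailIn (Ends.comp X (Quotient.mk (raySetoid G) r) : Comp G X) :=
  (r.exists_comp X).choose_spec

theorem Ends.compMap_comp {V : Type u} {G : SimpleGraph V} {X X' : Finset V} (h : X ⊆ X')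
    (ω : Ends G) : compMap h (ω.comp X') = ω.comp X := by
  induction ω using Quotient.inductionOn with
  | h r =>
    refine Ray.comp_unique (r := r) ?_ (Ends.tailIn_comp X r)
    obtain ⟨N, hN⟩ := Ends.tailIn_comp X' r
    exact ⟨N, fun n hn => subset_compMap h _ (hN n hn)⟩

/-- The points of `|G|_Ω = G ⊔ Ω`. -/
def EndSpace {V : Type u} (G : SimpleGraph V) : Type u := Ext G (Ends G)

noncomputable instance instTopEndSpace {V : Type u} (G : SimpleGraph V) : TopologicalSpace (EndSpace G) :=
  extTopology {S | ∃ (X : Finset V) (𝒞 : Set (Comp G X)),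
    S = basicNhd X 𝒞 {ω : Ends G | ω.comp X ∈ 𝒞}}

/-- The set `E̊` of inner edge points, as a subset of `|G|_Ω`. -/
def EndSpace.inner {V : Type u} (G : SimpleGraph V) : Set (EndSpace G) :=
  Ext.pt '' innerPoints G

/-! ## Compactifications -/

/-- `(K, h)` is a compactification of `A`. -/
structure IsCompactification {A : Type u} {K : Type v} [TopologicalSpace A] [TopologicalSpace K]
    (h : A → K) : Prop where
  compact : CompactSpace K
  isEmbedding : IsEmbedding h
  dense : DenseRange h

/-- `(K, h)` is a Hausdorff compactification of `A`. -/
structure IsHausdorffCompactification {A : Type u} {K : Type v} [TopologicalSpace A]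
    [TopologicalSpace K] (h : A → K) : Prop extends IsCompactification h where
  hausdorff : T2Space K

/-- `(K, h) ≤ (K', h')` for compactifications `h`, `h'` of `A`: some continuous `f : K' → K`
satisfies `f ∘ h' = h`. -/
def Coarser {A : Type u} {K : Type v} {K' : Type w} [TopologicalSpace K] [TopologicalSpace K']
    (h : A → K) (h' : A → K') : Prop :=
  ∃ f : K' → K, Continuous f ∧ f ∘ h' = h

/-- Topological equivalence of two compactifications `h`, `h'` of `A`. -/
def TopEquivalent {A : Type u} {K : Type v} {K' : Type w} [TopologicalSpace K]
    [TopologicalSpace K'] (h : A → K) (h' : A → K') : Prop :=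
  ∃ f : K' ≃ₜ K, f ∘ h' = h

/-- `(K, h)` is a quotient of `(K', h')`, for compactifications `h`, `h'` of `A`. -/
def IsQuotientOf {A : Type u} {K : Type v} {K' : Type w} [TopologicalSpace K]
    [TopologicalSpace K'] (h : A → K) (h' : A → K') : Prop :=
  ∃ f : K' → K, IsQuotientMap f ∧ f ∘ h' = h

/-- The restriction of an injective map `h : A → K` to `A \ I → K \ h[I]`. -/
def deleteMap {A : Type u} {K : Type v} (h : A → K) (hinj : Function.Injective h) (I : Set A) :
    ↥Iᶜ → ↥(h '' I)ᶜ :=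
  fun a => ⟨h a, fun ⟨_, hb, e⟩ => a.2 (hinj e ▸ hb)⟩

/-- `(K, h)` is an `Ω`-compactification of `G`: a compactification of `|G|_Ω` such that
`K \ E̊` is a Hausdorff compactification of `|G|_Ω \ E̊`. -/
structure IsOmegaCompactification {V : Type u} (G : SimpleGraph V) {K : Type v}
    [TopologicalSpace K] (h : EndSpace G → K) : Prop where
  isCompactification : IsCompactification h
  delete_inner : IsHausdorffCompactification
    (deleteMap h isCompactification.isEmbedding.injective (EndSpace.inner G))

/-! ## `𝒞`-systems -/

/-- A `𝒞`-system of `G`: an inverse system of Hausdorff compactifications `(α(𝒞_X), α_X)` of the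
discrete component spaces whose bonding maps extend the maps `𝔠_{X',X}`. -/
structure CSystem {V : Type u} (G : SimpleGraph V) : Type (max u (w + 1)) where
  space : Finset V → Type w
  top : ∀ X, TopologicalSpace (space X)
  emb : ∀ X, Comp G X → space X
  isHausdorffCompactification : ∀ X, IsHausdorffCompactification (emb X)
  bond : ∀ {X X' : Finset V}, X ⊆ X' → space X' → space X
  continuous_bond : ∀ {X X' : Finset V} (h : X ⊆ X'), Continuous (bond h)
  bond_self : ∀ (X : Finset V) (p : space X), bond (Finset.Subset.refl X) p = p
  bond_comp : ∀ {X X' X'' : Finset V} (h : X ⊆ X') (h' : X' ⊆ X'') (p : space X''),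
    bond (h.trans h') p = bond h (bond h' p)
  bond_emb : ∀ {X X' : Finset V} (h : X ⊆ X') (C : Comp G X'),
    bond h (emb X' C) = emb X (compMap h C)

attribute [instance] CSystem.top

namespace CSystem

/-- The inverse limit of a `𝒞`-system. -/
def Limit {V : Type u} {G : SimpleGraph V} (𝒮 : CSystem.{u, w} G) : Type (max u w) :=
  {p : ∀ X, 𝒮.space X // ∀ (X X' : Finset V) (h : X ⊆ X'), 𝒮.bond h (p X') = p X}

/-- The canonical map from the ends into the inverse limit. -/
noncomputable def ofEnd {V : Type u} {G : SimpleGraph V} (𝒮 : CSystem.{u, w} G) (ω : Ends G) :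
    𝒮.Limit :=
  ⟨fun X => 𝒮.emb X (ω.comp X), fun X X' h => by rw [𝒮.bond_emb h, Ends.compMap_comp h]⟩

/-- The points of the space `αG = G ⊔ lim α(𝒞_X)` induced by a `𝒞`-system. -/
def Space {V : Type u} {G : SimpleGraph V} (𝒮 : CSystem.{u, w} G) : Type (max u w) :=
  Ext G 𝒮.Limit

noncomputable instance instTopSpace {V : Type u} {G : SimpleGraph V} (𝒮 : CSystem.{u, w} G) :
    TopologicalSpace 𝒮.Space :=
  extTopology {S | ∃ (X : Finset V) (O : Set (𝒮.space X)), IsOpen O ∧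
    S = basicNhd X (𝒮.emb X ⁻¹' O) {p : 𝒮.Limit | p.1 X ∈ O}}

/-- The canonical map from `|G|_Ω` to `αG`. -/
noncomputable def map {V : Type u} {G : SimpleGraph V} (𝒮 : CSystem.{u, w} G) :
    EndSpace G → 𝒮.Space
  | .pt z => .pt z
  | .lim ω => .lim (𝒮.ofEnd ω)

/-- `𝒮 ≤ 𝒯` for `𝒞`-systems: there are `f_X : 𝒯_X ≥ 𝒮_X` compatible with the bonding maps. -/
def Le {V : Type u} {G : SimpleGraph V} (𝒮 : CSystem.{u, v} G) (𝒯 : CSystem.{u, w} G) : Prop :=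
  ∃ f : ∀ X, 𝒯.space X → 𝒮.space X,
    (∀ X, Continuous (f X) ∧ f X ∘ 𝒯.emb X = 𝒮.emb X) ∧
    ∀ (X X' : Finset V) (h : X ⊆ X'), f X ∘ 𝒯.bond h = 𝒮.bond h ∘ f X'

end CSystem

/-- `(K, h)` is a `𝒞`-compactification of `G`: an `Ω`-compactification that is induced by a
`𝒞`-system, up to topological equivalence. -/
def IsCCompactification {V : Type u} (G : SimpleGraph V) {K : Type v} [TopologicalSpace K]
    (h : EndSpace G → K) : Prop :=
  IsOmegaCompactification G h ∧ ∃ 𝒮 : CSystem.{u, w} G, TopEquivalent h 𝒮.map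

/-! ## The Stone–Čech system -/

/-- `β(𝒞_X)` as the space of ultrafilters on `𝒞_X`, with the bonding maps `β(𝔠_{X',X})`. -/
noncomputable def stoneCechSystem {V : Type u} (G : SimpleGraph V) : CSystem.{u, u} G where
  space X := Ultrafilter (Comp G X)
  top X := inferInstance
  emb X := pure
  isHausdorffCompactification X :=
    { compact := inferInstance
      isEmbedding := (isDenseEmbedding_pure (α := Comp G X)).isEmbedding
      dense := denseRange_pure
      hausdorff := inferInstance }
  bond h := Ultrafilter.map (compMap h)
  continuous_bond {X X'} h := by
    refine ultrafilterBasis_is_basis.continuous_iff.2 ?_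
    rintro _ ⟨s, rfl⟩
    exact ultrafilter_isOpen_basic (compMap h ⁻¹' s)
  bond_self X p := by
    have : compMap (G := G) (Finset.Subset.refl X) = id := by
      funext C
      exact compMap_refl C
    rw [this, Ultrafilter.map_id]
  bond_comp {X X' X''} h h' p := by
    rw [Ultrafilter.map_map]
    congr 1
    funext C
    exact compMap_trans h h' C
  bond_emb h C := Ultrafilter.map_pure _ _

/-! ## Critical vertex sets -/

/-- The neighbourhood `N(C)` of a component `C` of `G - X`. -/
def nbhd {V : Type u} {G : SimpleGraph V} {X : Finset V} (C : Comp G X) : Set V :=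
  {x | x ∉ C ∧ ∃ y ∈ C, G.Adj x y}

/-- `𝒞_X(Y)`: the set of all components of `G - X` with neighbourhood `Y`. -/
def compsWithNbhd {V : Type u} (G : SimpleGraph V) (X Y : Finset V) : Set (Comp G X) :=
  {C | nbhd C = (Y : Set V)}

/-- A finite vertex set `X` is critical if infinitely many components of `G - X` have
neighbourhood precisely `X`. -/
def IsCritical {V : Type u} (G : SimpleGraph V) (X : Finset V) : Prop :=
  (compsWithNbhd G X X).Infinite

/-- `crit(X)`: the set of all critical subsets of `X`. -/
def crit {V : Type u} (G : SimpleGraph V) (X : Finset V) : Set (Finset V) :=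
  {Y | Y ⊆ X ∧ IsCritical G Y}

theorem mem_compMap_iff {V : Type u} {G : SimpleGraph V} {X X' : Finset V} (h : X ⊆ X')
    {C : Comp G X'} {D : Comp G X} {x : V} (hx : x ∈ C) : compMap h C = D ↔ x ∈ D :=
  ⟨fun e => e ▸ subset_compMap h C hx, fun hD => comp_eq_of_mem (subset_compMap h C hx) hD⟩

/-- The component of `G - X` containing a vertex `x ∉ X`. -/
def compOf {V : Type u} (G : SimpleGraph V) {X : Finset V} {x : V} (hx : x ∉ X) : Comp G X :=
  G.componentComplMk (K := (X : Set V)) hx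

theorem mem_compOf {V : Type u} (G : SimpleGraph V) {X : Finset V} {x : V} (hx : x ∉ X) :
    x ∈ compOf G hx :=
  G.componentComplMk_mem _

theorem mem_comp_of_adj {V : Type u} {G : SimpleGraph V} {X : Finset V} {C : Comp G X} {x y : V}
    (hx : x ∈ C) (hy : y ∉ X) (h : G.Adj x y) : y ∈ C :=
  SimpleGraph.ComponentCompl.mem_of_adj x y hx hy h

theorem not_mem_of_mem_comp {V : Type u} {G : SimpleGraph V} {X : Finset V} {C : Comp G X} {x : V}
    (hx : x ∈ C) : x ∉ X :=
  SimpleGraph.ComponentCompl.notMem_of_mem hx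

theorem comp_nonempty {V : Type u} {G : SimpleGraph V} {X : Finset V} (C : Comp G X) :
    ∃ x, x ∈ C :=
  SimpleGraph.ComponentCompl.nonempty C

/-- A set of vertices that is closed under adjacency outside `X` and meets a component of `G - X`
includes it. -/
theorem comp_subset_of_closed {V : Type u} {G : SimpleGraph V} {X : Finset V} (C : Comp G X)
    {S : Set V} (hS : ∀ x ∈ S, ∀ y, y ∉ X → G.Adj x y → y ∈ S) {x : V} (hx : x ∈ C) (hxS : x ∈ S) :
    (C : Set V) ⊆ S := by
  have key : ∀ a b : ↥((X : Set V)ᶜ), (G.induce (X : Set V)ᶜ).Walk a b → a.1 ∈ S → b.1 ∈ S := by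
    intro a b p
    induction p with
    | nil => exact id
    | @cons a b c hab _ ih =>
      intro ha
      exact ih (hS a.1 ha b.1 b.2 hab)
  obtain ⟨hxX, rfl⟩ := hx
  rintro y ⟨hyX, hy⟩
  obtain ⟨p⟩ := SimpleGraph.ConnectedComponent.exact hy.symm
  exact key ⟨x, hxX⟩ ⟨y, hyX⟩ p hxS

theorem nbhd_subset {V : Type u} {G : SimpleGraph V} {X : Finset V} (C : Comp G X) :
    nbhd C ⊆ (X : Set V) := by
  rintro x ⟨hx, y, hy, hxy⟩
  by_contra hX
  exact hx (mem_comp_of_adj hy hX hxy.symm)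

/-- A component of `G - X'` with neighbourhood in `X ⊆ X'` is also a component of `G - X`. -/
theorem coe_compMap_of_nbhd_subset {V : Type u} {G : SimpleGraph V} {X X' : Finset V}
    (h : X ⊆ X') (C : Comp G X') (hC : nbhd C ⊆ (X : Set V)) :
    ((compMap h C : Comp G X) : Set V) = (C : Set V) := by
  obtain ⟨x, hx⟩ := comp_nonempty C
  refine Subset.antisymm ?_ (subset_compMap h C)
  refine comp_subset_of_closed (compMap h C) ?_ (subset_compMap h C hx) hx
  intro a ha b hb hab
  by_contra hbC
  exact hb (hC ⟨hbC, a, ha, hab.symm⟩)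

theorem nbhd_eq_of_coe_eq {V : Type u} {G : SimpleGraph V} {X X' : Finset V} {C : Comp G X}
    {C' : Comp G X'} (h : (C : Set V) = (C' : Set V)) : nbhd C = nbhd C' := by
  have h' : ∀ x, x ∈ C ↔ x ∈ C' := fun x => by
    rw [← SetLike.mem_coe, h, SetLike.mem_coe]
  ext x
  simp only [nbhd, Set.mem_ofPred_eq, h']

theorem compMap_mem_compsWithNbhd {V : Type u} {G : SimpleGraph V} {X X' Y : Finset V}
    (h : X ⊆ X') (hY : Y ⊆ X) {C : Comp G X'} (hC : C ∈ compsWithNbhd G X' Y) :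
    compMap h C ∈ compsWithNbhd G X Y := by
  have hC' : nbhd C = (Y : Set V) := hC
  have := coe_compMap_of_nbhd_subset h C (hC'.trans_subset (Finset.coe_subset.2 hY))
  exact (nbhd_eq_of_coe_eq this).trans hC'

theorem compMap_injOn {V : Type u} {G : SimpleGraph V} {X X' Y : Finset V}
    (h : X ⊆ X') (hY : Y ⊆ X) : InjOn (compMap (G := G) h) (compsWithNbhd G X' Y) := by
  intro C hC D hD e
  have hC' : nbhd C = (Y : Set V) := hC
  have hD' : nbhd D = (Y : Set V) := hD
  have h1 := coe_compMap_of_nbhd_subset h C (hC'.trans_subset (Finset.coe_subset.2 hY))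
  have h2 := coe_compMap_of_nbhd_subset h D (hD'.trans_subset (Finset.coe_subset.2 hY))
  rw [e, h2] at h1
  exact SetLike.coe_injective h1.symm

theorem finite_comps_meeting {V : Type u} (G : SimpleGraph V) (X : Finset V) {S : Set V}
    (hS : S.Finite) : {C : Comp G X | ∃ x ∈ S, x ∈ C}.Finite := by
  classical
  have : {C : Comp G X | ∃ x ∈ S, x ∈ C} ⊆
      ⋃ x ∈ S, {C : Comp G X | x ∈ C} := by
    rintro C ⟨x, hx, hxC⟩
    exact mem_iUnion₂.2 ⟨x, hx, hxC⟩
  refine (hS.biUnion fun x _ => ?_).subset this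
  exact Set.Subsingleton.finite fun C hC D hD => comp_eq_of_mem hC hD

/-- A component of `G - X` avoiding `X'` is also a component of `G - X'` for `X ⊆ X'`. -/
theorem exists_comp_of_disjoint {V : Type u} {G : SimpleGraph V} {X X' : Finset V}
    (h : X ⊆ X') (C : Comp G X) (hC : ∀ x ∈ X', x ∉ C) :
    ∃ C' : Comp G X', compMap h C' = C ∧ (C' : Set V) = (C : Set V) := by
  obtain ⟨x, hx⟩ := comp_nonempty C
  have hxX' : x ∉ X' := fun hh => hC x hh hx
  have e : compMap h (compOf G hxX') = C := (mem_compMap_iff h (mem_compOf G hxX')).2 hx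
  refine ⟨compOf G hxX', e, Subset.antisymm (e ▸ subset_compMap h _) ?_⟩
  refine comp_subset_of_closed C ?_ hx (mem_compOf G hxX')
  intro a ha b hb hab
  have haC : a ∈ C := e ▸ subset_compMap h _ ha
  exact mem_comp_of_adj ha (fun hh => hC b hh (mem_comp_of_adj haC hb hab)) hab

theorem infinite_compsWithNbhd_iff {V : Type u} {G : SimpleGraph V} {X Y : Finset V}
    (hY : Y ⊆ X) : (compsWithNbhd G X Y).Infinite ↔ IsCritical G Y := by
  constructor
  · intro hinf
    refine (hinf.image (compMap_injOn (G := G) hY (Finset.Subset.refl Y))).mono ?_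
    rintro _ ⟨C, hC, rfl⟩
    exact compMap_mem_compsWithNbhd hY (Finset.Subset.refl Y) hC
  · intro hcrit hfin
    refine hcrit ?_
    have hm := finite_comps_meeting G Y X.finite_toSet
    refine ((hfin.image (compMap hY)).union hm).subset ?_
    intro C hC
    by_cases hmeet : ∃ x ∈ (X : Set V), x ∈ C
    · exact Or.inr hmeet
    · push Not at hmeet
      obtain ⟨C', e, e'⟩ := exists_comp_of_disjoint hY C hmeet
      exact Or.inl ⟨C', (nbhd_eq_of_coe_eq e').trans hC, e⟩

/-- If `Y` is critical, then all vertices of `Y \ X` lie in the same component of `G - X`. -/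
theorem critical_mem_comp {V : Type u} {G : SimpleGraph V} {X Y : Finset V}
    (hY : IsCritical G Y) {y y' : V} (hy : y ∈ Y) (hy' : y' ∈ Y) (hyX' : y' ∉ X)
    {C : Comp G X} (hC : y ∈ C) : y' ∈ C := by
  classical
  obtain ⟨D, hD, hDX⟩ := (hY.sdiff (finite_comps_meeting G Y X.finite_toSet)).nonempty
  have hDX' : ∀ x ∈ X, x ∉ D := fun x hx hxD => hDX ⟨x, hx, hxD⟩
  have hD' : nbhd D = (Y : Set V) := hD
  obtain ⟨-, d, hd, hyd⟩ : y ∈ nbhd D := hD' ▸ hy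
  obtain ⟨-, d', hd', hyd'⟩ : y' ∈ nbhd D := hD' ▸ hy'
  have hdC : d ∈ C := mem_comp_of_adj hC (fun hh => hDX' d hh hd) hyd
  have hsub : (D : Set V) ⊆ {v | v ∈ D ∧ v ∈ C} := by
    refine comp_subset_of_closed D ?_ hd ⟨hd, hdC⟩
    intro a ha b hb hab
    have hbD : b ∈ D := mem_comp_of_adj ha.1 hb hab
    exact ⟨hbD, mem_comp_of_adj ha.2 (fun hh => hDX' b hh hbD) hab⟩
  exact mem_comp_of_adj (hsub hd').2 hyX' hyd'.symm

/-- `C_X(Y)`: the unique component of `G - X` that meets `Y`, for `Y` critical and not included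
in `X` (it does not depend on the choice of a vertex in `Y \ X`). -/
noncomputable def critComp {V : Type u} (G : SimpleGraph V) {X Y : Finset V} (h : ¬ Y ⊆ X) :
    Comp G X :=
  compOf G (Finset.not_subset.1 h).choose_spec.2

theorem mem_critComp {V : Type u} {G : SimpleGraph V} {X Y : Finset V} (hY : IsCritical G Y)
    (h : ¬ Y ⊆ X) {y : V} (hy : y ∈ Y) (hyX : y ∉ X) : y ∈ critComp G h :=
  critical_mem_comp hY (Finset.not_subset.1 h).choose_spec.1 hy hyX (mem_compOf G _)

/-! ## The system of components and critical vertex sets -/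

/-- The points of `Γ_X = 𝒞_X ⊔ crit(X)`. -/
inductive Gam {V : Type u} (G : SimpleGraph V) (X : Finset V) : Type u
  | comp (C : Comp G X) : Gam G X
  | crit (Y : Finset V) (hY : Y ∈ crit G X) : Gam G X

/-- The topology on `Γ_X` generated by the subsets of the discrete space `𝒞_X` and the sets
`𝒞 ⊔ {Y}` for `Y ∈ crit(X)` and cofinite subsets `𝒞` of `𝒞_X(Y)`. -/
instance instTopGam {V : Type u} (G : SimpleGraph V) (X : Finset V) :
    TopologicalSpace (Gam G X) :=
  TopologicalSpace.generateFrom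
    ({S | ∃ 𝒞 : Set (Comp G X), S = Gam.comp '' 𝒞} ∪
     {S | ∃ (Y : Finset V) (hY : Y ∈ crit G X) (𝒞 : Set (Comp G X)),
        𝒞 ⊆ compsWithNbhd G X Y ∧ (compsWithNbhd G X Y \ 𝒞).Finite ∧
        S = Gam.comp '' 𝒞 ∪ {Gam.crit Y hY}})

theorem isOpen_gam_iff {V : Type u} {G : SimpleGraph V} {X : Finset V} {U : Set (Gam G X)} :
    IsOpen U ↔ ∀ Y (hY : Y ∈ crit G X), Gam.crit Y hY ∈ U →
      (compsWithNbhd G X Y \ Gam.comp ⁻¹' U).Finite := by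
  constructor
  · intro hU
    induction hU with
    | basic S hS =>
      rcases hS with ⟨𝒞, rfl⟩ | ⟨Z, hZ, 𝒞, h𝒞, hfin, rfl⟩
      · rintro Y hY ⟨C, -, hC⟩
        cases hC
      · rintro Y hY (⟨C, -, hC⟩ | hYZ)
        · cases hC
        · cases hYZ
          refine hfin.subset (sdiff_subset_sdiff_right ?_)
          intro C hC
          exact Or.inl ⟨C, hC, rfl⟩
    | univ => intro Y hY _; simp
    | inter S T _ _ ihS ihT =>
      intro Y hY hmem
      refine ((ihS Y hY hmem.1).union (ihT Y hY hmem.2)).subset ?_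
      rintro C ⟨hC, hC'⟩
      by_cases h : Gam.comp C ∈ S
      · exact Or.inr ⟨hC, fun hT => hC' ⟨h, hT⟩⟩
      · exact Or.inl ⟨hC, h⟩
    | sUnion 𝒮 _ ih =>
      rintro Y hY ⟨S, hS, hmem⟩
      refine (ih S hS Y hY hmem).subset ?_
      rintro C ⟨hC, hC'⟩
      exact ⟨hC, fun h => hC' ⟨S, hS, h⟩⟩
  · intro h
    rw [isOpen_iff_forall_mem_open]
    rintro (C | ⟨Y, hY⟩) hx
    · refine ⟨Gam.comp '' {C}, ?_, TopologicalSpace.isOpen_generateFrom_of_mem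
        (Or.inl ⟨_, rfl⟩), ⟨C, rfl, rfl⟩⟩
      rintro _ ⟨D, rfl, rfl⟩
      exact hx
    · refine ⟨Gam.comp '' (compsWithNbhd G X Y ∩ Gam.comp ⁻¹' U) ∪ {Gam.crit Y hY}, ?_,
        TopologicalSpace.isOpen_generateFrom_of_mem
          (Or.inr ⟨Y, hY, _, inter_subset_left, ?_, rfl⟩), Or.inr rfl⟩
      · rintro _ (⟨D, hD, rfl⟩ | rfl)
        · exact hD.2
        · exact hx
      · rw [sdiff_self_inter]
        exact h Y hY hx

theorem gam_isHausdorffCompactification {V : Type u} (G : SimpleGraph V) (X : Finset V) :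
    IsHausdorffCompactification (Gam.comp : Comp G X → Gam G X) where
  compact := by
    classical
    have hcover : (univ : Set (Gam G X)) ⊆ ⋃ Y ∈ X.powerset,
        (Gam.comp '' compsWithNbhd G X Y ∪ {p | ∃ hY, p = Gam.crit Y hY}) := by
      rintro (C | ⟨Y, hY⟩) -
      · have hsub := nbhd_subset C
        refine mem_iUnion₂.2 ⟨X.filter (· ∈ nbhd C), by simp, Or.inl ⟨C, ?_, rfl⟩⟩
        ext x
        simpa using fun hx => hsub hx
      · exact mem_iUnion₂.2 ⟨Y, Finset.mem_powerset.2 hY.1, Or.inr ⟨hY, rfl⟩⟩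
    have hK : IsCompact (⋃ Y ∈ X.powerset,
        (Gam.comp '' compsWithNbhd G X Y ∪ {p : Gam G X | ∃ hY, p = Gam.crit Y hY})) := by
      refine X.powerset.isCompact_biUnion fun Y hYX => ?_
      by_cases hY : Y ∈ crit G X
      · rw [isCompact_iff_ultrafilter_le_nhds]
        intro f hf
        by_cases hle : (f : Filter (Gam G X)) ≤ 𝓝 (Gam.crit Y hY)
        · exact ⟨_, Or.inr ⟨hY, rfl⟩, hle⟩
        · rw [(nhds_basis_opens _).ge_iff] at hle
          push Not at hle
          obtain ⟨U, ⟨hmem, hU⟩, hUf⟩ := hle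
          have hfin := (isOpen_gam_iff.1 hU Y hY hmem).image (Gam.comp (G := G) (X := X))
          have hin : Gam.comp '' (compsWithNbhd G X Y \ Gam.comp ⁻¹' U) ∈ f := by
            have h1 := f.inter_sets (Filter.le_principal_iff.1 hf)
              (Ultrafilter.compl_mem_iff_notMem.2 hUf)
            refine f.sets_of_superset h1 ?_
            rintro _ ⟨⟨C, hC, rfl⟩ | ⟨hY', rfl⟩, hn⟩
            · exact ⟨C, ⟨hC, hn⟩, rfl⟩
            · exact absurd hmem hn
          obtain ⟨_, ⟨C, hC, rfl⟩, hfx⟩ := Ultrafilter.eq_pure_of_finite_mem hfin hin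
          refine ⟨_, Or.inl ⟨C, hC.1, rfl⟩, ?_⟩
          rw [hfx]
          exact pure_le_nhds _
      · have hn : ¬ (compsWithNbhd G X Y).Infinite := fun hinf =>
          hY ⟨Finset.mem_powerset.1 hYX,
            (infinite_compsWithNbhd_iff (Finset.mem_powerset.1 hYX)).1 hinf⟩
        refine ((not_infinite.1 hn).image _).isCompact.union ?_
        convert isCompact_empty
        rw [eq_empty_iff_forall_notMem]
        rintro _ ⟨hY', -⟩
        exact hY hY'
    exact ⟨hK.of_isClosed_subset isClosed_univ hcover⟩
  isEmbedding := by
    have hinj : Function.Injective (Gam.comp : Comp G X → Gam G X) := fun C D h => by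
      cases h; rfl
    refine IsOpenEmbedding.isEmbedding
      (IsOpenEmbedding.of_continuous_injective_isOpenMap continuous_of_discreteTopology hinj ?_)
    intro S _
    exact TopologicalSpace.isOpen_generateFrom_of_mem (Or.inl ⟨S, rfl⟩)
  dense := by
    rw [DenseRange, dense_iff_inter_open]
    rintro U hU ⟨(C | ⟨Y, hY⟩), hx⟩
    · exact ⟨_, hx, C, rfl⟩
    · have h1 := isOpen_gam_iff.1 hU Y hY hx
      have h2 := (infinite_compsWithNbhd_iff hY.1).2 hY.2
      obtain ⟨C, hC, hC'⟩ := (h2.sdiff h1).nonempty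
      have : Gam.comp C ∈ U := by
        by_contra hn
        exact hC' ⟨hC, hn⟩
      exact ⟨_, this, C, rfl⟩
  hausdorff := by
    have hc : ∀ 𝒞 : Set (Comp G X), IsOpen (Gam.comp '' 𝒞 : Set (Gam G X)) := fun 𝒞 =>
      TopologicalSpace.isOpen_generateFrom_of_mem (Or.inl ⟨_, rfl⟩)
    have hk : ∀ Y (hY : Y ∈ crit G X) (C : Comp G X),
        IsOpen (Gam.comp '' (compsWithNbhd G X Y \ {C}) ∪ {Gam.crit Y hY} : Set (Gam G X)) :=
      fun Y hY C => TopologicalSpace.isOpen_generateFrom_of_mem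
        (Or.inr ⟨Y, hY, _, sdiff_subset, (finite_singleton C).subset (by
          rintro D ⟨hD, hD'⟩
          by_contra hne
          exact hD' ⟨hD, hne⟩), rfl⟩)
    have hk' : ∀ Y (hY : Y ∈ crit G X),
        IsOpen (Gam.comp '' (compsWithNbhd G X Y) ∪ {Gam.crit Y hY} : Set (Gam G X)) :=
      fun Y hY => TopologicalSpace.isOpen_generateFrom_of_mem
        (Or.inr ⟨Y, hY, _, Subset.rfl, by simp, rfl⟩)
    have hd : ∀ (C : Comp G X) Y (hY : Y ∈ crit G X),
        Disjoint (Gam.comp '' {C} : Set (Gam G X))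
          (Gam.comp '' (compsWithNbhd G X Y \ {C}) ∪ {Gam.crit Y hY}) := by
      intro C Y hY
      rw [Set.disjoint_left]
      rintro _ ⟨D, rfl, rfl⟩ (⟨E, ⟨-, hE⟩, e⟩ | e)
      · cases e
        exact hE rfl
      · cases e
    refine ⟨?_⟩
    rintro (C | ⟨Y, hY⟩) (D | ⟨Z, hZ⟩) hne
    · refine ⟨_, _, hc {C}, hc {D}, ⟨C, rfl, rfl⟩, ⟨D, rfl, rfl⟩, ?_⟩
      rw [Set.disjoint_left]
      rintro _ ⟨_, rfl, rfl⟩ ⟨_, rfl, e⟩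
      exact hne e.symm
    · exact ⟨_, _, hc {C}, hk Z hZ C, ⟨C, rfl, rfl⟩, Or.inr rfl, hd C Z hZ⟩
    · exact ⟨_, _, hk Y hY D, hc {D}, Or.inr rfl, ⟨D, rfl, rfl⟩, (hd D Y hY).symm⟩
    · refine ⟨_, _, hk' Y hY, hk' Z hZ, Or.inr rfl, Or.inr rfl, ?_⟩
      rw [Set.disjoint_left]
      rintro _ (⟨C, hC, rfl⟩ | rfl) (⟨D, hD, e⟩ | e)
      · cases e
        have h1 : nbhd C = (Y : Set V) := hC
        have h2 : nbhd C = (Z : Set V) := hD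
        have : Y = Z := Finset.coe_injective (h1.symm.trans h2)
        subst this
        exact hne rfl
      · cases e
      · cases e
      · exact hne e

/-- The bonding maps `Γ_{X'} → Γ_X`. -/
noncomputable def gamBond {V : Type u} {G : SimpleGraph V} {X X' : Finset V} (h : X ⊆ X') :
    Gam G X' → Gam G X
  | .comp C => .comp (compMap h C)
  | .crit Y hY =>
    open Classical in
    if hYX : Y ⊆ X then .crit Y ⟨hYX, hY.2⟩ else .comp (critComp G hYX)

theorem gamBond_crit_of_subset {V : Type u} {G : SimpleGraph V} {X X' : Finset V} (h : X ⊆ X')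
    {Y : Finset V} (hY : Y ∈ crit G X') (hYX : Y ⊆ X) :
    gamBond h (.crit Y hY) = .crit Y ⟨hYX, hY.2⟩ := by
  simp [gamBond, hYX]

theorem gamBond_crit_of_not_subset {V : Type u} {G : SimpleGraph V} {X X' : Finset V}
    (h : X ⊆ X') {Y : Finset V} (hY : Y ∈ crit G X') (hYX : ¬ Y ⊆ X) :
    gamBond h (.crit Y hY) = .comp (critComp G hYX) := by
  simp [gamBond, hYX]

/-- `𝒞^Γ`: the `𝒞`-system of the spaces `Γ_X`. -/
noncomputable def gamSystem {V : Type u} (G : SimpleGraph V) : CSystem.{u, u} G where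
  space X := Gam G X
  top X := inferInstance
  emb X := Gam.comp
  isHausdorffCompactification X := gam_isHausdorffCompactification G X
  bond h := gamBond h
  continuous_bond {X X'} h := by
    refine continuous_def.2 fun U hU => isOpen_gam_iff.2 fun Y hY hmem => ?_
    by_cases hYX : Y ⊆ X
    · rw [mem_preimage, gamBond_crit_of_subset h hY hYX] at hmem
      refine Finite.of_finite_image ((isOpen_gam_iff.1 hU Y _ hmem).subset ?_)
        ((compMap_injOn h hYX).mono sdiff_subset)
      rintro _ ⟨C, ⟨hC, hC'⟩, rfl⟩
      exact ⟨compMap_mem_compsWithNbhd h hYX hC, hC'⟩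
    · rw [mem_preimage, gamBond_crit_of_not_subset h hY hYX] at hmem
      convert finite_empty
      rw [eq_empty_iff_forall_notMem]
      rintro C ⟨hC, hC'⟩
      apply hC'
      have hCn : nbhd C = (Y : Set V) := hC
      obtain ⟨y, hy, hyX⟩ := Finset.not_subset.1 hYX
      obtain ⟨-, c, hc, hyc⟩ : y ∈ nbhd C := hCn ▸ hy
      have hcX : c ∉ X := fun hh => not_mem_of_mem_comp hc (h hh)
      have : compMap h C = critComp G hYX := (mem_compMap_iff h hc).2
        (mem_comp_of_adj (mem_critComp hY.2 hYX hy hyX) hcX hyc)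
      change Gam.comp (compMap h C) ∈ U
      rw [this]
      exact hmem
  bond_self X p := by
    rcases p with C | ⟨Y, hY⟩
    · exact congrArg Gam.comp (compMap_refl C)
    · exact gamBond_crit_of_subset _ hY hY.1
  bond_comp {X X' X''} h h' p := by
    rcases p with C | ⟨Y, hY⟩
    · exact congrArg Gam.comp (compMap_trans h h' C)
    · by_cases hYX' : Y ⊆ X'
      · rw [gamBond_crit_of_subset h' hY hYX']
        by_cases hYX : Y ⊆ X
        · exact (gamBond_crit_of_subset _ hY hYX).trans (gamBond_crit_of_subset h _ hYX).symm
        · exact (gamBond_crit_of_not_subset _ hY hYX).trans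
            (gamBond_crit_of_not_subset h _ hYX).symm
      · have hYX : ¬ Y ⊆ X := fun hh => hYX' (hh.trans h)
        rw [gamBond_crit_of_not_subset h' hY hYX', gamBond_crit_of_not_subset _ _ hYX]
        obtain ⟨y, hy, hyX⟩ := Finset.not_subset.1 hYX'
        refine congrArg Gam.comp ((mem_compMap_iff h (mem_critComp hY.2 hYX' hy hyX)).2 ?_).symm
        exact mem_critComp hY.2 hYX hy fun hh => hyX (h hh)
  bond_emb h C := rfl

/-! ## Tangles -/

/-- `(A, B)` is an oriented finite order separation of `G`. -/
def IsSep {V : Type u} (G : SimpleGraph V) (s : Set V × Set V) : Prop :=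
  (s.1 ∩ s.2).Finite ∧ s.1 ∪ s.2 = univ ∧ ∀ a ∈ s.1 \ s.2, ∀ b ∈ s.2 \ s.1, ¬ G.Adj a b

/-- `(A, B) ≤ (C, D)` if `A ⊆ C` and `B ⊇ D`. -/
def SepLE {V : Type u} (s t : Set V × Set V) : Prop := s.1 ⊆ t.1 ∧ t.2 ⊆ s.2

/-- Stars of finite order separations: any two distinct elements point towards each other. -/
def IsStar {V : Type u} (G : SimpleGraph V) (σ : Set (Set V × Set V)) : Prop :=
  (∀ s ∈ σ, IsSep G s) ∧ ∀ s ∈ σ, ∀ t ∈ σ, s ≠ t → SepLE s t.swap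

/-- The interior of a star: the intersection of all the big sides. -/
def starInterior {V : Type u} (σ : Set (Set V × Set V)) : Set V := ⋂ s ∈ σ, s.2

/-- The `ℵ₀`-tangles of `G`: the consistent orientations of the set of all finite order
separations of `G` that avoid all finite stars with finite interior. -/
@[ext]
structure Tangle {V : Type u} (G : SimpleGraph V) : Type u where
  carrier : Set (Set V × Set V)
  isSep : ∀ s ∈ carrier, IsSep G s
  /-- precisely one of `(A, B)` and `(B, A)` is chosen -/
  orients : ∀ s, IsSep G s → (s ∈ carrier ↔ s.swap ∉ carrier)
  /-- no two distinct chosen separations point away from each other -/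
  consistent : ∀ s ∈ carrier, ∀ t ∈ carrier, s ≠ t → ¬ (SepLE s.swap t ∧ s.swap ≠ t)
  avoids : ∀ σ ⊆ carrier, IsStar G σ → σ.Finite → ¬ (starInterior σ).Finite

/-- The separation `s_{X → 𝒞} = (V \ V[𝒞], X ∪ V[𝒞])`. -/
def sepTo {V : Type u} {G : SimpleGraph V} (X : Finset V) (𝒞 : Set (Comp G X)) : Set V × Set V :=
  ((verts 𝒞)ᶜ, (X : Set V) ∪ verts 𝒞)

/-- `U(τ, X)`: the set of all `𝒞 ⊆ 𝒞_X` with `s_{X → 𝒞} ∈ τ` (this is an ultrafilter). -/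
def Tangle.U {V : Type u} {G : SimpleGraph V} (τ : Tangle G) (X : Finset V) :
    Set (Set (Comp G X)) :=
  {𝒞 | sepTo X 𝒞 ∈ τ.carrier}

theorem IsSep.swap {V : Type u} {G : SimpleGraph V} {s : Set V × Set V} (hs : IsSep G s) :
    IsSep G s.swap :=
  ⟨inter_comm s.1 s.2 ▸ hs.1, union_comm s.1 s.2 ▸ hs.2.1,
    fun a ha b hb hab => hs.2.2 b hb a ha hab.symm⟩

theorem IsSep.comp_subset {V : Type u} {G : SimpleGraph V} {s : Set V × Set V} (hs : IsSep G s)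
    {X : Finset V} (hX : (X : Set V) = s.1 ∩ s.2) (C : Comp G X) {x : V} (hx : x ∈ C)
    (hxs : x ∈ s.2 \ s.1) : (C : Set V) ⊆ s.2 \ s.1 := by
  refine comp_subset_of_closed C ?_ hx hxs
  intro a ha b hb hab
  have hb' : b ∉ s.1 ∩ s.2 := hX ▸ hb
  have hu : b ∈ s.1 ∪ s.2 := hs.2.1 ▸ mem_univ b
  by_cases h1 : b ∈ s.1
  · exact absurd hab.symm (hs.2.2 b ⟨h1, fun h2 => hb' ⟨h1, h2⟩⟩ a ha)
  · exact ⟨hu.resolve_left h1, h1⟩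

theorem IsSep.comp_subset_iff {V : Type u} {G : SimpleGraph V} {s : Set V × Set V}
    (hs : IsSep G s) (r : Ray G) :
    ((Ends.comp hs.1.toFinset (Quotient.mk (raySetoid G) r) : Comp G _) : Set V) ⊆ s.2 \ s.1 ↔
      r.TailIn (s.2 \ s.1) := by
  have ht := Ends.tailIn_comp hs.1.toFinset r
  constructor
  · intro hsub
    obtain ⟨N, hN⟩ := ht
    exact ⟨N, fun n hn => hsub (hN n hn)⟩
  · intro htail
    obtain ⟨x, hx, hx'⟩ := (ht.inter htail).nonempty
    exact hs.comp_subset hs.1.coe_toFinset _ hx hx'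

theorem IsSep.tail_or {V : Type u} {G : SimpleGraph V} {s : Set V × Set V} (hs : IsSep G s)
    (r : Ray G) : r.TailIn (s.2 \ s.1) ∨ r.TailIn (s.1 \ s.2) := by
  obtain ⟨N, hN⟩ := Ends.tailIn_comp hs.1.toFinset r
  have hx := hN N le_rfl
  have hxX : r.vertex N ∉ s.1 ∩ s.2 := fun h =>
    not_mem_of_mem_comp hx (hs.1.mem_toFinset.2 h)
  have hu : r.vertex N ∈ s.1 ∪ s.2 := hs.2.1 ▸ mem_univ _
  by_cases h1 : r.vertex N ∈ s.1
  · exact Or.inr ⟨N, fun n hn => hs.swap.comp_subset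
      (hs.1.coe_toFinset.trans (inter_comm _ _)) _ hx ⟨h1, fun h2 => hxX ⟨h1, h2⟩⟩ (hN n hn)⟩
  · exact Or.inl ⟨N, fun n hn => hs.comp_subset hs.1.coe_toFinset _ hx
      ⟨hu.resolve_left h1, h1⟩ (hN n hn)⟩

/-- The set `{(A, B) | C(A ∩ B, ω) ⊆ G[B \ A]}` of oriented finite order separations. -/
def endOrientation {V : Type u} {G : SimpleGraph V} (ω : Ends G) : Set (Set V × Set V) :=
  {s | ∃ hs : IsSep G s, (Ends.comp hs.1.toFinset ω : Set V) ⊆ s.2 \ s.1}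

theorem mem_endOrientation_iff {V : Type u} {G : SimpleGraph V} (r : Ray G)
    (s : Set V × Set V) : s ∈ endOrientation (Quotient.mk (raySetoid G) r : Ends G) ↔
      IsSep G s ∧ r.TailIn (s.2 \ s.1) :=
  ⟨fun ⟨hs, h⟩ => ⟨hs, (hs.comp_subset_iff r).1 h⟩,
    fun ⟨hs, h⟩ => ⟨hs, (hs.comp_subset_iff r).2 h⟩⟩

theorem Ray.not_tailIn_swap {V : Type u} {G : SimpleGraph V} {r : Ray G} {A B C D : Set V}
    (h : r.TailIn (A \ B)) (h' : r.TailIn (D \ C)) (hAC : A ⊆ C) : False := by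
  obtain ⟨x, hx, hx'⟩ := (h.inter h').nonempty
  exact hx'.2 (hAC hx.1)

/-- The end tangle `τ_ω` of an end `ω`. -/
def endTangle {V : Type u} {G : SimpleGraph V} (ω : Ends G) : Tangle G where
  carrier := endOrientation ω
  isSep s hs := hs.1
  orients s hs := by
    induction ω using Quotient.inductionOn with
    | h r =>
      rw [mem_endOrientation_iff, mem_endOrientation_iff]
      constructor
      · rintro ⟨-, h⟩ ⟨-, h'⟩
        exact Ray.not_tailIn_swap h' h Subset.rfl
      · intro h
        exact ⟨hs, (hs.tail_or r).resolve_right fun h' => h ⟨hs.swap, h'⟩⟩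
  consistent s hs t ht _ hle := by
    induction ω using Quotient.inductionOn with
    | h r =>
      rw [mem_endOrientation_iff] at hs ht
      exact Ray.not_tailIn_swap hs.2 ht.2 hle.1.1
  avoids σ hσ _ hfin hint := by
    induction ω using Quotient.inductionOn with
    | h r =>
      have key : r.TailIn (starInterior σ) := by
        have h1 : ∀ s ∈ σ, ∃ N, ∀ n, N ≤ n → r.vertex n ∈ s.2 := fun s hs => by
          obtain ⟨N, hN⟩ := ((mem_endOrientation_iff r s).1 (hσ hs)).2
          exact ⟨N, fun n hn => (hN n hn).1⟩
        choose! N hN using h1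
        obtain ⟨M, hM⟩ := (hfin.image N).bddAbove
        exact ⟨M, fun n hn => mem_iInter₂.2 fun s hs =>
          hN s hs n ((hM (mem_image_of_mem N hs)).trans hn)⟩
      exact key.infinite hint

/-! ## The tangle compactification and its quotient -/

/-- The points of the tangle compactification `|G|_Θ = G ⊔ Θ`. -/
def TangleSpace {V : Type u} (G : SimpleGraph V) : Type u := Ext G (Tangle G)

noncomputable instance instTopTangleSpace {V : Type u} (G : SimpleGraph V) :
    TopologicalSpace (TangleSpace G) :=
  extTopology {S | ∃ (X : Finset V) (𝒞 : Set (Comp G X)),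
    S = basicNhd X 𝒞 {τ : Tangle G | 𝒞 ∈ τ.U X}}

/-- The canonical map from `|G|_Ω` to `|G|_Θ`. -/
def tangleMap {V : Type u} (G : SimpleGraph V) : EndSpace G → TangleSpace G
  | .pt z => .pt z
  | .lim ω => .lim (endTangle ω)

/-- `𝒳_τ`: the collection of all finite `X` for which the ultrafilter `U(τ, X)` is free. -/
def Tangle.free {V : Type u} {G : SimpleGraph V} (τ : Tangle G) : Set (Finset V) :=
  {X | ⋂₀ τ.U X = ∅}

/-- `τ ∼ τ'`: both are ultrafilter tangles (that is, `𝒳_τ` and `𝒳_τ'` are non-empty) and the least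
elements `X_τ` of `𝒳_τ` and `X_τ'` of `𝒳_τ'` coincide. -/
def Tangle.Equiv {V : Type u} {G : SimpleGraph V} (τ τ' : Tangle G) : Prop :=
  ∃ X : Finset V, IsLeast τ.free X ∧ IsLeast τ'.free X

/-- The equivalence relation on `|G|_Θ` that identifies equivalent ultrafilter tangles. -/
def tangleSetoid {V : Type u} (G : SimpleGraph V) : Setoid (TangleSpace G) where
  r p q := p = q ∨ ∃ τ τ' : Tangle G, p = .lim τ ∧ q = .lim τ' ∧ τ.Equiv τ'
  iseqv := by
    refine ⟨fun p => Or.inl rfl, ?_, ?_⟩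
    · rintro p q (rfl | ⟨τ, τ', rfl, rfl, X, h, h'⟩)
      · exact Or.inl rfl
      · exact Or.inr ⟨τ', τ, rfl, rfl, X, h', h⟩
    · rintro p q t (rfl | ⟨τ, τ', rfl, rfl, X, h, h'⟩) (rfl | ⟨σ, σ', e, rfl, Y, k, k'⟩)
      · exact Or.inl rfl
      · exact Or.inr ⟨σ, σ', e, rfl, Y, k, k'⟩
      · exact Or.inr ⟨τ, τ', rfl, rfl, X, h, h'⟩
      · cases e
        obtain rfl := h'.unique k
        exact Or.inr ⟨τ, σ', rfl, rfl, X, h, k'⟩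

/-- The quotient space `|G|_Θ / ∼`. -/
abbrev TangleQuotient {V : Type u} (G : SimpleGraph V) : Type u := Quotient (tangleSetoid G)

/-- The canonical map from `|G|_Ω` to `|G|_Θ / ∼`. -/
def tangleQuotientMap {V : Type u} (G : SimpleGraph V) : EndSpace G → TangleQuotient G :=
  fun p => Quotient.mk (tangleSetoid G) (tangleMap G p)

end InfGraph

open InfGraph

universe w'

namespace InfGraph

open Set Topology

/-! ## Topology of the 1-complex -/

/-! The comparison is made between `𝒞`-systems, where all spaces are compact Hausdorff, and then
carried over to the induced spaces.

The Stone–Čech system is greatest by the universal property of `β`. For `𝒞^Γ`, the point is that in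
any `𝒞`-system the sets `𝒞_X(Y)` with `Y ⊆ X` have pairwise disjoint closures in `α(𝒞_X)`
(`disjoint_closure`). If `y ∈ Y \ Y'`, the bonding map to `X \ {y}` sends every component with
neighbourhood `Y` to the component containing `y`, which is an isolated point, and sends no
component with neighbourhood `Y'` there. As `X` has only finitely many subsets, each added point of
`α(𝒞_X)` lies in the closure of exactly one `𝒞_X(Y)`; this `Y` must be critical, and the point is
sent to it (`exists_tendsto_gam`). Compatibility with the bonding maps follows by density.

The induced spaces need not be Hausdorff: a vertex of infinite degree may be inseparable from a
limit point. Two standard facts therefore need other proofs. A comparison of systems induces a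
quotient map, because ultrafilters converging to limit points lift (`isQuotientMap_spaceMap`).
Mutually comparable induced spaces are equivalent, because an ultrafilter of vertices converging to
a limit point has no other limit (`eq_limPt_of_le_nhds`).

Tangles enter through the bijection `τ ↦ (U(τ, X))_X` onto the inverse limit of the spaces `β(𝒞_X)`,
which makes `|G|_Θ` the space induced by the Stone–Čech system. The map from it to `|G|_Γ` sends a
tangle to a limit point with a critical coordinate precisely when the tangle is an ultrafilter
tangle, and that critical set is then `X_τ`. Hence the fibres are the classes of `∼`. -/

theorem OneComplex.isOpen_iff {V : Type u} {G : SimpleGraph V} {S : Set (OneComplex G)} :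
    IsOpen S ↔ ∀ e : G.edgeSet, IsOpen (edgePath e ⁻¹' S) := by
  rw [isOpen_iSup_iff]
  exact Iff.rfl

theorem continuous_edgePath {V : Type u} {G : SimpleGraph V} (e : G.edgeSet) :
    Continuous (edgePath e) :=
  continuous_def.2 fun _ hS => OneComplex.isOpen_iff.1 hS e

theorem edgePath_zero {V : Type u} {G : SimpleGraph V} (e : G.edgeSet) :
    edgePath e ⟨0, left_mem_Icc.2 zero_le_one⟩ = .vert (ends e).1 := by
  simp [edgePath]

theorem edgePath_one {V : Type u} {G : SimpleGraph V} (e : G.edgeSet) :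
    edgePath e ⟨1, right_mem_Icc.2 zero_le_one⟩ = .vert (ends e).2 := by
  simp [edgePath]

theorem edgePath_inner {V : Type u} {G : SimpleGraph V} (e : G.edgeSet) (t : Ioo (0 : ℝ) 1) :
    edgePath e ⟨t, Ioo_subset_Icc_self t.2⟩ = .inner e t := by
  simp [edgePath, t.2.1.ne', t.2.2.ne]

theorem exists_edgePath_eq_inner {V : Type u} {G : SimpleGraph V} (e : G.edgeSet)
    (t : Icc (0 : ℝ) 1) :
    (∃ s, edgePath e t = .inner e s) ∨ (t : ℝ) = 0 ∨ (t : ℝ) = 1 := by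
  by_cases h0 : (t : ℝ) = 0
  · exact Or.inr (Or.inl h0)
  by_cases h1 : (t : ℝ) = 1
  · exact Or.inr (Or.inr h1)
  · exact Or.inl ⟨_, by rw [edgePath, dif_neg h0, dif_neg h1]⟩

theorem mk_ends {V : Type u} {G : SimpleGraph V} (e : G.edgeSet) :
    s((ends e).1, (ends e).2) = (e : Sym2 V) :=
  Quot.out_eq (e : Sym2 V)

/-- A set whose preimage in an edge contains all inner points of the edge has an open preimage. -/
theorem isOpen_edgePath_preimage {V : Type u} {G : SimpleGraph V} {S : Set (OneComplex G)}
    {e : G.edgeSet} (h : ∀ t, .inner e t ∈ S) : IsOpen (edgePath e ⁻¹' S) := by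
  -- The complement consists of endpoints of the interval only, so it is finite and hence closed.
  rw [← isClosed_compl_iff]
  refine Finite.isClosed (Finite.subset (s := Subtype.val ⁻¹' ({0, 1} : Set ℝ)) ?_ ?_)
  · exact Finite.preimage Subtype.val_injective.injOn (by simp)
  · intro t ht
    rcases exists_edgePath_eq_inner e t with ⟨s, hs⟩ | h' | h'
    · exact absurd (show edgePath e t ∈ S from hs ▸ h s) ht
    · exact Or.inl h'
    · exact Or.inr h'

/-- Applied to the inner points together with a single vertex, this shows that vertices become
isolated among the vertices once inner points are deleted, even at infinite degree. -/
theorem isOpen_of_innerPoints_subset {V : Type u} {G : SimpleGraph V} {S : Set (OneComplex G)}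
    (h : innerPoints G ⊆ S) : IsOpen S :=
  OneComplex.isOpen_iff.2 fun e => isOpen_edgePath_preimage fun t => h ⟨e, t, rfl⟩

/-- Membership of an inner point depends only on its edge. An edge with no inner point in the region
has no endvertex in a component from `𝒞`, so its trace is empty. -/
theorem isOpen_region {V : Type u} {G : SimpleGraph V} (X : Finset V) (𝒞 : Set (Comp G X)) :
    IsOpen (region X 𝒞) := by
  refine OneComplex.isOpen_iff.2 fun e => ?_
  by_cases he : ∃ t, .inner e t ∈ region X 𝒞
  · obtain ⟨_, ht⟩ := he
    exact isOpen_edgePath_preimage fun t => ht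
  · convert isOpen_empty
    have hadj : ∀ x y, (e : Sym2 V) = s(x, y) → ∀ C ∈ 𝒞, x ∉ C := by
      intro x y hxy C hC hx
      have had : G.Adj x y := by
        have := e.2
        rwa [hxy] at this
      refine he ⟨⟨1 / 2, by norm_num⟩, ?_⟩
      by_cases hy : y ∈ X
      · exact Or.inr ⟨C, hC, y, hy, x, hx, hxy.trans Sym2.eq_swap⟩
      · refine Or.inl ⟨C, hC, fun v hv => ?_⟩
        rw [hxy, Sym2.mem_iff] at hv
        rcases hv with rfl | rfl
        · exact hx
        · exact mem_comp_of_adj hx hy had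
    rw [eq_empty_iff_forall_notMem]
    intro t ht
    rcases exists_edgePath_eq_inner e t with ⟨s, hs⟩ | h' | h'
    · exact he ⟨s, hs ▸ ht⟩
    · obtain rfl : t = ⟨0, left_mem_Icc.2 zero_le_one⟩ := Subtype.ext h'
      rw [mem_preimage, edgePath_zero] at ht
      obtain ⟨C, hC, hx⟩ := ht
      exact hadj _ _ (mk_ends e).symm C hC hx
    · obtain rfl : t = ⟨1, right_mem_Icc.2 zero_le_one⟩ := Subtype.ext h'
      rw [mem_preimage, edgePath_one] at ht
      obtain ⟨C, hC, hx⟩ := ht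
      exact hadj _ _ ((mk_ends e).symm.trans Sym2.eq_swap) C hC hx

/-- An edge between a component of `G - X'` and a vertex of `X' \ X` is absorbed into the component
of `G - X` including that component. -/
theorem region_subset {V : Type u} {G : SimpleGraph V} {X X' : Finset V} (h : X ⊆ X')
    {𝒞 : Set (Comp G X)} {𝒞' : Set (Comp G X')} (h𝒞 : MapsTo (compMap h) 𝒞' 𝒞) :
    region X' 𝒞' ⊆ region X 𝒞 := by
  rintro (v | ⟨e, t⟩) hz
  · obtain ⟨C, hC, hv⟩ := hz
    exact ⟨_, h𝒞 hC, subset_compMap h C hv⟩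
  · rcases hz with ⟨C, hC, hv⟩ | ⟨C, hC, x, hx, y, hy, hxy⟩
    · exact Or.inl ⟨_, h𝒞 hC, fun v hve => subset_compMap h C (hv v hve)⟩
    · have hy' := subset_compMap h C hy
      by_cases hxX : x ∈ X
      · exact Or.inr ⟨_, h𝒞 hC, x, hxX, y, hy', hxy⟩
      · refine Or.inl ⟨_, h𝒞 hC, fun v hv => ?_⟩
        have had : G.Adj x y := by
          have := e.2
          rwa [hxy] at this
        rw [hxy, Sym2.mem_iff] at hv
        rcases hv with rfl | rfl
        · exact mem_comp_of_adj hy' hxX had.symm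
        · exact hy'

theorem disjoint_region {V : Type u} {G : SimpleGraph V} {X : Finset V} {𝒞 𝒟 : Set (Comp G X)}
    (h : Disjoint 𝒞 𝒟) : Disjoint (region X 𝒞) (region X 𝒟) := by
  have key : ∀ C ∈ 𝒞, ∀ D ∈ 𝒟, ∀ v, v ∈ C → v ∉ D := fun C hC D hD v hv hv' =>
    Set.disjoint_left.1 h hC (comp_eq_of_mem hv hv' ▸ hD)
  rw [Set.disjoint_left]
  rintro (v | ⟨e, t⟩) hz hz'
  · obtain ⟨C, hC, hv⟩ := hz
    obtain ⟨D, hD, hv'⟩ := hz'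
    exact key C hC D hD v hv hv'
  · rcases hz with ⟨C, hC, hv⟩ | ⟨C, hC, x, hx, y, hy, hxy⟩ <;>
    rcases hz' with ⟨D, hD, hv'⟩ | ⟨D, hD, x', hx', y', hy', hxy'⟩
    · exact key C hC D hD _ (hv _ (Sym2.out_fst_mem _)) (hv' _ (Sym2.out_fst_mem _))
    · exact not_mem_of_mem_comp (hv x' (by simp [hxy'])) hx'
    · exact not_mem_of_mem_comp (hv' x (by simp [hxy])) hx
    · have : y ∈ s(x', y') := by rw [← hxy', hxy]; simp
      rcases Sym2.mem_iff.1 this with rfl | rfl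
      · exact not_mem_of_mem_comp hy hx'
      · exact key C hC D hD _ hy hy'

theorem region_union {V : Type u} {G : SimpleGraph V} (X : Finset V) (𝒞 𝒟 : Set (Comp G X)) :
    region X (𝒞 ∪ 𝒟) = region X 𝒞 ∪ region X 𝒟 := by
  ext (v | ⟨e, t⟩)
  · change (∃ C ∈ 𝒞 ∪ 𝒟, v ∈ C) ↔ (∃ C ∈ 𝒞, v ∈ C) ∨ (∃ C ∈ 𝒟, v ∈ C)
    simp only [mem_union, or_and_right, exists_or]
  · change ((∃ C ∈ 𝒞 ∪ 𝒟, _) ∨ (∃ C ∈ 𝒞 ∪ 𝒟, _)) ↔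
      ((∃ C ∈ 𝒞, _) ∨ (∃ C ∈ 𝒞, _)) ∨ ((∃ C ∈ 𝒟, _) ∨ (∃ C ∈ 𝒟, _))
    simp only [mem_union, or_and_right, exists_or]
    exact or_or_or_comm

/-- The subgraph induced by a finite set of vertices is compact. -/
theorem exists_isCompact_compl_region {V : Type u} (G : SimpleGraph V) (X : Finset V) :
    ∃ K : Set (OneComplex G), IsCompact K ∧ (region X univ)ᶜ ⊆ K := by
  have hfin : {e : G.edgeSet | ∀ v ∈ (e : Sym2 V), v ∈ X}.Finite := by
    refine Finite.of_finite_image (f := Subtype.val) ?_ Subtype.val_injective.injOn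
    refine X.sym2.finite_toSet.subset ?_
    rintro _ ⟨e, he, rfl⟩
    exact Finset.mem_coe.2 (Finset.mem_sym2_iff.2 he)
  -- Only finitely many edges have both ends in `X`. The vertices are added separately, since some
  -- of them may lie on no such edge.
  refine ⟨OneComplex.vert '' X ∪ ⋃ e ∈ {e : G.edgeSet | ∀ v ∈ (e : Sym2 V), v ∈ X},
    range (edgePath e), ((X.finite_toSet.image _).isCompact).union
      (hfin.isCompact_biUnion fun e _ => isCompact_range (continuous_edgePath e)), ?_⟩
  rintro (v | ⟨e, t⟩) hz
  · refine Or.inl ⟨v, ?_, rfl⟩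
    by_contra hv
    exact hz ⟨compOf G hv, mem_univ _, mem_compOf G hv⟩
  · refine Or.inr (mem_iUnion₂.2 ⟨e, ?_, _, edgePath_inner e t⟩)
    intro v hv
    by_contra hvX
    refine hz ?_
    obtain ⟨y, hy⟩ := Sym2.mem_iff_exists.1 hv
    have had : G.Adj v y := by
      have := e.2
      rwa [hy] at this
    by_cases hyX : y ∈ X
    · exact Or.inr ⟨_, mem_univ _, y, hyX, v, mem_compOf G hvX, hy.trans Sym2.eq_swap⟩
    · refine Or.inl ⟨_, mem_univ (compOf G hvX), fun w hw => ?_⟩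
      rw [hy, Sym2.mem_iff] at hw
      rcases hw with rfl | rfl
      · exact mem_compOf G hvX
      · exact mem_comp_of_adj (mem_compOf G hvX) hyX had

/-! ## Spaces obtained by adding points to the 1-complex -/

theorem Ext.pt_injective {V : Type u} {G : SimpleGraph V} {I : Type v} :
    Function.Injective (Ext.pt : OneComplex G → Ext G I) := fun _ _ h => by
  cases h; rfl

theorem Ext.lim_injective {V : Type u} {G : SimpleGraph V} {I : Type v} :
    Function.Injective (Ext.lim : I → Ext G I) := fun _ _ h => by
  cases h; rfl

theorem pt_mem_basicNhd {V : Type u} {G : SimpleGraph V} {I : Type v} {X : Finset V}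
    {𝒞 : Set (Comp G X)} {P : Set I} {z : OneComplex G} :
    Ext.pt z ∈ basicNhd X 𝒞 P ↔ z ∈ region X 𝒞 := by
  constructor
  · rintro (⟨_, h, e⟩ | ⟨_, _, e⟩) <;> cases e
    exact h
  · exact fun h => Or.inl ⟨z, h, rfl⟩

theorem lim_mem_basicNhd {V : Type u} {G : SimpleGraph V} {I : Type v} {X : Finset V}
    {𝒞 : Set (Comp G X)} {P : Set I} {i : I} :
    Ext.lim i ∈ basicNhd X 𝒞 P ↔ i ∈ P := by
  constructor
  · rintro (⟨_, _, e⟩ | ⟨_, h, e⟩) <;> cases e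
    exact h
  · exact fun h => Or.inr ⟨i, h, rfl⟩

/-- The map `G ⊔ I → G ⊔ J` that is the identity on `G` and extends a map `I → J`. -/
def Ext.map {V : Type u} {G : SimpleGraph V} {I : Type v} {J : Type w} (f : I → J) :
    Ext G I → Ext G J
  | .pt z => .pt z
  | .lim i => .lim (f i)

theorem Ext.map_preimage_image_pt {V : Type u} {G : SimpleGraph V} {I : Type v} {J : Type w}
    (f : I → J) (U : Set (OneComplex G)) : Ext.map f ⁻¹' (Ext.pt '' U) = Ext.pt '' U := by
  ext (z | i)
  · exact Ext.pt_injective.mem_set_image.trans Ext.pt_injective.mem_set_image.symm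
  · constructor <;> rintro ⟨_, _, e⟩ <;> cases e

theorem Ext.map_preimage_basicNhd {V : Type u} {G : SimpleGraph V} {I : Type v} {J : Type w}
    (f : I → J) (X : Finset V) (𝒞 : Set (Comp G X)) (P : Set J) :
    Ext.map f ⁻¹' (basicNhd X 𝒞 P) = basicNhd X 𝒞 (f ⁻¹' P) := by
  ext (z | i)
  · exact pt_mem_basicNhd.trans pt_mem_basicNhd.symm
  · exact lim_mem_basicNhd.trans (lim_mem_basicNhd (P := f ⁻¹' P)).symm

theorem isOpen_image_pt {V : Type u} {G : SimpleGraph V} {I : Type v} (B : Set (Set (Ext G I)))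
    {U : Set (OneComplex G)} (hU : IsOpen U) : IsOpen[extTopology B] (Ext.pt '' U) :=
  TopologicalSpace.isOpen_generateFrom_of_mem (Or.inl ⟨U, hU, rfl⟩)

theorem Ext.continuous_map {V : Type u} {G : SimpleGraph V} {I : Type v} {J : Type w}
    {B : Set (Set (Ext G I))} {B' : Set (Set (Ext G J))} {f : I → J}
    (h : ∀ S ∈ B', IsOpen[extTopology B] (Ext.map f ⁻¹' S)) :
    Continuous[extTopology B, extTopology B'] (Ext.map f) := by
  refine continuous_generateFrom_iff.2 ?_
  rintro S (⟨U, hU, rfl⟩ | hS)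
  · rw [Ext.map_preimage_image_pt]
    exact isOpen_image_pt B hU
  · exact h S hS

/-! ## Spaces induced by `𝒞`-systems -/

/-- A point of the 1-complex of `G`, as a point of `|G|_Ω`. -/
def EndSpace.pt {V : Type u} {G : SimpleGraph V} (z : OneComplex G) : EndSpace G := Ext.pt z

/-- An end of `G`, as a point of `|G|_Ω`. -/
def EndSpace.ofEnd {V : Type u} {G : SimpleGraph V} (ω : Ends G) : EndSpace G := Ext.lim ω

theorem EndSpace.eq_pt_or_eq_ofEnd {V : Type u} {G : SimpleGraph V} (x : EndSpace G) :
    (∃ z, x = EndSpace.pt z) ∨ ∃ ω, x = EndSpace.ofEnd ω := by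
  rcases x with z | ω
  · exact Or.inl ⟨z, rfl⟩
  · exact Or.inr ⟨ω, rfl⟩

theorem EndSpace.isOpen_image {V : Type u} {G : SimpleGraph V} {U : Set (OneComplex G)}
    (hU : IsOpen U) : IsOpen (EndSpace.pt '' U : Set (EndSpace G)) :=
  isOpen_image_pt _ hU

namespace CSystem

/-- The coordinates of a point of the inverse limit. -/
def Limit.coord {V : Type u} {G : SimpleGraph V} {𝒮 : CSystem.{u, w} G} (p : 𝒮.Limit)
    (X : Finset V) : 𝒮.space X :=
  p.1 X

theorem Limit.bond_coord {V : Type u} {G : SimpleGraph V} {𝒮 : CSystem.{u, w} G} (p : 𝒮.Limit)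
    {X X' : Finset V} (h : X ⊆ X') : 𝒮.bond h (p.coord X') = p.coord X :=
  p.2 X X' h

theorem Limit.ext {V : Type u} {G : SimpleGraph V} {𝒮 : CSystem.{u, w} G} {p q : 𝒮.Limit}
    (h : ∀ X, p.coord X = q.coord X) : p = q :=
  Subtype.ext (funext h)

theorem Limit.exists_coord_ne {V : Type u} {G : SimpleGraph V} {𝒮 : CSystem.{u, w} G}
    {p q : 𝒮.Limit} (h : p ≠ q) : ∃ X, p.coord X ≠ q.coord X := by
  by_contra! hn
  exact h (Limit.ext hn)

/-- A point of the 1-complex of `G`, as a point of the space induced by a `𝒞`-system. -/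
def pt {V : Type u} {G : SimpleGraph V} (𝒮 : CSystem.{u, w} G) (z : OneComplex G) : 𝒮.Space :=
  Ext.pt z

/-- A point of the inverse limit, as a point of the space induced by a `𝒞`-system. -/
def limPt {V : Type u} {G : SimpleGraph V} (𝒮 : CSystem.{u, w} G) (p : 𝒮.Limit) : 𝒮.Space :=
  Ext.lim p

theorem eq_pt_or_eq_limPt {V : Type u} {G : SimpleGraph V} {𝒮 : CSystem.{u, w} G} (x : 𝒮.Space) :
    (∃ z, x = 𝒮.pt z) ∨ ∃ p, x = 𝒮.limPt p := by
  rcases x with z | p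
  · exact Or.inl ⟨z, rfl⟩
  · exact Or.inr ⟨p, rfl⟩

theorem pt_injective {V : Type u} {G : SimpleGraph V} (𝒮 : CSystem.{u, w} G) :
    Function.Injective 𝒮.pt :=
  Ext.pt_injective

theorem limPt_injective {V : Type u} {G : SimpleGraph V} (𝒮 : CSystem.{u, w} G) :
    Function.Injective 𝒮.limPt :=
  Ext.lim_injective

theorem pt_ne_limPt {V : Type u} {G : SimpleGraph V} {𝒮 : CSystem.{u, w} G} {z : OneComplex G}
    {p : 𝒮.Limit} : 𝒮.pt z ≠ 𝒮.limPt p := fun h => by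
  cases h

/-- The set `𝒪(X, α_X⁻¹(O), {p | p_X ∈ O})`. -/
def nhd {V : Type u} {G : SimpleGraph V} (𝒮 : CSystem.{u, w} G) (X : Finset V)
    (O : Set (𝒮.space X)) : Set 𝒮.Space :=
  basicNhd X (𝒮.emb X ⁻¹' O) {p : 𝒮.Limit | p.coord X ∈ O}

theorem pt_mem_nhd {V : Type u} {G : SimpleGraph V} {𝒮 : CSystem.{u, w} G} {X : Finset V}
    {O : Set (𝒮.space X)} {z : OneComplex G} :
    𝒮.pt z ∈ 𝒮.nhd X O ↔ z ∈ region X (𝒮.emb X ⁻¹' O) :=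
  pt_mem_basicNhd

theorem lim_mem_nhd {V : Type u} {G : SimpleGraph V} {𝒮 : CSystem.{u, w} G} {X : Finset V}
    {O : Set (𝒮.space X)} {p : 𝒮.Limit} : 𝒮.limPt p ∈ 𝒮.nhd X O ↔ p.coord X ∈ O :=
  lim_mem_basicNhd

theorem isOpen_nhd {V : Type u} {G : SimpleGraph V} (𝒮 : CSystem.{u, w} G) (X : Finset V)
    {O : Set (𝒮.space X)} (hO : IsOpen O) : IsOpen (𝒮.nhd X O) :=
  TopologicalSpace.isOpen_generateFrom_of_mem (Or.inr ⟨X, O, hO, rfl⟩)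

theorem isOpen_image {V : Type u} {G : SimpleGraph V} (𝒮 : CSystem.{u, w} G)
    {U : Set (OneComplex G)} (hU : IsOpen U) : IsOpen (𝒮.pt '' U) :=
  isOpen_image_pt _ hU

/-- This lets neighbourhoods taken at different finite sets be compared at a common larger one. -/
theorem nhd_subset_nhd {V : Type u} {G : SimpleGraph V} (𝒮 : CSystem.{u, w} G) {X X' : Finset V}
    (h : X ⊆ X') {O : Set (𝒮.space X)} {O' : Set (𝒮.space X')} (hO : MapsTo (𝒮.bond h) O' O) :
    𝒮.nhd X' O' ⊆ 𝒮.nhd X O := by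
  intro x hz
  obtain ⟨z, rfl⟩ | ⟨p, rfl⟩ := eq_pt_or_eq_limPt x
  · refine pt_mem_nhd.2 (region_subset h ?_ (pt_mem_nhd.1 hz))
    intro C hC
    have := hO hC
    rwa [𝒮.bond_emb] at this
  · have := hO (lim_mem_nhd.1 hz)
    rw [p.bond_coord] at this
    exact lim_mem_nhd.2 this

theorem nhd_mono {V : Type u} {G : SimpleGraph V} (𝒮 : CSystem.{u, w} G) {X : Finset V}
    {O O' : Set (𝒮.space X)} (h : O ⊆ O') : 𝒮.nhd X O ⊆ 𝒮.nhd X O' :=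
  𝒮.nhd_subset_nhd (Finset.Subset.refl X) fun p hp => by rw [𝒮.bond_self]; exact h hp

theorem disjoint_nhd {V : Type u} {G : SimpleGraph V} (𝒮 : CSystem.{u, w} G) {X : Finset V}
    {O O' : Set (𝒮.space X)} (h : Disjoint O O') : Disjoint (𝒮.nhd X O) (𝒮.nhd X O') := by
  rw [Set.disjoint_left]
  intro x hx hx'
  obtain ⟨z, rfl⟩ | ⟨p, rfl⟩ := eq_pt_or_eq_limPt x
  · exact Set.disjoint_left.1 (disjoint_region (h.preimage (𝒮.emb X))) (pt_mem_nhd.1 hx)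
      (pt_mem_nhd.1 hx')
  · exact Set.disjoint_left.1 h (lim_mem_nhd.1 hx) (lim_mem_nhd.1 hx')

theorem nhd_union {V : Type u} {G : SimpleGraph V} (𝒮 : CSystem.{u, w} G) {X : Finset V}
    (O O' : Set (𝒮.space X)) : 𝒮.nhd X (O ∪ O') = 𝒮.nhd X O ∪ 𝒮.nhd X O' := by
  ext x
  obtain ⟨z, rfl⟩ | ⟨p, rfl⟩ := eq_pt_or_eq_limPt x
  · rw [pt_mem_nhd, preimage_union, region_union, mem_union, mem_union, pt_mem_nhd, pt_mem_nhd]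
  · rw [lim_mem_nhd, mem_union, mem_union, lim_mem_nhd, lim_mem_nhd]

/-- The sets `nhd X O` containing a limit point form a neighbourhood base there because the finite
vertex sets are directed: two of them can be pulled back to `X ∪ X'`. Images of open sets of `G`
contain no limit point. -/
theorem exists_nhd_subset {V : Type u} {G : SimpleGraph V} (𝒮 : CSystem.{u, w} G) {p : 𝒮.Limit}
    {U : Set 𝒮.Space} (hU : IsOpen U) (hp : 𝒮.limPt p ∈ U) :
    ∃ (X : Finset V) (O : Set (𝒮.space X)), IsOpen O ∧ p.coord X ∈ O ∧ 𝒮.nhd X O ⊆ U := by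
  classical
  induction hU with
  | basic S hS =>
    rcases hS with ⟨U, -, rfl⟩ | ⟨X, O, hO, rfl⟩
    · obtain ⟨_, _, e⟩ := hp
      exact absurd e pt_ne_limPt
    · exact ⟨X, O, hO, lim_mem_nhd.1 hp, Subset.rfl⟩
  | univ => exact ⟨∅, univ, isOpen_univ, mem_univ _, subset_univ _⟩
  | inter S T _ _ ihS ihT =>
    obtain ⟨X, O, hO, hpO, hS⟩ := ihS hp.1
    obtain ⟨X', O', hO', hpO', hT⟩ := ihT hp.2
    have h : X ⊆ X ∪ X' := Finset.subset_union_left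
    have h' : X' ⊆ X ∪ X' := Finset.subset_union_right
    refine ⟨X ∪ X', 𝒮.bond h ⁻¹' O ∩ 𝒮.bond h' ⁻¹' O',
      (hO.preimage (𝒮.continuous_bond h)).inter (hO'.preimage (𝒮.continuous_bond h')),
      ⟨?_, ?_⟩, subset_inter ?_ ?_⟩
    · rw [mem_preimage, p.bond_coord]
      exact hpO
    · rw [mem_preimage, p.bond_coord]
      exact hpO'
    · exact (𝒮.nhd_subset_nhd h fun q hq => hq.1).trans hS
    · exact (𝒮.nhd_subset_nhd h' fun q hq => hq.2).trans hT
  | sUnion 𝒰 _ ih =>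
    obtain ⟨S, hS, hpS⟩ := hp
    obtain ⟨X, O, hO, hpO, h⟩ := ih S hS hpS
    exact ⟨X, O, hO, hpO, h.trans (subset_sUnion_of_mem hS)⟩

theorem mem_nhds_lim_iff {V : Type u} {G : SimpleGraph V} (𝒮 : CSystem.{u, w} G) {p : 𝒮.Limit}
    {U : Set 𝒮.Space} : U ∈ 𝓝 (𝒮.limPt p) ↔
      ∃ (X : Finset V) (O : Set (𝒮.space X)), IsOpen O ∧ p.coord X ∈ O ∧ 𝒮.nhd X O ⊆ U := by
  constructor
  · intro hU
    obtain ⟨W, hWU, hW, hp⟩ := mem_nhds_iff.1 hU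
    obtain ⟨X, O, hO, hpO, h⟩ := 𝒮.exists_nhd_subset hW hp
    exact ⟨X, O, hO, hpO, h.trans hWU⟩
  · rintro ⟨X, O, hO, hpO, h⟩
    exact Filter.mem_of_superset ((𝒮.isOpen_nhd X hO).mem_nhds (lim_mem_nhd.2 hpO)) h

theorem nhd_univ_mem_nhds {V : Type u} {G : SimpleGraph V} (𝒮 : CSystem.{u, w} G)
    (p : 𝒮.Limit) (X : Finset V) : 𝒮.nhd X univ ∈ 𝓝 (𝒮.limPt p) :=
  𝒮.mem_nhds_lim_iff.2 ⟨X, univ, isOpen_univ, mem_univ _, Subset.rfl⟩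

/-- Every neighbourhood of a limit point contains a vertex. -/
theorem exists_vert_mem {V : Type u} {G : SimpleGraph V} (𝒮 : CSystem.{u, w} G)
    {p : 𝒮.Limit} {U : Set 𝒮.Space} (hU : U ∈ 𝓝 (𝒮.limPt p)) :
    ∃ v, 𝒮.pt (.vert v) ∈ U := by
  obtain ⟨X, O, hO, hpO, h⟩ := 𝒮.mem_nhds_lim_iff.1 hU
  obtain ⟨C, hC⟩ := (𝒮.isHausdorffCompactification X).dense.exists_mem_open hO ⟨_, hpO⟩
  obtain ⟨v, hv⟩ := comp_nonempty C
  exact ⟨v, h (pt_mem_nhd.2 ⟨C, hC, hv⟩)⟩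

/-- Vertex ultrafilters serve twice later: any continuous map fixing `G` is pinned down by them, and
they can be lifted along comparison maps. -/
theorem exists_ultrafilter_le_nhds_lim {V : Type u} {G : SimpleGraph V} (𝒮 : CSystem.{u, w} G)
    (p : 𝒮.Limit) : ∃ F : Ultrafilter 𝒮.Space, (F : Filter 𝒮.Space) ≤ 𝓝 (𝒮.limPt p) ∧
      range (fun v => 𝒮.pt (.vert v)) ∈ F := by
  set L := 𝓝 (𝒮.limPt p) ⊓ Filter.principal (range fun v => 𝒮.pt (.vert v))
  have hne : L.NeBot := by
    rw [Filter.inf_principal_neBot_iff]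
    intro U hU
    obtain ⟨v, hv⟩ := 𝒮.exists_vert_mem hU
    exact ⟨_, hv, v, rfl⟩
  exact ⟨Ultrafilter.of L, (Ultrafilter.of_le L).trans inf_le_left,
    Filter.le_principal_iff.1 ((Ultrafilter.of_le L).trans inf_le_right)⟩

theorem continuous_pt {V : Type u} {G : SimpleGraph V} (𝒮 : CSystem.{u, w} G) :
    Continuous 𝒮.pt := by
  refine continuous_generateFrom_iff.2 ?_
  rintro _ (⟨U, hU, rfl⟩ | ⟨X, O, -, rfl⟩)
  · convert hU
    exact preimage_image_eq _ 𝒮.pt_injective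
  · convert isOpen_region X (𝒮.emb X ⁻¹' O)
    ext z
    exact pt_mem_basicNhd

/-! ### Convergence of ultrafilters and compactness -/

/-- Distinct limit points differ in some coordinate, and disjoint open sets of the Hausdorff space
`α(𝒞_X)` give disjoint neighbourhoods. This holds for limit points even when the whole space is not
Hausdorff. -/
theorem lim_unique {V : Type u} {G : SimpleGraph V} (𝒮 : CSystem.{u, w} G)
    {F : Filter 𝒮.Space} [F.NeBot] {p q : 𝒮.Limit} (hp : F ≤ 𝓝 (𝒮.limPt p))
    (hq : F ≤ 𝓝 (𝒮.limPt q)) : p = q := by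
  by_contra hne
  obtain ⟨X, hX⟩ := Limit.exists_coord_ne hne
  have := (𝒮.isHausdorffCompactification X).hausdorff
  obtain ⟨O, O', hO, hO', hpO, hqO, hd⟩ := t2_separation hX
  have h1 := hp ((𝒮.isOpen_nhd X hO).mem_nhds (lim_mem_nhd.2 hpO))
  have h2 := hq ((𝒮.isOpen_nhd X hO').mem_nhds (lim_mem_nhd.2 hqO))
  obtain ⟨x, hx, hx'⟩ := Filter.nonempty_of_mem (Filter.inter_mem h1 h2)
  exact Set.disjoint_left.1 (𝒮.disjoint_nhd hd) hx hx'

/-- The projection to `α(𝒞_X)` of an ultrafilter that contains `𝒪(X, 𝒞_X)`. -/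
def proj {V : Type u} {G : SimpleGraph V} (𝒮 : CSystem.{u, w} G) (F : Ultrafilter 𝒮.Space)
    {X : Finset V} (h : 𝒮.nhd X univ ∈ F) : Ultrafilter (𝒮.space X) :=
  Ultrafilter.ofComplNotMemIff
    { sets := {O | 𝒮.nhd X O ∈ F}
      univ_sets := h
      sets_of_superset := fun hO hle => Filter.mem_of_superset hO (𝒮.nhd_mono hle)
      inter_sets := by
        intro O O' hO hO'
        refine Filter.mem_of_superset (Filter.inter_mem hO hO') ?_
        rintro x ⟨hx, hx'⟩
        by_contra hn
        -- `nhd` is known to respect unions and disjointness, so intersections are handled by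
        -- splitting `O` along `O'`.
        have h1 : O ∩ O' ∪ O \ O' = O := inter_union_sdiff O O'
        rw [← h1, nhd_union] at hx
        exact Set.disjoint_left.1 (𝒮.disjoint_nhd disjoint_sdiff_left) (hx.resolve_left hn) hx' }
    (by
      intro O
      change 𝒮.nhd X Oᶜ ∉ F ↔ 𝒮.nhd X O ∈ F
      constructor
      · intro hn
        rw [← union_compl_self O, nhd_union] at h
        exact (Ultrafilter.union_mem_iff.1 h).resolve_right hn
      · intro h1 h2
        obtain ⟨x, hx, hx'⟩ := Filter.nonempty_of_mem (Filter.inter_mem h1 h2)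
        exact Set.disjoint_left.1 (𝒮.disjoint_nhd disjoint_compl_right) hx hx')

theorem mem_proj {V : Type u} {G : SimpleGraph V} {𝒮 : CSystem.{u, w} G}
    {F : Ultrafilter 𝒮.Space} {X : Finset V} {h : 𝒮.nhd X univ ∈ F} {O : Set (𝒮.space X)} :
    O ∈ 𝒮.proj F h ↔ 𝒮.nhd X O ∈ F :=
  Iff.rfl

/-- The ultrafilter projects to each compact space `α(𝒞_X)` and converges there. The limits form a
point of the inverse limit, since separating two incompatible ones would put disjoint sets into `F`.
-/
theorem exists_le_nhds_lim {V : Type u} {G : SimpleGraph V} (𝒮 : CSystem.{u, w} G)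
    {F : Ultrafilter 𝒮.Space} (hF : ∀ X, 𝒮.nhd X univ ∈ F) :
    ∃ p : 𝒮.Limit, (F : Filter 𝒮.Space) ≤ 𝓝 (𝒮.limPt p) := by
  have hconv : ∀ X, ∃ q : 𝒮.space X, (𝒮.proj F (hF X) : Filter (𝒮.space X)) ≤ 𝓝 q := by
    intro X
    have := (𝒮.isHausdorffCompactification X).compact
    obtain ⟨q, -, hq⟩ := isCompact_iff_ultrafilter_le_nhds.1 isCompact_univ (𝒮.proj F (hF X))
      (by simp)
    exact ⟨q, hq⟩
  choose q hq using hconv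
  refine ⟨⟨q, fun X X' h => ?_⟩, ?_⟩
  · have := (𝒮.isHausdorffCompactification X).hausdorff
    by_contra hne
    obtain ⟨O, O', hO, hO', h1, h2, hd⟩ := t2_separation hne
    have h3 : 𝒮.nhd X O ∈ F := Filter.mem_of_superset
      (mem_proj.1 (hq X' ((hO.preimage (𝒮.continuous_bond h)).mem_nhds h1)))
      (𝒮.nhd_subset_nhd h fun _ hx => hx)
    have h4 : 𝒮.nhd X O' ∈ F := mem_proj.1 (hq X (hO'.mem_nhds h2))
    obtain ⟨x, hx, hx'⟩ := Filter.nonempty_of_mem (Filter.inter_mem h3 h4)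
    exact Set.disjoint_left.1 (𝒮.disjoint_nhd hd) hx hx'
  · intro U hU
    obtain ⟨X, O, hO, hpO, hOU⟩ := 𝒮.mem_nhds_lim_iff.1 hU
    exact Filter.mem_of_superset (mem_proj.1 (hq X (hO.mem_nhds hpO))) hOU

/-- An ultrafilter containing every `𝒪(X, 𝒞_X)` converges to a limit point. Otherwise it contains
the complement of one of them, which lies in the compact subgraph spanned by a finite vertex set. -/
theorem compactSpace {V : Type u} {G : SimpleGraph V} (𝒮 : CSystem.{u, w} G) :
    CompactSpace 𝒮.Space := by
  refine ⟨isCompact_iff_ultrafilter_le_nhds.2 fun F _ => ?_⟩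
  by_cases hF : ∀ X, 𝒮.nhd X univ ∈ F
  · obtain ⟨p, hp⟩ := 𝒮.exists_le_nhds_lim hF
    exact ⟨_, mem_univ _, hp⟩
  · push Not at hF
    obtain ⟨X, hX⟩ := hF
    obtain ⟨K, hK, hKX⟩ := exists_isCompact_compl_region G X
    have hKF : (𝒮.pt '' K) ∈ F := by
      refine Filter.mem_of_superset (Ultrafilter.compl_mem_iff_notMem.2 hX) ?_
      intro x hz
      obtain ⟨z, rfl⟩ | ⟨p, rfl⟩ := eq_pt_or_eq_limPt x
      · exact ⟨z, hKX fun hz' => hz (pt_mem_nhd.2 hz'), rfl⟩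
      · exact absurd (lim_mem_nhd.2 (mem_univ _)) hz
    obtain ⟨x, -, hx⟩ := isCompact_iff_ultrafilter_le_nhds.1 (hK.image 𝒮.continuous_pt) F
      (Filter.le_principal_iff.2 hKF)
    exact ⟨x, mem_univ _, hx⟩

/-! ### Every `𝒞`-system induces an `Ω`-compactification -/

/-- A dense discrete subspace of a Hausdorff space is open: if an open `O` traces out only `C`, a
second point of `O` would, by density, have another component near it. Hence every set of components
yields an open set of `α(𝒞_X)`. -/
theorem isOpenEmbedding_emb {V : Type u} {G : SimpleGraph V} (𝒮 : CSystem.{u, w} G)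
    (X : Finset V) : IsOpenEmbedding (𝒮.emb X) := by
  have hα := 𝒮.isHausdorffCompactification X
  have := hα.hausdorff
  refine IsOpenEmbedding.of_continuous_injective_isOpenMap hα.isEmbedding.continuous
    hα.isEmbedding.injective fun 𝒞 _ => ?_
  have key : ∀ C, IsOpen ({𝒮.emb X C} : Set (𝒮.space X)) := by
    intro C
    obtain ⟨O, hO, hOC⟩ := hα.isEmbedding.isOpen_iff.1 (isOpen_discrete ({C} : Set (Comp G X)))
    convert hO
    refine Subset.antisymm ?_ ?_
    · rintro _ rfl
      exact (hOC.symm ▸ rfl : C ∈ 𝒮.emb X ⁻¹' O)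
    · intro x hx
      by_contra hne
      obtain ⟨D, hD, hD'⟩ := hα.dense.exists_mem_open
        (hO.inter (isOpen_compl_singleton (x := 𝒮.emb X C))) ⟨x, hx, hne⟩
      have : D ∈ 𝒮.emb X ⁻¹' O := hD
      rw [hOC] at this
      exact hD' (congrArg _ this)
  rw [← biUnion_of_singleton 𝒞, image_iUnion₂]
  exact isOpen_biUnion fun C _ => by rw [image_singleton]; exact key C

theorem map_preimage_nhd {V : Type u} {G : SimpleGraph V} (𝒮 : CSystem.{u, w} G)
    (X : Finset V) (O : Set (𝒮.space X)) :
    𝒮.map ⁻¹' (𝒮.nhd X O) =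
      basicNhd X (𝒮.emb X ⁻¹' O) {ω : Ends G | ω.comp X ∈ 𝒮.emb X ⁻¹' O} := by
  ext x
  obtain ⟨z, rfl⟩ | ⟨ω, rfl⟩ := EndSpace.eq_pt_or_eq_ofEnd x
  · exact pt_mem_nhd.trans pt_mem_basicNhd.symm
  · exact lim_mem_nhd.trans
      (lim_mem_basicNhd (P := {ω : Ends G | ω.comp X ∈ 𝒮.emb X ⁻¹' O})).symm

theorem map_preimage_image_pt {V : Type u} {G : SimpleGraph V} (𝒮 : CSystem.{u, w} G)
    (U : Set (OneComplex G)) : 𝒮.map ⁻¹' (𝒮.pt '' U) = EndSpace.pt '' U := by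
  ext x
  obtain ⟨z, rfl⟩ | ⟨ω, rfl⟩ := EndSpace.eq_pt_or_eq_ofEnd x
  · exact 𝒮.pt_injective.mem_set_image.trans (Ext.pt_injective (I := Ends G)).mem_set_image.symm
  · constructor <;> rintro ⟨_, _, e⟩ <;> cases e

theorem ends_ext {V : Type u} {G : SimpleGraph V} {ω ω' : Ends G}
    (h : ∀ X, ω.comp X = ω'.comp X) : ω = ω' := by
  induction ω using Quotient.inductionOn with
  | h r =>
    induction ω' using Quotient.inductionOn with
    | h s =>
      exact Quotient.sound fun X => ⟨_, Ends.tailIn_comp X r, by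
        rw [h]
        exact Ends.tailIn_comp X s⟩

theorem ofEnd_injective {V : Type u} {G : SimpleGraph V} (𝒮 : CSystem.{u, w} G) :
    Function.Injective 𝒮.ofEnd := fun _ _ h => ends_ext fun X =>
  (𝒮.isHausdorffCompactification X).isEmbedding.injective
    (congrFun (congrArg Subtype.val h) X)

theorem isEmbedding_map {V : Type u} {G : SimpleGraph V} (𝒮 : CSystem.{u, w} G) :
    IsEmbedding 𝒮.map := by
  refine ⟨⟨?_⟩, ?_⟩
  · refine le_antisymm ?_ ?_
    · refine continuous_iff_le_induced.1 (continuous_generateFrom_iff.2 ?_)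
      rintro _ (⟨U, hU, rfl⟩ | ⟨X, O, -, rfl⟩)
      · exact (𝒮.map_preimage_image_pt U).symm ▸ EndSpace.isOpen_image hU
      · refine TopologicalSpace.isOpen_generateFrom_of_mem (Or.inr ⟨X, 𝒮.emb X ⁻¹' O, ?_⟩)
        exact 𝒮.map_preimage_nhd X O
    · refine le_generateFrom ?_
      rintro _ (⟨U, hU, rfl⟩ | ⟨X, 𝒞, rfl⟩)
      · exact ⟨𝒮.pt '' U, 𝒮.isOpen_image hU, 𝒮.map_preimage_image_pt U⟩
      · refine ⟨𝒮.nhd X (𝒮.emb X '' 𝒞),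
          𝒮.isOpen_nhd X ((𝒮.isOpenEmbedding_emb X).isOpenMap _ (isOpen_discrete 𝒞)), ?_⟩
        rw [map_preimage_nhd,
          preimage_image_eq _ (𝒮.isHausdorffCompactification X).isEmbedding.injective]
  · intro x y h
    obtain ⟨z, rfl⟩ | ⟨ω, rfl⟩ := EndSpace.eq_pt_or_eq_ofEnd x <;>
    obtain ⟨z', rfl⟩ | ⟨ω', rfl⟩ := EndSpace.eq_pt_or_eq_ofEnd y
    · exact congrArg EndSpace.pt (𝒮.pt_injective h)
    · exact absurd h pt_ne_limPt
    · exact absurd h.symm pt_ne_limPt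
    · exact congrArg EndSpace.ofEnd (𝒮.ofEnd_injective (𝒮.limPt_injective h))

theorem isCompactification_map {V : Type u} {G : SimpleGraph V} (𝒮 : CSystem.{u, w} G) :
    IsCompactification 𝒮.map where
  compact := 𝒮.compactSpace
  isEmbedding := 𝒮.isEmbedding_map
  dense := by
    rw [DenseRange, dense_iff_inter_open]
    rintro U hU ⟨x, hx⟩
    obtain ⟨z, rfl⟩ | ⟨p, rfl⟩ := eq_pt_or_eq_limPt x
    · exact ⟨_, hx, EndSpace.pt z, rfl⟩
    · obtain ⟨v, hv⟩ := 𝒮.exists_vert_mem (hU.mem_nhds hx)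
      exact ⟨_, hv, EndSpace.pt (.vert v), rfl⟩

theorem image_inner {V : Type u} {G : SimpleGraph V} (𝒮 : CSystem.{u, w} G) :
    𝒮.map '' EndSpace.inner G = 𝒮.pt '' innerPoints G :=
  image_image 𝒮.map EndSpace.pt (innerPoints G)

theorem vert_notMem_inner {V : Type u} {G : SimpleGraph V} (v : V) :
    EndSpace.pt (.vert v) ∉ EndSpace.inner G := by
  rintro ⟨_, ⟨e, t, rfl⟩, h⟩
  cases h

/-- The set of all inner edge points together with one vertex is open. -/
theorem isOpen_insert_vert {V : Type u} {G : SimpleGraph V} (𝒮 : CSystem.{u, w} G) (v : V) :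
    IsOpen (𝒮.pt '' (insert (.vert v) (innerPoints G))) :=
  𝒮.isOpen_image (isOpen_of_innerPoints_subset (subset_insert _ _))

theorem inner_mem_image {V : Type u} {G : SimpleGraph V} (𝒮 : CSystem.{u, w} G)
    (e : G.edgeSet) (t : Ioo (0 : ℝ) 1) : 𝒮.pt (.inner e t) ∈ 𝒮.map '' EndSpace.inner G := by
  rw [image_inner]
  exact mem_image_of_mem _ ⟨e, t, rfl⟩

theorem isOmegaCompactification_map {V : Type u} {G : SimpleGraph V} (𝒮 : CSystem.{u, w} G) :
    IsOmegaCompactification G 𝒮.map where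
  isCompactification := 𝒮.isCompactification_map
  delete_inner :=
    { compact := by
        have := 𝒮.compactSpace
        -- The set of inner edge points is open, so what remains is closed in a compact space.
        refine isCompact_iff_compactSpace.1 (IsClosed.isCompact ?_)
        rw [isClosed_compl_iff, image_inner]
        exact 𝒮.isOpen_image (isOpen_of_innerPoints_subset Subset.rfl)
      isEmbedding := (𝒮.isEmbedding_map.comp .subtypeVal).codRestrict _
        fun a => (deleteMap 𝒮.map 𝒮.isEmbedding_map.injective (EndSpace.inner G) a).2
      dense := by
        rw [DenseRange, dense_iff_inter_open]
        rintro _ ⟨U, hU, rfl⟩ ⟨⟨x, hx⟩, hxU⟩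
        have hv : ∃ v, 𝒮.pt (.vert v) ∈ U := by
          obtain ⟨v | ⟨e, t⟩, rfl⟩ | ⟨p, rfl⟩ := eq_pt_or_eq_limPt x
          · exact ⟨v, hxU⟩
          · exact absurd (𝒮.inner_mem_image e t) hx
          · exact 𝒮.exists_vert_mem (hU.mem_nhds hxU)
        obtain ⟨v, hv⟩ := hv
        exact ⟨deleteMap 𝒮.map 𝒮.isEmbedding_map.injective (EndSpace.inner G)
          ⟨EndSpace.pt (.vert v), vert_notMem_inner v⟩, hv, mem_range_self _⟩
      hausdorff := by
        have hvert : ∀ (v : V) (x : ↥(𝒮.map '' EndSpace.inner G)ᶜ),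
            x.1 ∈ 𝒮.pt '' (insert (.vert v) (innerPoints G)) → x.1 = 𝒮.pt (.vert v) := by
          rintro v x ⟨_, rfl | ⟨e, t, rfl⟩, h⟩
          · exact h.symm
          · exact absurd (h ▸ 𝒮.inner_mem_image e t) x.2
        have hvl : ∀ (v : V) (p : 𝒮.Limit), ∃ U W : Set 𝒮.Space, IsOpen U ∧ IsOpen W ∧
            𝒮.pt (.vert v) ∈ U ∧ 𝒮.limPt p ∈ W ∧
            ∀ x : ↥(𝒮.map '' EndSpace.inner G)ᶜ, x.1 ∈ U → x.1 ∉ W := by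
          -- With `X = {v}`, the whole of `𝒪(X, 𝒞_X)` omits `v`, while the other open set contains
          -- no point besides `v` outside the inner edge points.
          refine fun v p => ⟨_, 𝒮.nhd {v} univ, 𝒮.isOpen_insert_vert v,
            𝒮.isOpen_nhd _ isOpen_univ, ⟨_, Or.inl rfl, rfl⟩, lim_mem_nhd.2 (mem_univ _), ?_⟩
          intro x hx hx'
          rw [hvert v x hx, pt_mem_nhd] at hx'
          obtain ⟨C, -, hC⟩ := hx'
          exact not_mem_of_mem_comp hC (Finset.mem_singleton_self v)
        have key : ∀ x y : ↥(𝒮.map '' EndSpace.inner G)ᶜ, x ≠ y → ∃ U W : Set 𝒮.Space,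
            IsOpen U ∧ IsOpen W ∧ x.1 ∈ U ∧ y.1 ∈ W ∧
            ∀ z : ↥(𝒮.map '' EndSpace.inner G)ᶜ, z.1 ∈ U → z.1 ∉ W := by
          rintro ⟨x, hx⟩ ⟨y, hy⟩ hne
          obtain ⟨v | ⟨e, t⟩, rfl⟩ | ⟨p, rfl⟩ := eq_pt_or_eq_limPt x
          · obtain ⟨v' | ⟨e, t⟩, rfl⟩ | ⟨p, rfl⟩ := eq_pt_or_eq_limPt y
            · refine ⟨_, _, 𝒮.isOpen_insert_vert v, 𝒮.isOpen_insert_vert v',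
                ⟨_, Or.inl rfl, rfl⟩, ⟨_, Or.inl rfl, rfl⟩, fun z hz hz' =>
                hne (Subtype.ext ((hvert v z hz).symm.trans (hvert v' z hz')))⟩
            · exact absurd (𝒮.inner_mem_image e t) hy
            · exact hvl v p
          · exact absurd (𝒮.inner_mem_image e t) hx
          · obtain ⟨v | ⟨e, t⟩, rfl⟩ | ⟨q, rfl⟩ := eq_pt_or_eq_limPt y
            · obtain ⟨U, W, hU, hW, h1, h2, h3⟩ := hvl v p
              exact ⟨W, U, hW, hU, h2, h1, fun z hz hz' => h3 z hz' hz⟩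
            · exact absurd (𝒮.inner_mem_image e t) hy
            · have hpq : p ≠ q := by
                rintro rfl
                exact hne rfl
              obtain ⟨X, hX⟩ := Limit.exists_coord_ne hpq
              have := (𝒮.isHausdorffCompactification X).hausdorff
              obtain ⟨O, O', hO, hO', hpO, hqO, hd⟩ := t2_separation hX
              exact ⟨_, _, 𝒮.isOpen_nhd X hO, 𝒮.isOpen_nhd X hO', lim_mem_nhd.2 hpO,
                lim_mem_nhd.2 hqO, fun z hz hz' =>
                Set.disjoint_left.1 (𝒮.disjoint_nhd hd) hz hz'⟩
        refine ⟨fun x y hne => ?_⟩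
        obtain ⟨U, W, hU, hW, h1, h2, h3⟩ := key x y hne
        exact ⟨_, _, hU.preimage continuous_subtype_val, hW.preimage continuous_subtype_val,
          h1, h2, Set.disjoint_left.2 h3⟩ }

/-! ### Maps between spaces induced by `𝒞`-systems -/

/-- A vertex `v` is no limit of `F`: among vertices, a suitable neighbourhood of `v` contains only
`v`, which a neighbourhood of the limit point avoids. An inner edge point is none either, as the
inner points form an open set without vertices. -/
theorem eq_limPt_of_le_nhds {V : Type u} {G : SimpleGraph V} (𝒮 : CSystem.{u, w} G)
    {F : Filter 𝒮.Space} [F.NeBot] {p : 𝒮.Limit} {x : 𝒮.Space} (hp : F ≤ 𝓝 (𝒮.limPt p))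
    (hv : range (fun v => 𝒮.pt (.vert v)) ∈ F) (hx : F ≤ 𝓝 x) : x = 𝒮.limPt p := by
  obtain ⟨v | ⟨e, t⟩, rfl⟩ | ⟨q, rfl⟩ := eq_pt_or_eq_limPt x
  · exfalso
    have h1 := hx ((𝒮.isOpen_insert_vert v).mem_nhds ⟨_, Or.inl rfl, rfl⟩)
    have h2 := hp (𝒮.nhd_univ_mem_nhds p {v})
    obtain ⟨_, ⟨⟨w, rfl⟩, ⟨z, hz, e⟩⟩, h⟩ :=
      Filter.nonempty_of_mem (Filter.inter_mem (Filter.inter_mem hv h1) h2)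
    obtain rfl := 𝒮.pt_injective e
    rcases hz with hz | ⟨_, _, hz⟩
    · cases hz
      obtain ⟨C, -, hC⟩ := pt_mem_nhd.1 h
      exact not_mem_of_mem_comp hC (Finset.mem_singleton_self v)
    · cases hz
  · exfalso
    have h1 := hx ((𝒮.isOpen_image (isOpen_of_innerPoints_subset Subset.rfl)).mem_nhds
      ⟨_, ⟨e, t, rfl⟩, rfl⟩)
    obtain ⟨_, ⟨v, rfl⟩, ⟨_, ⟨_, _, rfl⟩, h⟩⟩ :=
      Filter.nonempty_of_mem (Filter.inter_mem hv h1)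
    cases h
  · exact congrArg 𝒮.limPt (𝒮.lim_unique hx hp)

/-- This replaces the uniqueness of continuous extensions from dense sets, which would need a
Hausdorff target. -/
theorem eq_id_of_continuous {V : Type u} {G : SimpleGraph V} (𝒮 : CSystem.{u, w} G)
    {f : 𝒮.Space → 𝒮.Space} (hf : Continuous f) (h : ∀ a, f (𝒮.map a) = 𝒮.map a) (x : 𝒮.Space) :
    f x = x := by
  obtain ⟨z, rfl⟩ | ⟨p, rfl⟩ := eq_pt_or_eq_limPt x
  · exact h (EndSpace.pt z)
  · obtain ⟨F, hF, hv⟩ := 𝒮.exists_ultrafilter_le_nhds_lim p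
    refine 𝒮.eq_limPt_of_le_nhds hF hv ?_
    -- All vertices are fixed, so `f` does not change `F`; hence `F` also converges to the image of
    -- the limit point.
    have h1 : Filter.map f F = F := by
      refine (Filter.map_congr ?_).trans Filter.map_id
      filter_upwards [hv]
      rintro _ ⟨v, rfl⟩
      exact h (EndSpace.pt (.vert v))
    rw [← h1]
    exact (Filter.map_mono hF).trans (hf.tendsto _)

theorem topEquivalent_map_of_coarser {V : Type u} {G : SimpleGraph V} (𝒮 : CSystem.{u, w} G)
    (𝒯 : CSystem.{u, w'} G) (h : Coarser 𝒮.map 𝒯.map) (h' : Coarser 𝒯.map 𝒮.map) :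
    TopEquivalent 𝒮.map 𝒯.map := by
  obtain ⟨f, hf, hfm⟩ := h
  obtain ⟨g, hg, hgm⟩ := h'
  have hfm' : ∀ a, f (𝒯.map a) = 𝒮.map a := congrFun hfm
  have hgm' : ∀ a, g (𝒮.map a) = 𝒯.map a := congrFun hgm
  exact ⟨⟨⟨f, g, 𝒯.eq_id_of_continuous (hg.comp hf) fun a => by rw [hfm', hgm'],
    𝒮.eq_id_of_continuous (hf.comp hg) fun a => by rw [hgm', hfm']⟩, hf, hg⟩, hfm⟩

/-- The map between the inverse limits of `𝒞`-systems induced by compatible maps. -/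
def limMap {V : Type u} {G : SimpleGraph V} {𝒮 : CSystem.{u, w} G} {𝒯 : CSystem.{u, w'} G}
    (f : ∀ X, 𝒯.space X → 𝒮.space X)
    (hf : ∀ (X X' : Finset V) (h : X ⊆ X'), f X ∘ 𝒯.bond h = 𝒮.bond h ∘ f X') (p : 𝒯.Limit) :
    𝒮.Limit :=
  ⟨fun X => f X (p.coord X), fun X X' h =>
    (congrFun (hf X X' h) (p.coord X')).symm.trans (congrArg (f X) (p.bond_coord h))⟩

/-- The map between the spaces induced by `𝒞`-systems that is the identity on `G` and extends
the map between the inverse limits. -/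
def spaceMap {V : Type u} {G : SimpleGraph V} {𝒮 : CSystem.{u, w} G} {𝒯 : CSystem.{u, w'} G}
    (f : ∀ X, 𝒯.space X → 𝒮.space X)
    (hf : ∀ (X X' : Finset V) (h : X ⊆ X'), f X ∘ 𝒯.bond h = 𝒮.bond h ∘ f X') :
    𝒯.Space → 𝒮.Space :=
  Ext.map (limMap f hf)

section SpaceMap

variable {V : Type u} {G : SimpleGraph V} {𝒮 : CSystem.{u, w} G} {𝒯 : CSystem.{u, w'} G}
  {f : ∀ X, 𝒯.space X → 𝒮.space X}
  {hf : ∀ (X X' : Finset V) (h : X ⊆ X'), f X ∘ 𝒯.bond h = 𝒮.bond h ∘ f X'}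

theorem spaceMap_preimage_nhd (hc : ∀ X, f X ∘ 𝒯.emb X = 𝒮.emb X) (X : Finset V)
    (O : Set (𝒮.space X)) : spaceMap f hf ⁻¹' (𝒮.nhd X O) = 𝒯.nhd X (f X ⁻¹' O) := by
  refine (Ext.map_preimage_basicNhd _ _ _ _).trans ?_
  rw [nhd, ← preimage_comp, hc X]
  rfl

theorem continuous_spaceMap (hc : ∀ X, Continuous (f X) ∧ f X ∘ 𝒯.emb X = 𝒮.emb X) :
    Continuous (spaceMap f hf) := by
  refine Ext.continuous_map ?_
  rintro _ ⟨X, O, hO, rfl⟩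
  exact (spaceMap_preimage_nhd (fun X => (hc X).2) X O).symm ▸
    𝒯.isOpen_nhd X (hO.preimage (hc X).1)

theorem spaceMap_comp_map (hc : ∀ X, f X ∘ 𝒯.emb X = 𝒮.emb X) :
    spaceMap f hf ∘ 𝒯.map = 𝒮.map := by
  funext x
  obtain ⟨z, rfl⟩ | ⟨ω, rfl⟩ := EndSpace.eq_pt_or_eq_ofEnd x
  · rfl
  · exact congrArg 𝒮.limPt (Limit.ext fun X => congrFun (hc X) (ω.comp X))

/-- An ultrafilter whose image converges to a limit point converges to a limit point. -/
theorem exists_le_nhds_of_map_spaceMap_le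
    (hc : ∀ X, Continuous (f X) ∧ f X ∘ 𝒯.emb X = 𝒮.emb X) {F : Ultrafilter 𝒯.Space}
    {q : 𝒮.Limit} (hF : Filter.map (spaceMap f hf) F ≤ 𝓝 (𝒮.limPt q)) :
    ∃ p : 𝒯.Limit, (F : Filter 𝒯.Space) ≤ 𝓝 (𝒯.limPt p) ∧
      spaceMap f hf (𝒯.limPt p) = 𝒮.limPt q := by
  obtain ⟨p, hp⟩ := 𝒯.exists_le_nhds_lim (F := F) fun X => by
    -- The preimage of `𝒪(X, 𝒞_X)` is again that set, now in the finer space, so `F` contains all of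
    -- them.
    have := hF (𝒮.nhd_univ_mem_nhds q X)
    rwa [Filter.mem_map, spaceMap_preimage_nhd fun X => (hc X).2] at this
  have h1 : Filter.map (spaceMap f hf) F ≤ 𝓝 (𝒮.limPt (limMap f hf p)) :=
    (Filter.map_mono hp).trans ((continuous_spaceMap hc).tendsto _)
  exact ⟨p, hp, congrArg 𝒮.limPt (𝒮.lim_unique h1 hF)⟩

/-- A continuous map from a compact space need not be closed here, as the target may fail to be
Hausdorff. Openness is tested by ultrafilters instead: at points of `G` it is inherited from the
1-complex, and at limit points an offending ultrafilter is lifted. -/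
theorem isQuotientMap_spaceMap (hc : ∀ X, Continuous (f X) ∧ f X ∘ 𝒯.emb X = 𝒮.emb X) :
    IsQuotientMap (spaceMap f hf) := by
  have hcont : Continuous (spaceMap f hf) := continuous_spaceMap hc
  have hsurj : Function.Surjective (spaceMap f hf) := by
    intro x
    obtain ⟨z, rfl⟩ | ⟨q, rfl⟩ := eq_pt_or_eq_limPt x
    · exact ⟨𝒯.pt z, rfl⟩
    · obtain ⟨F, hF, hv⟩ := 𝒮.exists_ultrafilter_le_nhds_lim q
      -- Vertices have vertices as preimages, so the pullback of a vertex ultrafilter is proper.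
      have hne : (Filter.comap (spaceMap f hf) F).NeBot := by
        refine Filter.comap_neBot fun U hU => ?_
        obtain ⟨_, hx, v, rfl⟩ := Filter.nonempty_of_mem (Filter.inter_mem hU hv)
        exact ⟨𝒯.pt (.vert v), hx⟩
      obtain ⟨p, -, hp⟩ := exists_le_nhds_of_map_spaceMap_le hc
        (F := Ultrafilter.of (Filter.comap (spaceMap f hf) F))
        ((Filter.map_le_iff_le_comap.2 (Ultrafilter.of_le _)).trans hF)
      exact ⟨_, hp⟩
  refine ⟨isCoinducing_iff.2 fun U => ⟨fun hU => ?_, fun hU => hU.preimage hcont⟩, hsurj⟩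
  rw [isOpen_iff_ultrafilter]
  intro x hx F hF
  obtain ⟨z, rfl⟩ | ⟨q, rfl⟩ := eq_pt_or_eq_limPt x
  · have hW : IsOpen (𝒯.pt ⁻¹' (spaceMap f hf ⁻¹' U)) := hU.preimage 𝒯.continuous_pt
    refine Filter.mem_of_superset (hF ((𝒮.isOpen_image hW).mem_nhds ⟨z, hx, rfl⟩)) ?_
    rintro _ ⟨y, hy, rfl⟩
    exact hy
  · by_contra hn
    -- If `U ∉ F`, then `F` lifts to an ultrafilter living on the preimage of `Uᶜ`. The lift
    -- converges to a point over `q`, which lies in the open preimage of `U`, a contradiction.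
    have hne : (Filter.comap (spaceMap f hf) F ⊓
        Filter.principal (spaceMap f hf ⁻¹' Uᶜ)).NeBot := by
      rw [Filter.inf_principal_neBot_iff]
      rintro W ⟨W', hW', hW⟩
      obtain ⟨x, hx, hx'⟩ := Filter.nonempty_of_mem
        (Filter.inter_mem hW' (Ultrafilter.compl_mem_iff_notMem.2 hn))
      obtain ⟨y, rfl⟩ := hsurj x
      exact ⟨y, hW hx, hx'⟩
    have hle := Ultrafilter.of_le
      (Filter.comap (spaceMap f hf) F ⊓ Filter.principal (spaceMap f hf ⁻¹' Uᶜ))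
    obtain ⟨p, hp, hpq⟩ := exists_le_nhds_of_map_spaceMap_le hc
      ((Filter.map_le_iff_le_comap.2 (hle.trans inf_le_left)).trans hF)
    have h1 := hp (hU.mem_nhds (show spaceMap f hf (𝒯.limPt p) ∈ U from hpq ▸ hx))
    have h2 := Filter.le_principal_iff.1 (hle.trans inf_le_right)
    obtain ⟨x, hx, hx'⟩ := Filter.nonempty_of_mem (Filter.inter_mem h1 h2)
    exact hx' hx

end SpaceMap

theorem Le.isQuotientOf_map {V : Type u} {G : SimpleGraph V} {𝒮 : CSystem.{u, w} G}
    {𝒯 : CSystem.{u, w'} G} (h : 𝒮.Le 𝒯) : IsQuotientOf 𝒮.map 𝒯.map := by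
  obtain ⟨f, hc, hf⟩ := h
  exact ⟨spaceMap f hf, isQuotientMap_spaceMap hc, spaceMap_comp_map fun X => (hc X).2⟩

end CSystem

/-! ## The least and the greatest `𝒞`-system -/

namespace CSystem

theorem isOpen_singleton_emb {V : Type u} {G : SimpleGraph V} (𝒮 : CSystem.{u, w} G)
    {X : Finset V} (C : Comp G X) : IsOpen ({𝒮.emb X C} : Set (𝒮.space X)) := by
  rw [← image_singleton]
  exact (𝒮.isOpenEmbedding_emb X).isOpenMap _ (isOpen_discrete _)

/-- Compatible maps on the dense component spaces commute with the bonding maps. -/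
theorem comp_bond_eq {V : Type u} {G : SimpleGraph V} {𝒮 : CSystem.{u, w} G}
    {𝒯 : CSystem.{u, w'} G} {f : ∀ X, 𝒯.space X → 𝒮.space X}
    (hc : ∀ X, Continuous (f X) ∧ f X ∘ 𝒯.emb X = 𝒮.emb X) (X X' : Finset V) (h : X ⊆ X') :
    f X ∘ 𝒯.bond h = 𝒮.bond h ∘ f X' := by
  have := (𝒮.isHausdorffCompactification X).hausdorff
  -- Both composites are continuous into a Hausdorff space and agree on the dense set of components.
  refine (𝒯.isHausdorffCompactification X').dense.equalizer
    ((hc X).1.comp (𝒯.continuous_bond h)) ((𝒮.continuous_bond h).comp (hc X').1) ?_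
  funext C
  have h1 : ∀ D, f X (𝒯.emb X D) = 𝒮.emb X D := congrFun (hc X).2
  have h2 : ∀ D, f X' (𝒯.emb X' D) = 𝒮.emb X' D := congrFun (hc X').2
  simp only [Function.comp_apply]
  rw [h2, 𝒯.bond_emb, 𝒮.bond_emb, h1]

/-- The Stone–Čech system is the greatest `𝒞`-system. -/
theorem le_stoneCechSystem {V : Type u} {G : SimpleGraph V} (𝒮 : CSystem.{u, w} G) :
    𝒮.Le (stoneCechSystem G) := by
  have hc : ∀ X, Continuous (Ultrafilter.extend (𝒮.emb X)) ∧
      Ultrafilter.extend (𝒮.emb X) ∘ pure = 𝒮.emb X := by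
    intro X
    have := (𝒮.isHausdorffCompactification X).hausdorff
    have := (𝒮.isHausdorffCompactification X).compact
    exact ⟨continuous_ultrafilter_extend _, ultrafilter_extend_extends _⟩
  exact ⟨fun X => Ultrafilter.extend (𝒮.emb X), hc, comp_bond_eq (𝒯 := stoneCechSystem G) hc⟩

/-! ### Minimality of the system of components and critical vertex sets -/

theorem exists_mem_compsWithNbhd {V : Type u} {G : SimpleGraph V} {X : Finset V} (C : Comp G X) :
    ∃ Y ∈ X.powerset, C ∈ compsWithNbhd G X Y := by
  classical
  have hsub := nbhd_subset C
  refine ⟨X.filter (· ∈ nbhd C), by simp, ?_⟩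
  ext x
  simpa using fun hx => hsub hx

/-- Sets of components that differ in a neighbour have disjoint closures. -/
theorem disjoint_closure_of_mem {V : Type u} {G : SimpleGraph V} (𝒮 : CSystem.{u, w} G)
    {X Y Y' : Finset V} {y : V} (hY : Y ⊆ X) (hY' : Y' ⊆ X) (hy : y ∈ Y) (hy' : y ∉ Y') :
    Disjoint (closure (𝒮.emb X '' compsWithNbhd G X Y))
      (closure (𝒮.emb X '' compsWithNbhd G X Y')) := by
  classical
  have h : X.erase y ⊆ X := Finset.erase_subset y X
  have hyX : y ∉ X.erase y := Finset.notMem_erase y X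
  have := (𝒮.isHausdorffCompactification (X.erase y)).hausdorff
  -- The fibre over the isolated point `D` is clopen. Components with neighbourhood `Y` are adjacent
  -- to `y` and so lie in `D`. Those with neighbourhood `Y'` remain components after `y` is put
  -- back, and do not contain `y`.
  set D := compOf G hyX
  have hcl : IsClosed (𝒮.bond h ⁻¹' {𝒮.emb _ D}) :=
    isClosed_singleton.preimage (𝒮.continuous_bond h)
  have hop : IsOpen (𝒮.bond h ⁻¹' {𝒮.emb _ D}) :=
    (𝒮.isOpen_singleton_emb D).preimage (𝒮.continuous_bond h)
  refine Set.disjoint_of_subset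
    (closure_minimal (t := 𝒮.bond h ⁻¹' {𝒮.emb _ D}) ?_ hcl)
    (closure_minimal (t := (𝒮.bond h ⁻¹' {𝒮.emb _ D})ᶜ) ?_ hop.isClosed_compl)
    disjoint_compl_right
  · rintro _ ⟨C, hC, rfl⟩
    rw [mem_preimage, 𝒮.bond_emb, mem_singleton_iff]
    congr 1
    have hC' : nbhd C = (Y : Set V) := hC
    obtain ⟨-, c, hc, hyc⟩ : y ∈ nbhd C := hC' ▸ hy
    exact (mem_compMap_iff h hc).2 (mem_comp_of_adj (mem_compOf G hyX)
      (fun hcX => not_mem_of_mem_comp hc (h hcX)) hyc)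
  · rintro _ ⟨C, hC, rfl⟩ hmem
    rw [mem_preimage, 𝒮.bond_emb, mem_singleton_iff] at hmem
    have e := (𝒮.isHausdorffCompactification _).isEmbedding.injective hmem
    have hC' : nbhd C = (Y' : Set V) := hC
    have hsub : nbhd C ⊆ ((X.erase y : Finset V) : Set V) := by
      rw [hC']
      exact Finset.coe_subset.2 (Finset.subset_erase.2 ⟨hY', hy'⟩)
    have h1 := coe_compMap_of_nbhd_subset h C hsub
    rw [e] at h1
    have h2 : y ∈ (C : Set V) := h1 ▸ mem_compOf G hyX
    exact not_mem_of_mem_comp h2 (hY hy)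

theorem disjoint_closure {V : Type u} {G : SimpleGraph V} (𝒮 : CSystem.{u, w} G)
    {X Y Y' : Finset V} (hY : Y ⊆ X) (hY' : Y' ⊆ X) (hne : Y ≠ Y') :
    Disjoint (closure (𝒮.emb X '' compsWithNbhd G X Y))
      (closure (𝒮.emb X '' compsWithNbhd G X Y')) := by
  by_cases h : Y ⊆ Y'
  · obtain ⟨y, hy, hy'⟩ := Finset.not_subset.1 fun h' => hne (h.antisymm h')
    exact (𝒮.disjoint_closure_of_mem hY' hY hy hy').symm
  · obtain ⟨y, hy, hy'⟩ := Finset.not_subset.1 h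
    exact 𝒮.disjoint_closure_of_mem hY hY' hy hy'

/-- This is the hypothesis for extending `Gam.comp` continuously to `α(𝒞_X)`. A point outside the
image lies in the closure of a unique `𝒞_X(Y)`, and that set is infinite because finite sets are
closed; so the limit is the critical set `Y`. -/
theorem exists_tendsto_gam {V : Type u} {G : SimpleGraph V} (𝒮 : CSystem.{u, w} G)
    {X : Finset V} (p : 𝒮.space X) :
    ∃ c, Filter.Tendsto (Gam.comp (G := G) (X := X)) (Filter.comap (𝒮.emb X) (𝓝 p)) (𝓝 c) := by
  classical
  have hα := 𝒮.isHausdorffCompactification X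
  have := hα.hausdorff
  by_cases hp : ∃ C, 𝒮.emb X C = p
  · obtain ⟨C, rfl⟩ := hp
    refine ⟨Gam.comp C, ?_⟩
    rw [← hα.isEmbedding.nhds_eq_comap]
    exact continuous_of_discreteTopology.tendsto C
  push Not at hp
  have hcover : range (𝒮.emb X) ⊆ ⋃ Y ∈ X.powerset, 𝒮.emb X '' compsWithNbhd G X Y := by
    rintro _ ⟨C, rfl⟩
    obtain ⟨Y, hY, hC⟩ := exists_mem_compsWithNbhd C
    exact mem_iUnion₂.2 ⟨Y, hY, C, hC, rfl⟩
  have hpc := closure_mono hcover (hα.dense p)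
  rw [X.powerset.closure_biUnion] at hpc
  obtain ⟨Y, hY, hpY⟩ := mem_iUnion₂.1 hpc
  have hYX := Finset.mem_powerset.1 hY
  have hcrit : Y ∈ crit G X := by
    refine ⟨hYX, (infinite_compsWithNbhd_iff hYX).1 fun hfin => ?_⟩
    rw [(hfin.image _).isClosed.closure_eq] at hpY
    obtain ⟨C, -, hC⟩ := hpY
    exact hp C hC
  -- The closures of the other finitely many sets `𝒞_X(Y')` miss `p`, so near `p` only components
  -- with neighbourhood `Y` occur.
  have hev1 : ∀ᶠ C in Filter.comap (𝒮.emb X) (𝓝 p), C ∈ compsWithNbhd G X Y := by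
    have h1 : ∀ Y' ∈ X.powerset.erase Y,
        ∀ᶠ x in 𝓝 p, x ∉ closure (𝒮.emb X '' compsWithNbhd G X Y') := by
      intro Y' hY'
      obtain ⟨hne, hY'X⟩ := Finset.mem_erase.1 hY'
      exact isClosed_closure.isOpen_compl.mem_nhds (Set.disjoint_left.1
        (𝒮.disjoint_closure hYX (Finset.mem_powerset.1 hY'X) hne.symm) hpY)
    have h2 := (Filter.eventually_all_finset _).2 h1
    filter_upwards [Filter.preimage_mem_comap h2] with C hC
    obtain ⟨Y', hY', hCY'⟩ := exists_mem_compsWithNbhd C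
    by_contra hn
    refine hC Y' (Finset.mem_erase.2 ⟨?_, hY'⟩) (subset_closure ⟨C, hCY', rfl⟩)
    rintro rfl
    exact hn hCY'
  refine ⟨Gam.crit Y hcrit, ?_⟩
  rw [(nhds_basis_opens _).tendsto_right_iff]
  rintro U ⟨hmem, hU⟩
  have hfin := (isOpen_gam_iff.1 hU Y hcrit hmem).image (𝒮.emb X)
  -- A neighbourhood of `Y` in `Γ_X` omits only finitely many components of `𝒞_X(Y)`, and `p` is
  -- none of them.
  have hev2 : ∀ᶠ x in 𝓝 p, x ∉ 𝒮.emb X '' (compsWithNbhd G X Y \ Gam.comp ⁻¹' U) := by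
    refine hfin.isClosed.isOpen_compl.mem_nhds ?_
    rintro ⟨C, -, hC⟩
    exact hp C hC
  filter_upwards [hev1, Filter.preimage_mem_comap hev2] with C hC hC'
  by_contra hn
  exact hC' ⟨C, ⟨hC, hn⟩, rfl⟩

/-- `𝒞^Γ` is the least `𝒞`-system. -/
theorem gamSystem_le {V : Type u} {G : SimpleGraph V} (𝒮 : CSystem.{u, w} G) :
    (gamSystem G).Le 𝒮 := by
  have di : ∀ X, IsDenseInducing (𝒮.emb X) := fun X =>
    ⟨(𝒮.isHausdorffCompactification X).isEmbedding.isInducing,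
      (𝒮.isHausdorffCompactification X).dense⟩
  have hc : ∀ X, Continuous ((di X).extend (Gam.comp (G := G) (X := X))) ∧
      (di X).extend (Gam.comp (G := G) (X := X)) ∘ 𝒮.emb X = Gam.comp := by
    intro X
    -- Together with compactness this makes `Γ_X` regular, as needed for the dense extension to be
    -- continuous.
    have := (gam_isHausdorffCompactification G X).hausdorff
    have := (gam_isHausdorffCompactification G X).compact
    exact ⟨(di X).continuous_extend 𝒮.exists_tendsto_gam,
      funext ((di X).extend_eq' 𝒮.exists_tendsto_gam)⟩
  exact ⟨fun X => (di X).extend Gam.comp, hc, comp_bond_eq (𝒮 := gamSystem G) hc⟩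

end CSystem

/-! ## Tangles and inverse limits of ultrafilters -/

theorem mem_verts {V : Type u} {G : SimpleGraph V} {X : Finset V} {𝒞 : Set (Comp G X)} {x : V} :
    x ∈ verts 𝒞 ↔ ∃ C ∈ 𝒞, x ∈ C := by
  rw [verts, mem_iUnion₂]
  exact ⟨fun ⟨C, hC, hx⟩ => ⟨C, hC, hx⟩, fun ⟨C, hC, hx⟩ => ⟨C, hC, hx⟩⟩

theorem notMem_of_mem_verts {V : Type u} {G : SimpleGraph V} {X : Finset V}
    {𝒞 : Set (Comp G X)} {x : V} (hx : x ∈ verts 𝒞) : x ∉ X := by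
  obtain ⟨C, -, hC⟩ := mem_verts.1 hx
  exact not_mem_of_mem_comp hC

theorem mem_verts_compl {V : Type u} {G : SimpleGraph V} {X : Finset V} {𝒞 : Set (Comp G X)}
    {x : V} : x ∈ verts 𝒞ᶜ ↔ x ∉ X ∧ x ∉ verts 𝒞 := by
  constructor
  · intro hx
    refine ⟨notMem_of_mem_verts hx, fun hx' => ?_⟩
    obtain ⟨C, hC, hxC⟩ := mem_verts.1 hx
    obtain ⟨D, hD, hxD⟩ := mem_verts.1 hx'
    exact hC (comp_eq_of_mem hxC hxD ▸ hD)
  · rintro ⟨hX, hx⟩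
    exact mem_verts.2 ⟨compOf G hX, fun hC => hx (mem_verts.2 ⟨_, hC, mem_compOf G hX⟩),
      mem_compOf G hX⟩

theorem sepTo_inter {V : Type u} {G : SimpleGraph V} (X : Finset V) (𝒞 : Set (Comp G X)) :
    (sepTo X 𝒞).1 ∩ (sepTo X 𝒞).2 = X := by
  ext x
  constructor
  · rintro ⟨h1, h2 | h2⟩
    · exact h2
    · exact absurd h2 h1
  · exact fun hx => ⟨fun h => notMem_of_mem_verts h hx, Or.inl hx⟩

theorem sepTo_sdiff {V : Type u} {G : SimpleGraph V} (X : Finset V) (𝒞 : Set (Comp G X)) :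
    (sepTo X 𝒞).2 \ (sepTo X 𝒞).1 = verts 𝒞 := by
  ext x
  constructor
  · rintro ⟨-, h⟩
    exact not_not.1 h
  · exact fun hx => ⟨Or.inr hx, not_not.2 hx⟩

theorem sepTo_swap {V : Type u} {G : SimpleGraph V} (X : Finset V) (𝒞 : Set (Comp G X)) :
    (sepTo X 𝒞).swap = sepTo X 𝒞ᶜ := by
  refine Prod.ext ?_ ?_ <;> ext x <;>
    simp only [sepTo, Prod.swap, mem_compl_iff, mem_union, mem_verts_compl, Finset.mem_coe]
  · tauto
  · have : x ∈ verts 𝒞 → x ∉ X := notMem_of_mem_verts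
    tauto

theorem isSep_sepTo {V : Type u} {G : SimpleGraph V} (X : Finset V) (𝒞 : Set (Comp G X)) :
    IsSep G (sepTo X 𝒞) := by
  refine ⟨?_, ?_, ?_⟩
  · rw [sepTo_inter]
    exact X.finite_toSet
  · refine eq_univ_of_forall fun x => ?_
    by_cases hx : x ∈ verts 𝒞
    · exact Or.inr (Or.inr hx)
    · exact Or.inl hx
  · rintro a ⟨ha, ha'⟩ b hb hab
    rw [sepTo_sdiff, mem_verts] at hb
    obtain ⟨C, hC, hbC⟩ := hb
    exact ha (mem_verts.2 ⟨C, hC, mem_comp_of_adj hbC (fun h => ha' (Or.inl h)) hab.symm⟩)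

theorem mem_starInterior {V : Type u} {σ : Set (Set V × Set V)} {x : V} :
    x ∈ starInterior σ ↔ ∀ s ∈ σ, x ∈ s.2 :=
  mem_iInter₂

/-! ### Closure properties of tangles and their ultrafilters -/

namespace Tangle

theorem swap_notMem {V : Type u} {G : SimpleGraph V} (τ : Tangle G) {s : Set V × Set V}
    (hs : s ∈ τ.carrier) : s.swap ∉ τ.carrier :=
  (τ.orients s (τ.isSep s hs)).1 hs

theorem mem_of_swap_notMem {V : Type u} {G : SimpleGraph V} (τ : Tangle G) {s : Set V × Set V}
    (h : IsSep G s) (hs : s.swap ∉ τ.carrier) : s ∈ τ.carrier :=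
  (τ.orients s h).2 hs

/-- A single separation is a star whose interior is its big side. -/
theorem infinite_snd {V : Type u} {G : SimpleGraph V} (τ : Tangle G) {s : Set V × Set V}
    (hs : s ∈ τ.carrier) : s.2.Infinite := by
  intro hfin
  refine τ.avoids {s} (singleton_subset_iff.2 hs) ⟨?_, ?_⟩ (finite_singleton s) ?_
  · rintro _ rfl
    exact τ.isSep _ hs
  · rintro _ rfl _ rfl h
    exact absurd rfl h
  · exact hfin.subset fun x hx => mem_starInterior.1 hx s rfl

/-- Tangles are closed downwards. -/
theorem mem_of_sepLE {V : Type u} {G : SimpleGraph V} (τ : Tangle G) {s t : Set V × Set V}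
    (hs : s ∈ τ.carrier) (ht : IsSep G t) (h : SepLE t s) : t ∈ τ.carrier := by
  refine τ.mem_of_swap_notMem ht fun hts => ?_
  have hle : SepLE s.swap t.swap := ⟨h.2, h.1⟩
  have hne : s.swap ≠ t.swap := by
    intro e
    rw [← e] at hts
    exact τ.swap_notMem hs hts
  -- Consistency speaks only of distinct separations. If `s = t.swap`, then `t.1 ⊆ t.2`, so the big
  -- side `t.1` of `s` lies in the finite separator.
  by_cases e : s = t.swap
  · subst e
    refine τ.infinite_snd hs (ht.1.subset fun x hx => ⟨hx, h.1 hx⟩)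
  · exact τ.consistent s hs t.swap hts e ⟨hle, hne⟩

/-- If `t.swap` were chosen, `{s, t.swap}` would be a star with interior `s.2 ∩ t.1`. -/
theorem mem_of_sepLE_of_finite {V : Type u} {G : SimpleGraph V} (τ : Tangle G)
    {s t : Set V × Set V} (hs : s ∈ τ.carrier) (ht : IsSep G t) (h : SepLE s t)
    (hfin : (s.2 ∩ t.1).Finite) : t ∈ τ.carrier := by
  refine τ.mem_of_swap_notMem ht fun hts => ?_
  refine τ.avoids {s, t.swap} ?_ ⟨?_, ?_⟩ (toFinite _) ?_
  · rintro _ (rfl | rfl)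
    · exact hs
    · exact hts
  · rintro _ (rfl | rfl)
    · exact τ.isSep _ hs
    · exact ht.swap
  · rintro _ (rfl | rfl) _ (rfl | rfl) hne
    · exact absurd rfl hne
    · exact h
    · exact ⟨h.2, h.1⟩
    · exact absurd rfl hne
  · exact hfin.subset fun x hx =>
      ⟨mem_starInterior.1 hx s (Or.inl rfl), mem_starInterior.1 hx t.swap (Or.inr rfl)⟩

/-- Tangles are closed under finite changes of separations, and downwards. -/
theorem mem_of_finite {V : Type u} {G : SimpleGraph V} (τ : Tangle G) {s t : Set V × Set V}
    (hs : s ∈ τ.carrier) (ht : IsSep G t) (hfin : (s.2 ∩ t.1).Finite) : t ∈ τ.carrier := by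
  have hs' := τ.isSep s hs
  -- The infimum of `s` and `t` lies below `s`, hence in `τ`. It also lies below `t`, and its big
  -- side meets `t.1` in `s.2 ∩ t.1` plus the finite separator of `t`.
  have hm : IsSep G (s.1 ∩ t.1, s.2 ∪ t.2) := by
    refine ⟨(hs'.1.union ht.1).subset ?_, eq_univ_of_forall fun x => ?_, ?_⟩
    · rintro x ⟨⟨h1, h2⟩, h3 | h3⟩
      · exact Or.inl ⟨h1, h3⟩
      · exact Or.inr ⟨h2, h3⟩
    · have h1 : x ∈ s.1 ∪ s.2 := hs'.2.1 ▸ mem_univ x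
      have h2 : x ∈ t.1 ∪ t.2 := ht.2.1 ▸ mem_univ x
      rcases h1 with h1 | h1
      · rcases h2 with h2 | h2
        · exact Or.inl ⟨h1, h2⟩
        · exact Or.inr (Or.inr h2)
      · exact Or.inr (Or.inl h1)
    · rintro a ⟨⟨h1, h2⟩, h3⟩ b ⟨-, h4⟩ hab
      by_cases hb : b ∈ s.1
      · have hbt : b ∉ t.1 := fun h => h4 ⟨hb, h⟩
        have h5 : b ∈ t.1 ∪ t.2 := ht.2.1 ▸ mem_univ b
        exact ht.2.2 a ⟨h2, fun h => h3 (Or.inr h)⟩ b ⟨h5.resolve_left hbt, hbt⟩ hab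
      · have h5 : b ∈ s.1 ∪ s.2 := hs'.2.1 ▸ mem_univ b
        exact hs'.2.2 a ⟨h1, fun h => h3 (Or.inl h)⟩ b ⟨h5.resolve_left hb, hb⟩ hab
  refine τ.mem_of_sepLE_of_finite (τ.mem_of_sepLE hs hm ⟨inter_subset_left, subset_union_left⟩)
    ht ⟨inter_subset_right, subset_union_right⟩ ((hfin.union ht.1).subset ?_)
  rintro x ⟨h1 | h1, h2⟩
  · exact Or.inl ⟨h1, h2⟩
  · exact Or.inr ⟨h2, h1⟩

theorem mem_U {V : Type u} {G : SimpleGraph V} {τ : Tangle G} {X : Finset V}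
    {𝒞 : Set (Comp G X)} : 𝒞 ∈ τ.U X ↔ sepTo X 𝒞 ∈ τ.carrier :=
  Iff.rfl

theorem compl_mem_U {V : Type u} {G : SimpleGraph V} (τ : Tangle G) {X : Finset V}
    {𝒞 : Set (Comp G X)} : 𝒞ᶜ ∉ τ.U X ↔ 𝒞 ∈ τ.U X := by
  rw [mem_U, mem_U, ← sepTo_swap]
  exact (τ.orients _ (isSep_sepTo X 𝒞)).symm

theorem U_superset {V : Type u} {G : SimpleGraph V} (τ : Tangle G) {X : Finset V}
    {𝒞 𝒟 : Set (Comp G X)} (h𝒞 : 𝒞 ∈ τ.U X) (h : 𝒞 ⊆ 𝒟) : 𝒟 ∈ τ.U X := by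
  refine τ.mem_of_finite h𝒞 (isSep_sepTo X 𝒟) (X.finite_toSet.subset ?_)
  rintro x ⟨h1 | h1, h2⟩
  · exact h1
  · obtain ⟨C, hC, hx⟩ := mem_verts.1 h1
    exact absurd (mem_verts.2 ⟨C, h hC, hx⟩) h2

/-- If `𝒞 ∩ 𝒟` failed, the tangle would contain the separations of `𝒞`, `𝒟 ∪ 𝒞ᶜ` and `(𝒞 ∩ 𝒟)ᶜ`. The
complements of these three sets partition `𝒞_X`, so the separations form a star with interior in the
finite set `X`. -/
theorem U_inter {V : Type u} {G : SimpleGraph V} (τ : Tangle G) {X : Finset V}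
    {𝒞 𝒟 : Set (Comp G X)} (h𝒞 : 𝒞 ∈ τ.U X) (h𝒟 : 𝒟 ∈ τ.U X) : 𝒞 ∩ 𝒟 ∈ τ.U X := by
  by_contra hn
  have h1 : (𝒞 ∩ 𝒟)ᶜ ∈ τ.U X := not_not.1 fun h => hn (τ.compl_mem_U.1 h)
  -- Enlarging `𝒟` makes its complement disjoint from that of `𝒞`, as a star requires.
  have h2 : 𝒟 ∪ 𝒞ᶜ ∈ τ.U X := τ.U_superset h𝒟 subset_union_left
  have hle : ∀ 𝒜 ℬ : Set (Comp G X), 𝒜 ∪ ℬ = univ → SepLE (sepTo X 𝒜) (sepTo X ℬ).swap := by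
    have key : ∀ 𝒜 ℬ : Set (Comp G X), 𝒜 ∪ ℬ = univ → (verts 𝒜)ᶜ ⊆ X ∪ verts ℬ := by
      intro 𝒜 ℬ h x hx
      by_cases hX : x ∈ X
      · exact Or.inl hX
      · refine Or.inr (mem_verts.2 ⟨compOf G hX, ?_, mem_compOf G hX⟩)
        have : compOf G hX ∈ 𝒜 ∪ ℬ := h ▸ mem_univ _
        exact this.resolve_left fun h => hx (mem_verts.2 ⟨_, h, mem_compOf G hX⟩)
    exact fun 𝒜 ℬ h => ⟨key 𝒜 ℬ h, key ℬ 𝒜 (union_comm 𝒜 ℬ ▸ h)⟩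
  refine τ.avoids {sepTo X 𝒞, sepTo X (𝒟 ∪ 𝒞ᶜ), sepTo X (𝒞 ∩ 𝒟)ᶜ} ?_ ⟨?_, ?_⟩ (toFinite _) ?_
  · rintro _ (rfl | rfl | rfl)
    · exact h𝒞
    · exact h2
    · exact h1
  · rintro _ (rfl | rfl | rfl) <;> exact isSep_sepTo X _
  · rintro _ (rfl | rfl | rfl) _ (rfl | rfl | rfl) hne
    all_goals first
      | exact absurd rfl hne
      | (refine hle _ _ (eq_univ_of_forall fun C => ?_)
         simp only [mem_union, mem_compl_iff, mem_inter_iff]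
         tauto)
  · refine X.finite_toSet.subset fun x hx => ?_
    rw [mem_starInterior] at hx
    by_contra hX
    have hmem : ∀ 𝒜 : Set (Comp G X), x ∈ (X : Set V) ∪ verts 𝒜 → compOf G hX ∈ 𝒜 := by
      rintro 𝒜 (h | h)
      · exact absurd h hX
      · obtain ⟨C, hC, hxC⟩ := mem_verts.1 h
        exact comp_eq_of_mem hxC (mem_compOf G hX) ▸ hC
    have m1 := hmem _ (hx _ (Or.inl rfl))
    have m2 := hmem _ (hx _ (Or.inr (Or.inl rfl)))
    have m3 := hmem _ (hx _ (Or.inr (Or.inr rfl)))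
    exact m3 ⟨m1, m2.resolve_right (not_not.2 m1)⟩

theorem U_univ {V : Type u} {G : SimpleGraph V} (τ : Tangle G) (X : Finset V) :
    univ ∈ τ.U X := by
  rw [← compl_mem_U, compl_univ]
  intro h
  refine τ.infinite_snd h (X.finite_toSet.subset ?_)
  rintro x (hx | hx)
  · exact hx
  · obtain ⟨C, hC, -⟩ := mem_verts.1 hx
    exact absurd hC (notMem_empty C)

/-- The ultrafilter `U(τ, X)`. -/
def ultrafilter {V : Type u} {G : SimpleGraph V} (τ : Tangle G) (X : Finset V) :
    Ultrafilter (Comp G X) :=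
  Ultrafilter.ofComplNotMemIff
    { sets := τ.U X
      univ_sets := τ.U_univ X
      sets_of_superset := τ.U_superset
      inter_sets := τ.U_inter } fun _ => τ.compl_mem_U

theorem mem_ultrafilter {V : Type u} {G : SimpleGraph V} {τ : Tangle G} {X : Finset V}
    {𝒞 : Set (Comp G X)} : 𝒞 ∈ τ.ultrafilter X ↔ 𝒞 ∈ τ.U X :=
  Iff.rfl

/-- The separations of `𝒞` at `X` and of its preimage at `X'` differ only within the finite set
`X'`, so `τ` orients them alike. Between ultrafilters one inclusion suffices for equality. -/
theorem map_ultrafilter {V : Type u} {G : SimpleGraph V} (τ : Tangle G) {X X' : Finset V}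
    (h : X ⊆ X') : (τ.ultrafilter X').map (compMap h) = τ.ultrafilter X := by
  refine (Ultrafilter.coe_le_coe.1 fun 𝒞 h𝒞 => ?_)
  refine τ.mem_of_finite (t := sepTo X' (compMap h ⁻¹' 𝒞)) h𝒞 (isSep_sepTo _ _)
    (X'.finite_toSet.subset ?_)
  rintro x ⟨h1 | h1, h2⟩
  · exact h h1
  · by_contra hX'
    obtain ⟨C, hC, hxC⟩ := mem_verts.1 h1
    refine h2 (mem_verts.2 ⟨compOf G hX', ?_, mem_compOf G hX'⟩)
    rw [mem_preimage, (mem_compMap_iff h (mem_compOf G hX')).2 hxC]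
    exact hC

/-- The inverse limit of the ultrafilters `U(τ, X)`. -/
def toLimit {V : Type u} {G : SimpleGraph V} (τ : Tangle G) : (stoneCechSystem G).Limit :=
  ⟨τ.ultrafilter, fun _ _ h => τ.map_ultrafilter h⟩

end Tangle

/-- The components of `G - X` on the big side of a separation. -/
def bigSide {V : Type u} (G : SimpleGraph V) (X : Finset V) (s : Set V × Set V) :
    Set (Comp G X) :=
  {C | (C : Set V) ⊆ s.2 \ s.1}

theorem mem_bigSide {V : Type u} {G : SimpleGraph V} {X : Finset V} {s : Set V × Set V}
    {C : Comp G X} : C ∈ bigSide G X s ↔ (C : Set V) ⊆ s.2 \ s.1 :=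
  Iff.rfl

/-- A component avoiding the separator lies in a component of the graph minus the separator, which
cannot meet both sides. -/
theorem IsSep.mem_bigSide_of_mem {V : Type u} {G : SimpleGraph V} {s : Set V × Set V}
    (hs : IsSep G s) {X : Finset V} (hX : s.1 ∩ s.2 ⊆ X) {C : Comp G X} {x : V} (hx : x ∈ C)
    (hxs : x ∈ s.2 \ s.1) : C ∈ bigSide G X s := by
  have h : hs.1.toFinset ⊆ X := by
    rw [← Finset.coe_subset, hs.1.coe_toFinset]
    exact hX
  exact (subset_compMap h C).trans
    (hs.comp_subset hs.1.coe_toFinset _ (subset_compMap h C hx) hxs)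

theorem IsSep.bigSide_swap {V : Type u} {G : SimpleGraph V} {s : Set V × Set V}
    (hs : IsSep G s) {X : Finset V} (hX : s.1 ∩ s.2 ⊆ X) :
    bigSide G X s.swap = (bigSide G X s)ᶜ := by
  ext C
  obtain ⟨x, hx⟩ := comp_nonempty C
  constructor
  · exact fun h h' => (h hx).2 (h' hx).1
  · intro h
    have hxX : x ∉ s.1 ∩ s.2 := fun hxs => not_mem_of_mem_comp hx (hX hxs)
    have hu : x ∈ s.1 ∪ s.2 := hs.2.1 ▸ mem_univ x
    refine hs.swap.mem_bigSide_of_mem (inter_comm s.1 s.2 ▸ hX) hx ?_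
    by_cases h1 : x ∈ s.1
    · exact ⟨h1, fun h2 => hxX ⟨h1, h2⟩⟩
    · exact absurd (hs.mem_bigSide_of_mem hX hx ⟨hu.resolve_left h1, h1⟩) h

theorem IsSep.compMap_preimage_bigSide {V : Type u} {G : SimpleGraph V} {s : Set V × Set V}
    (hs : IsSep G s) {X X' : Finset V} (hX : s.1 ∩ s.2 ⊆ X) (h : X ⊆ X') :
    compMap h ⁻¹' bigSide G X s = bigSide G X' s := by
  ext C
  constructor
  · exact fun hC => (subset_compMap h C).trans hC
  · intro hC
    obtain ⟨x, hx⟩ := comp_nonempty C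
    exact hs.mem_bigSide_of_mem hX (subset_compMap h C hx) (hC hx)

/-- Thus every finite order separation has the form `sepTo X 𝒞`, which is why the ultrafilters `U(τ,
X)` determine `τ`. -/
theorem IsSep.sepTo_bigSide {V : Type u} {G : SimpleGraph V} {s : Set V × Set V}
    (hs : IsSep G s) {X : Finset V} (hX : s.1 ∩ s.2 = X) : sepTo X (bigSide G X s) = s := by
  have hv : verts (bigSide G X s) = s.2 \ s.1 := by
    ext x
    rw [mem_verts]
    constructor
    · rintro ⟨C, hC, hx⟩
      exact hC hx
    · intro hx
      have hxX : x ∉ X := by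
        rw [← Finset.mem_coe, ← hX]
        exact fun h => hx.2 h.1
      exact ⟨compOf G hxX, hs.mem_bigSide_of_mem hX.subset (mem_compOf G hxX) hx,
        mem_compOf G hxX⟩
  have hu : ∀ x, x ∈ s.1 ∨ x ∈ s.2 := fun x => (hs.2.1 ▸ mem_univ x : x ∈ s.1 ∪ s.2)
  refine Prod.ext ?_ ?_ <;> ext x <;> have := hu x <;>
    simp only [sepTo, hv, ← hX, mem_compl_iff, mem_sdiff, mem_union, mem_inter_iff] <;> tauto

theorem bigSide_sepTo {V : Type u} {G : SimpleGraph V} (X : Finset V) (𝒞 : Set (Comp G X)) :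
    bigSide G X (sepTo X 𝒞) = 𝒞 := by
  ext C
  rw [mem_bigSide, sepTo_sdiff]
  constructor
  · intro h
    obtain ⟨x, hx⟩ := comp_nonempty C
    obtain ⟨D, hD, hxD⟩ := mem_verts.1 (h hx)
    exact comp_eq_of_mem hx hxD ▸ hD
  · exact fun h x hx => mem_verts.2 ⟨C, h, hx⟩

theorem Tangle.toLimit_injective {V : Type u} {G : SimpleGraph V} :
    Function.Injective (Tangle.toLimit (G := G)) := by
  intro τ τ' h
  have key : ∀ X, τ.ultrafilter X = τ'.ultrafilter X := congrFun (congrArg Subtype.val h)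
  have hmem : ∀ s, IsSep G s → (s ∈ τ.carrier ↔ s ∈ τ'.carrier) := by
    intro s hs
    have e := hs.sepTo_bigSide hs.1.coe_toFinset.symm
    rw [← e, ← Tangle.mem_U, ← Tangle.mem_U, ← Tangle.mem_ultrafilter, ← Tangle.mem_ultrafilter,
      key]
  refine Tangle.ext (Set.ext fun s => ⟨fun hs => ?_, fun hs => ?_⟩)
  · exact (hmem s (τ.isSep s hs)).1 hs
  · exact (hmem s (τ'.isSep s hs)).2 hs

/-! ### Tangles from points of the inverse limit -/

section OfLimit

variable {V : Type u} {G : SimpleGraph V} (p : (stoneCechSystem G).Limit)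

/-- The ultrafilters of a point of the inverse limit of the Stone–Čech system. -/
noncomputable def limitUltrafilter (X : Finset V) : Ultrafilter (Comp G X) := p.coord X

theorem map_limitUltrafilter {X X' : Finset V} (h : X ⊆ X') :
    (limitUltrafilter p X').map (compMap h) = limitUltrafilter p X :=
  p.bond_coord h

/-- The separations whose big side lies in the ultrafilters of a point of the inverse limit. -/
def limitOrientation : Set (Set V × Set V) :=
  {s | IsSep G s ∧ ∃ X : Finset V, s.1 ∩ s.2 ⊆ X ∧ bigSide G X s ∈ limitUltrafilter p X}

theorem bigSide_mem_iff_of_subset {s : Set V × Set V} (hs : IsSep G s) {X X' : Finset V}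
    (hX : s.1 ∩ s.2 ⊆ X) (h : X ⊆ X') :
    bigSide G X s ∈ limitUltrafilter p X ↔ bigSide G X' s ∈ limitUltrafilter p X' := by
  rw [← map_limitUltrafilter p h, Ultrafilter.mem_map, hs.compMap_preimage_bigSide hX h]

/-- The ultrafilters are compatible, so the choice of a finite set including the separator does not
matter: two choices are compared at their union. -/
theorem mem_limitOrientation_iff {s : Set V × Set V} (hs : IsSep G s) {X : Finset V}
    (hX : s.1 ∩ s.2 ⊆ X) :
    s ∈ limitOrientation p ↔ bigSide G X s ∈ limitUltrafilter p X := by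
  classical
  constructor
  · rintro ⟨-, X', hX', h⟩
    rw [bigSide_mem_iff_of_subset p hs hX' (Finset.subset_union_right (s₁ := X))] at h
    exact (bigSide_mem_iff_of_subset p hs hX Finset.subset_union_left).2 h
  · exact fun h => ⟨hs, X, hX, h⟩

/-- Finitely many separations in the orientation have a common component on their big sides,
which can be chosen to avoid a given finite set. -/
theorem exists_comp_subset_of_finite {σ : Set (Set V × Set V)} (hσ : σ ⊆ limitOrientation p)
    (hfin : σ.Finite) {S : Set V} (hS : S.Finite) :
    ∃ (X : Finset V) (C : Comp G X), S ⊆ X ∧ ∀ s ∈ σ, (C : Set V) ⊆ s.2 \ s.1 := by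
  have hT : (S ∪ ⋃ s ∈ σ, s.1 ∩ s.2).Finite :=
    hS.union (hfin.biUnion fun s hs => (hσ hs).1.1)
  have hsub : ∀ s ∈ σ, s.1 ∩ s.2 ⊆ hT.toFinset := by
    intro s hs
    rw [hT.coe_toFinset]
    exact (subset_biUnion_of_mem (u := fun s : Set V × Set V => s.1 ∩ s.2) hs).trans
      subset_union_right
  -- At a finite set including all the separators, every big side belongs to one ultrafilter, so
  -- finitely many of them have a common component.
  have hmem : (⋂ s ∈ σ, bigSide G hT.toFinset s) ∈ limitUltrafilter p hT.toFinset :=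
    (Filter.biInter_mem hfin).2 fun s hs =>
      (mem_limitOrientation_iff p (hσ hs).1 (hsub s hs)).1 (hσ hs)
  obtain ⟨C, hC⟩ := Filter.nonempty_of_mem hmem
  refine ⟨hT.toFinset, C, ?_, fun s hs => mem_iInter₂.1 hC s hs⟩
  rw [hT.coe_toFinset]
  exact subset_union_left

/-- The tangle of a point of the inverse limit of the Stone–Čech system. -/
noncomputable def tangleOfLimit : Tangle G where
  carrier := limitOrientation p
  isSep s hs := hs.1
  orients s hs := by
    have h1 : s.1 ∩ s.2 ⊆ hs.1.toFinset := hs.1.coe_toFinset.symm.subset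
    have h2 : s.swap.1 ∩ s.swap.2 ⊆ hs.1.toFinset := inter_comm s.1 s.2 ▸ h1
    rw [mem_limitOrientation_iff p hs h1, mem_limitOrientation_iff p hs.swap h2,
      hs.bigSide_swap h1, Ultrafilter.compl_mem_iff_notMem, not_not]
  consistent s hs t ht _ hle := by
    obtain ⟨X, C, -, hC⟩ := exists_comp_subset_of_finite p (σ := {s, t})
      (by rintro _ (rfl | rfl); exacts [hs, ht]) (toFinite _) finite_empty
    obtain ⟨x, hx⟩ := comp_nonempty C
    exact (hC t (Or.inr rfl) hx).2 (hle.1.1 (hC s (Or.inl rfl) hx).1)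
  avoids σ hσ _ hfin hint := by
    -- The finite set to be avoided is the interior itself; a component on all the big sides would
    -- nevertheless lie in it.
    obtain ⟨X, C, hX, hC⟩ := exists_comp_subset_of_finite p hσ hfin hint
    obtain ⟨x, hx⟩ := comp_nonempty C
    exact not_mem_of_mem_comp hx (hX (mem_starInterior.2 fun s hs => (hC s hs hx).1))

theorem toLimit_tangleOfLimit : (tangleOfLimit p).toLimit = p := by
  refine CSystem.Limit.ext fun X => ?_
  refine Ultrafilter.ext (f := (tangleOfLimit p).ultrafilter X) (g := limitUltrafilter p X)
    fun 𝒞 => ?_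
  have := mem_limitOrientation_iff p (isSep_sepTo X 𝒞) (sepTo_inter X 𝒞).subset
  rwa [bigSide_sepTo] at this

end OfLimit

/-- Tangles correspond to the points of the inverse limit of the Stone–Čech system. -/
noncomputable def tangleEquivLimit {V : Type u} (G : SimpleGraph V) :
    Tangle G ≃ (stoneCechSystem G).Limit :=
  Equiv.ofBijective Tangle.toLimit
    ⟨Tangle.toLimit_injective, fun p => ⟨tangleOfLimit p, toLimit_tangleOfLimit p⟩⟩

theorem endTangle_ultrafilter {V : Type u} {G : SimpleGraph V} (ω : Ends G) (X : Finset V) :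
    (endTangle ω).ultrafilter X = pure (ω.comp X) := by
  ext 𝒞
  rw [Tangle.mem_ultrafilter, Tangle.mem_U, Ultrafilter.mem_pure]
  have hX : (isSep_sepTo X 𝒞).1.toFinset = X := Finset.coe_injective (by
    rw [(isSep_sepTo X 𝒞).1.coe_toFinset, sepTo_inter])
  have h : sepTo X 𝒞 ∈ (endTangle ω).carrier ↔
      (Ends.comp (isSep_sepTo X 𝒞).1.toFinset ω : Set V) ⊆ (sepTo X 𝒞).2 \ (sepTo X 𝒞).1 :=
    ⟨fun ⟨_, h⟩ => h, fun h => ⟨isSep_sepTo X 𝒞, h⟩⟩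
  rw [h, hX, ← mem_bigSide, bigSide_sepTo]

theorem toLimit_endTangle {V : Type u} {G : SimpleGraph V} (ω : Ends G) :
    (endTangle ω).toLimit = (stoneCechSystem G).ofEnd ω :=
  CSystem.Limit.ext fun X => endTangle_ultrafilter ω X

/-! ## The tangle compactification as an induced space -/

/-- A point of the 1-complex of `G`, as a point of `|G|_Θ`. -/
def TangleSpace.pt {V : Type u} {G : SimpleGraph V} (z : OneComplex G) : TangleSpace G :=
  Ext.pt z

/-- A tangle of `G`, as a point of `|G|_Θ`. -/
def TangleSpace.ofTangle {V : Type u} {G : SimpleGraph V} (τ : Tangle G) : TangleSpace G :=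
  Ext.lim τ

theorem TangleSpace.eq_pt_or_eq_ofTangle {V : Type u} {G : SimpleGraph V} (x : TangleSpace G) :
    (∃ z, x = TangleSpace.pt z) ∨ ∃ τ, x = TangleSpace.ofTangle τ := by
  rcases x with z | τ
  · exact Or.inl ⟨z, rfl⟩
  · exact Or.inr ⟨τ, rfl⟩

/-- The set `𝒪(X, 𝒞, P)` in `|G|_Θ`. -/
def TangleSpace.nhd {V : Type u} {G : SimpleGraph V} (X : Finset V) (𝒞 : Set (Comp G X))
    (P : Set (Tangle G)) : Set (TangleSpace G) :=
  basicNhd X 𝒞 P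

theorem TangleSpace.isOpen_nhd {V : Type u} {G : SimpleGraph V} (X : Finset V)
    (𝒞 : Set (Comp G X)) : IsOpen (TangleSpace.nhd X 𝒞 {τ : Tangle G | 𝒞 ∈ τ.U X}) :=
  TopologicalSpace.isOpen_generateFrom_of_mem (Or.inr ⟨X, 𝒞, rfl⟩)

theorem eq_pure_of_singleton_mem {α : Type u} {u : Ultrafilter α} {a : α} (h : {a} ∈ u) :
    u = pure a := by
  obtain ⟨b, hb, e⟩ := Ultrafilter.eq_pure_of_finite_mem (finite_singleton a) h
  rwa [mem_singleton_iff.1 hb] at e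

/-- The topology of `|G|_Θ` is generated using only the basic open sets `{u | 𝒞 ∈ u}` of `β(𝒞_X)`. A
general open `O` is a union of these; points of `G` are covered by taking `𝒞` to be a single
component. -/
theorem isOpen_tangle_nhd {V : Type u} {G : SimpleGraph V} (X : Finset V)
    {O : Set (Ultrafilter (Comp G X))} (hO : IsOpen O) :
    IsOpen (TangleSpace.nhd X (pure ⁻¹' O) {τ : Tangle G | τ.ultrafilter X ∈ O}) := by
  have hbas : ∀ u ∈ O, ∃ 𝒞 : Set (Comp G X), 𝒞 ∈ u ∧ {u' | 𝒞 ∈ u'} ⊆ O := by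
    intro u hu
    obtain ⟨_, ⟨𝒞, rfl⟩, h1, h2⟩ := ultrafilterBasis_is_basis.exists_subset_of_mem_open hu hO
    exact ⟨𝒞, h1, h2⟩
  have hsub : ∀ 𝒞 : Set (Comp G X), {u' : Ultrafilter (Comp G X) | 𝒞 ∈ u'} ⊆ O →
      TangleSpace.nhd X 𝒞 {τ : Tangle G | 𝒞 ∈ τ.U X} ⊆
        TangleSpace.nhd X (pure ⁻¹' O) {τ : Tangle G | τ.ultrafilter X ∈ O} := by
    intro 𝒞 h
    refine union_subset_union (image_mono ?_) (image_mono fun τ hτ => h hτ)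
    have h' : 𝒞 ⊆ pure ⁻¹' O := fun C hC => h (Ultrafilter.mem_pure.2 hC)
    rw [← union_eq_self_of_subset_left h', region_union]
    exact subset_union_left
  refine isOpen_iff_forall_mem_open.2 fun x hx => ?_
  obtain ⟨z, rfl⟩ | ⟨τ, rfl⟩ := TangleSpace.eq_pt_or_eq_ofTangle x
  · have hz : z ∈ region X (pure ⁻¹' O) := pt_mem_basicNhd.1 hx
    obtain ⟨C, hC, hzC⟩ : ∃ C ∈ (pure ⁻¹' O : Set (Comp G X)), z ∈ region X {C} := by
      rcases z with v | ⟨e, t⟩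
      · obtain ⟨C, hC, hv⟩ := hz
        exact ⟨C, hC, C, rfl, hv⟩
      · rcases hz with ⟨C, hC, h⟩ | ⟨C, hC, h⟩
        · exact ⟨C, hC, Or.inl ⟨C, rfl, h⟩⟩
        · exact ⟨C, hC, Or.inr ⟨C, rfl, h⟩⟩
    -- The only ultrafilter containing `{C}` is `pure C`, which lies in `O`.
    refine ⟨_, hsub {C} ?_, TangleSpace.isOpen_nhd X {C}, pt_mem_basicNhd.2 hzC⟩
    intro u hu
    rw [eq_pure_of_singleton_mem hu]
    exact hC
  · have hτ : τ.ultrafilter X ∈ O :=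
      (lim_mem_basicNhd (P := {τ : Tangle G | τ.ultrafilter X ∈ O})).1 hx
    obtain ⟨𝒞, h1, h2⟩ := hbas _ hτ
    exact ⟨_, hsub 𝒞 h2, TangleSpace.isOpen_nhd X 𝒞,
      (lim_mem_basicNhd (P := {τ : Tangle G | 𝒞 ∈ τ.U X})).2 h1⟩

/-- `|G|_Θ` is homeomorphic to the space induced by the Stone–Čech system. -/
noncomputable def tangleHomeo {V : Type u} (G : SimpleGraph V) :
    TangleSpace G ≃ₜ (stoneCechSystem G).Space where
  toFun := Ext.map (tangleEquivLimit G)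
  invFun := Ext.map (tangleEquivLimit G).symm
  left_inv x := by
    rcases x with z | τ
    · rfl
    · exact congrArg Ext.lim ((tangleEquivLimit G).symm_apply_apply τ)
  right_inv x := by
    rcases x with z | p
    · rfl
    · exact congrArg Ext.lim ((tangleEquivLimit G).apply_symm_apply p)
  continuous_toFun := by
    refine Ext.continuous_map ?_
    rintro _ ⟨X, O, hO, rfl⟩
    rw [Ext.map_preimage_basicNhd]
    exact isOpen_tangle_nhd X hO
  continuous_invFun := by
    refine Ext.continuous_map ?_
    rintro _ ⟨X, 𝒞, rfl⟩
    rw [Ext.map_preimage_basicNhd]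
    have h := (stoneCechSystem G).isOpen_nhd X (ultrafilter_isOpen_basic 𝒞)
    -- The trace of `{u | 𝒞 ∈ u}` on the components is `𝒞` itself, so only the sets of limit points
    -- remain to be matched.
    refine Eq.subst (motive := fun S : Set (stoneCechSystem G).Space => IsOpen S)
      (congrArg (basicNhd X 𝒞) (Set.ext fun p => ?_)) h
    have : ((tangleEquivLimit G).symm p).toLimit = p :=
      (tangleEquivLimit G).apply_symm_apply p
    change _ ↔ 𝒞 ∈ limitUltrafilter ((tangleEquivLimit G).symm p).toLimit X
    rw [this]
    rfl

theorem tangleHomeo_comp_tangleMap {V : Type u} (G : SimpleGraph V) :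
    tangleHomeo G ∘ tangleMap G = (stoneCechSystem G).map := by
  funext x
  obtain ⟨z, rfl⟩ | ⟨ω, rfl⟩ := EndSpace.eq_pt_or_eq_ofEnd x
  · rfl
  · exact congrArg Ext.lim (toLimit_endTangle ω)

theorem topEquivalent_tangleMap {V : Type u} (G : SimpleGraph V) :
    TopEquivalent (tangleMap G) (stoneCechSystem G).map :=
  ⟨(tangleHomeo G).symm, by
    rw [← tangleHomeo_comp_tangleMap, ← Function.comp_assoc, Homeomorph.symm_comp_self,
      Function.id_comp]⟩

/-! ## Comparison of compactifications -/

section Compare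

variable {A : Type u} {K : Type v} {K' : Type w} {K'' : Type w'} [TopologicalSpace K]
  [TopologicalSpace K'] [TopologicalSpace K''] {h : A → K} {h' : A → K'} {h'' : A → K''}

theorem TopEquivalent.symm (e : TopEquivalent h h') : TopEquivalent h' h := by
  obtain ⟨f, rfl⟩ := e
  exact ⟨f.symm, by rw [← Function.comp_assoc, Homeomorph.symm_comp_self, Function.id_comp]⟩

theorem TopEquivalent.trans (e : TopEquivalent h h') (e' : TopEquivalent h' h'') :
    TopEquivalent h h'' := by
  obtain ⟨f, rfl⟩ := e
  obtain ⟨g, rfl⟩ := e'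
  exact ⟨g.trans f, rfl⟩

theorem TopEquivalent.isQuotientOf (e : TopEquivalent h h') : IsQuotientOf h h' := by
  obtain ⟨f, hf⟩ := e
  exact ⟨f, f.isQuotientMap, hf⟩

theorem IsQuotientOf.trans (e : IsQuotientOf h h') (e' : IsQuotientOf h' h'') :
    IsQuotientOf h h'' := by
  obtain ⟨f, hf, rfl⟩ := e
  obtain ⟨g, hg, rfl⟩ := e'
  exact ⟨f ∘ g, hf.comp hg, rfl⟩

theorem IsQuotientOf.coarser (e : IsQuotientOf h h') : Coarser h h' := by
  obtain ⟨f, hf, e⟩ := e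
  exact ⟨f, hf.continuous, e⟩

theorem Coarser.trans (e : Coarser h h') (e' : Coarser h' h'') : Coarser h h'' := by
  obtain ⟨f, hf, rfl⟩ := e
  obtain ⟨g, hg, rfl⟩ := e'
  exact ⟨f ∘ g, hf.comp hg, rfl⟩

theorem TopEquivalent.coarser (e : TopEquivalent h h') : Coarser h h' :=
  e.isQuotientOf.coarser

end Compare

theorem IsOmegaCompactification.of_topEquivalent {V : Type u} {G : SimpleGraph V} {K : Type v}
    {K' : Type w} [TopologicalSpace K] [TopologicalSpace K'] {h : EndSpace G → K}
    {h' : EndSpace G → K'} (hh : IsOmegaCompactification G h') (e : TopEquivalent h h') :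
    IsOmegaCompactification G h := by
  obtain ⟨f, rfl⟩ := e
  obtain ⟨⟨hc, he, hd⟩, hdel⟩ := hh
  let f' : ↥(h' '' EndSpace.inner G)ᶜ ≃ₜ ↥((f ∘ h') '' EndSpace.inner G)ᶜ :=
    f.subtype fun x => by
      rw [mem_compl_iff, mem_compl_iff, image_comp, f.injective.mem_set_image]
  have hcomp : deleteMap (f ∘ h') (f.injective.comp he.injective) (EndSpace.inner G) =
      f' ∘ deleteMap h' he.injective (EndSpace.inner G) := rfl
  refine ⟨⟨f.compactSpace, f.isEmbedding.comp he, f.surjective.denseRange.comp hd f.continuous⟩,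
    ?_⟩
  have := hdel.compact
  have := hdel.hausdorff
  exact
    { compact := f'.compactSpace
      isEmbedding := hcomp ▸ f'.isEmbedding.comp hdel.isEmbedding
      dense := hcomp ▸ f'.surjective.denseRange.comp hdel.dense f'.continuous
      hausdorff := f'.t2Space }

/-! ## Fibres of the map from tangles to the limit of the component and critical vertex sets -/

/-- Components map to components, and a critical set either stays fixed or becomes a component.
Hence a critical coordinate of a limit point persists at all larger finite sets. -/
theorem gamBond_eq_crit {V : Type u} {G : SimpleGraph V} {X X' : Finset V} (h : X ⊆ X')
    {x : Gam G X'} {Y : Finset V} {hY : Y ∈ crit G X} (hx : gamBond h x = .crit Y hY) :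
    ∃ hY', x = .crit Y hY' := by
  rcases x with C | ⟨Z, hZ⟩
  · cases hx
  · by_cases hZX : Z ⊆ X
    · rw [gamBond_crit_of_subset h hZ hZX] at hx
      cases hx
      exact ⟨hZ, rfl⟩
    · rw [gamBond_crit_of_not_subset h hZ hZX] at hx
      cases hx

section GamLimit

variable {V : Type u} {G : SimpleGraph V}

theorem gam_coord_union {p : (gamSystem G).Limit} {X X' Y : Finset V} {hY : Y ∈ crit G X}
    (h : X ⊆ X') (hp : p.coord X = Gam.crit Y hY) : ∃ hY', p.coord X' = Gam.crit Y hY' :=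
  gamBond_eq_crit h ((p.bond_coord h).trans hp)

/-- Both critical coordinates persist at `X ∪ X'`. -/
theorem gam_crit_unique {p : (gamSystem G).Limit} {X X' Y Y' : Finset V} {hY : Y ∈ crit G X}
    {hY' : Y' ∈ crit G X'} (hp : p.coord X = Gam.crit Y hY) (hp' : p.coord X' = Gam.crit Y' hY') :
    Y = Y' := by
  classical
  obtain ⟨_, h1⟩ := gam_coord_union (Finset.subset_union_left (s₂ := X')) hp
  obtain ⟨_, h2⟩ := gam_coord_union (Finset.subset_union_right (s₁ := X)) hp'
  have := h1.symm.trans h2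
  cases this
  rfl

theorem gam_coord_self {p : (gamSystem G).Limit} {X Y : Finset V} {hY : Y ∈ crit G X}
    (hp : p.coord X = Gam.crit Y hY) : ∃ hY', p.coord Y = Gam.crit Y hY' := by
  refine ⟨⟨Finset.Subset.refl Y, hY.2⟩, (p.bond_coord hY.1).symm.trans ?_⟩
  rw [hp]
  exact gamBond_crit_of_subset hY.1 hY (Finset.Subset.refl Y)

/-- A point of the inverse limit that has a critical vertex set as a coordinate is determined
by it. -/
theorem gam_limit_ext {p q : (gamSystem G).Limit} {X X' Y : Finset V} {hY : Y ∈ crit G X}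
    {hY' : Y ∈ crit G X'} (hp : p.coord X = Gam.crit Y hY) (hq : q.coord X' = Gam.crit Y hY') :
    p = q := by
  classical
  obtain ⟨_, hp⟩ := gam_coord_self hp
  obtain ⟨_, hq⟩ := gam_coord_self hq
  refine CSystem.Limit.ext fun Z => ?_
  obtain ⟨_, hp⟩ := gam_coord_union (Finset.subset_union_right (s₁ := Z)) hp
  obtain ⟨_, hq⟩ := gam_coord_union (Finset.subset_union_right (s₁ := Z)) hq
  rw [← p.bond_coord (Finset.subset_union_left (s₂ := Y)), hp,
    ← q.bond_coord (Finset.subset_union_left (s₂ := Y)), hq]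

/-- The critical coordinate is always the same set `Y`, and it can occur only at finite sets
including `Y`. Through the tangle map this identifies `X_τ` with `Y`. -/
theorem isLeast_gam {p : (gamSystem G).Limit} {X Y : Finset V} {hY : Y ∈ crit G X}
    (hp : p.coord X = Gam.crit Y hY) :
    IsLeast {Z | ∃ Y' hY', p.coord Z = Gam.crit Y' hY'} Y := by
  refine ⟨⟨Y, gam_coord_self hp⟩, ?_⟩
  rintro Z ⟨Y', hY', h⟩
  obtain rfl := gam_crit_unique hp h
  exact hY'.1

end GamLimit

theorem Tangle.mem_free_iff {V : Type u} {G : SimpleGraph V} {τ : Tangle G} {X : Finset V} :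
    X ∈ τ.free ↔ ∀ C, τ.ultrafilter X ≠ pure C := by
  constructor
  · intro h C hC
    have hmem : C ∈ ⋂₀ τ.U X := by
      intro 𝒞 h𝒞
      rw [← mem_ultrafilter, hC] at h𝒞
      exact Ultrafilter.mem_pure.1 h𝒞
    exact notMem_empty C ((h : ⋂₀ τ.U X = ∅) ▸ hmem)
  · refine fun h => eq_empty_iff_forall_notMem.2 fun C hC => h C ?_
    refine eq_pure_of_singleton_mem (mem_ultrafilter.2 (τ.compl_mem_U.1 fun hn => ?_))
    exact hC _ hn rfl

/-- The map `|G|_Θ → |G|_Γ` induced by a comparison of `𝒞`-systems has the classes of `∼` as its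
fibres. -/
theorem limMap_toLimit_eq_iff {V : Type u} {G : SimpleGraph V}
    {f : ∀ X, (stoneCechSystem G).space X → (gamSystem G).space X}
    (hc : ∀ X, Continuous (f X) ∧ f X ∘ (stoneCechSystem G).emb X = (gamSystem G).emb X)
    (hf : ∀ (X X' : Finset V) (h : X ⊆ X'),
      f X ∘ (stoneCechSystem G).bond h = (gamSystem G).bond h ∘ f X') {τ τ' : Tangle G} :
    CSystem.limMap f hf τ.toLimit = CSystem.limMap f hf τ'.toLimit ↔ τ = τ' ∨ τ.Equiv τ' := by
  -- Since `Gam.comp C` is isolated, its preimage contains a basic neighbourhood `{u' | 𝒞 ∈ u'}` of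
  -- `u`; each component in `𝒞` is then mapped to `C`, forcing `𝒞 ⊆ {C}`.
  have hcomp : ∀ X (u : Ultrafilter (Comp G X)) C, f X u = Gam.comp C ↔ u = pure C := by
    intro X u C
    constructor
    · intro hu
      have hop : IsOpen (f X ⁻¹' {Gam.comp C}) :=
        ((gamSystem G).isOpen_singleton_emb C).preimage (hc X).1
      obtain ⟨_, ⟨𝒞, rfl⟩, h1, h2⟩ :=
        ultrafilterBasis_is_basis.exists_subset_of_mem_open (a := u) hu hop
      refine eq_pure_of_singleton_mem (Filter.mem_of_superset h1 fun D hD => ?_)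
      have h3 : f X (pure D) = Gam.comp C := h2 (Ultrafilter.mem_pure.2 hD)
      have h4 : f X (pure D) = Gam.comp D := congrFun (hc X).2 D
      exact (gam_isHausdorffCompactification G X).isEmbedding.injective (h4.symm.trans h3)
    · rintro rfl
      exact congrFun (hc X).2 C
  set F : Tangle G → (gamSystem G).Limit := fun τ => CSystem.limMap f hf τ.toLimit with hF
  have hcoord : ∀ τ X, (F τ).coord X = f X (τ.ultrafilter X) := fun _ _ => rfl
  -- Non-principal ultrafilters go exactly to critical sets, so freeness can be read off the image
  -- in the limit of the `Γ_X`.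
  have hfree : ∀ τ : Tangle G, τ.free = {Z | ∃ Y' hY', (F τ).coord Z = Gam.crit Y' hY'} := by
    intro τ
    ext X
    rw [Tangle.mem_free_iff]
    constructor
    · intro h
      rcases hx : f X (τ.ultrafilter X) with C | ⟨Y, hY⟩
      · exact absurd ((hcomp X _ C).1 hx) (h C)
      · exact ⟨Y, hY, hx⟩
    · rintro ⟨Y, hY, h⟩ C hC
      rw [hcoord, (hcomp X _ C).2 hC] at h
      cases h
  change F τ = F τ' ↔ _
  constructor
  · intro h
    by_cases hne : τ.free.Nonempty
    · right
      rw [hfree] at hne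
      obtain ⟨X, Y, hY, hX⟩ := hne
      refine ⟨Y, ?_, ?_⟩
      · rw [hfree]
        exact isLeast_gam hX
      · rw [hfree, ← h]
        exact isLeast_gam hX
    · left
      -- With no free coordinate all the ultrafilters are principal, and principal ultrafilters are
      -- recovered from their images.
      refine Tangle.toLimit_injective (CSystem.Limit.ext fun X => ?_)
      have hX : X ∉ τ.free := fun hX => hne ⟨X, hX⟩
      rw [Tangle.mem_free_iff] at hX
      push Not at hX
      obtain ⟨C, hC⟩ := hX
      have h1 := (hcomp X _ C).2 hC
      rw [← hcoord, h, hcoord] at h1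
      exact hC.trans ((hcomp X _ C).1 h1).symm
  · rintro (rfl | ⟨Y, h1, h2⟩)
    · rfl
    · rw [hfree] at h1 h2
      obtain ⟨Z, hZ, e⟩ := h1.1
      obtain ⟨Z', hZ', e'⟩ := h2.1
      obtain rfl := (isLeast_gam e).unique h1
      obtain rfl := (isLeast_gam e').unique h2
      exact gam_limit_ext e e'

/-- The quotient map from `|G|_Θ` to `|G|_Γ` has exactly the classes of `∼` as fibres, so it factors
through an injective quotient map, which is a homeomorphism. -/
theorem topEquivalent_tangleQuotientMap {V : Type u} (G : SimpleGraph V) :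
    TopEquivalent (gamSystem G).map (tangleQuotientMap G) := by
  obtain ⟨f, hc, hf⟩ := (stoneCechSystem G).gamSystem_le
  set g : TangleSpace G → (gamSystem G).Space := CSystem.spaceMap f hf ∘ tangleHomeo G with hg
  have hgq : IsQuotientMap g :=
    (CSystem.isQuotientMap_spaceMap hc).comp (tangleHomeo G).isQuotientMap
  have hgm : ∀ a, g (tangleMap G a) = (gamSystem G).map a := by
    intro a
    exact (congrArg _ (congrFun (tangleHomeo_comp_tangleMap G) a)).trans
      (congrFun (CSystem.spaceMap_comp_map fun X => (hc X).2) a)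
  have hker : ∀ x y, g x = g y ↔ tangleSetoid G x y := by
    intro x y
    have hpt : ∀ z, g (TangleSpace.pt z) = (gamSystem G).pt z := fun _ => rfl
    have hlim : ∀ τ, g (TangleSpace.ofTangle τ) =
      (gamSystem G).limPt (CSystem.limMap f hf τ.toLimit) := fun _ => rfl
    change _ ↔ (x = y ∨ ∃ τ τ' : Tangle G,
      x = TangleSpace.ofTangle τ ∧ y = TangleSpace.ofTangle τ' ∧ τ.Equiv τ')
    constructor
    · intro h
      obtain ⟨z, rfl⟩ | ⟨τ, rfl⟩ := TangleSpace.eq_pt_or_eq_ofTangle x <;>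
      obtain ⟨z', rfl⟩ | ⟨τ', rfl⟩ := TangleSpace.eq_pt_or_eq_ofTangle y
      · rw [hpt, hpt] at h
        exact Or.inl (congrArg _ ((gamSystem G).pt_injective h))
      · rw [hpt, hlim] at h
        exact absurd h CSystem.pt_ne_limPt
      · rw [hpt, hlim] at h
        exact absurd h.symm CSystem.pt_ne_limPt
      · rw [hlim, hlim] at h
        rcases (limMap_toLimit_eq_iff hc hf).1 ((gamSystem G).limPt_injective h) with rfl | h
        · exact Or.inl rfl
        · exact Or.inr ⟨τ, τ', rfl, rfl, h⟩
    · rintro (rfl | ⟨τ, τ', rfl, rfl, h⟩)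
      · rfl
      · rw [hlim, hlim, (limMap_toLimit_eq_iff hc hf).2 (Or.inr h)]
  let k : TangleQuotient G → (gamSystem G).Space := Quotient.lift g fun x y h => (hker x y).2 h
  have hk : Continuous k := hgq.continuous.quotient_lift _
  have hkq : IsQuotientMap k := IsQuotientMap.of_comp continuous_quotient_mk' hk hgq
  have hinj : Function.Injective k := by
    intro x y
    induction x using Quotient.inductionOn
    induction y using Quotient.inductionOn
    exact fun h => Quotient.sound ((hker _ _).1 h)
  exact ⟨(isHomeomorph_iff_isQuotientMap_injective.2 ⟨hkq, hinj⟩).homeomorph, funext hgm⟩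

theorem isCCompactification_tangleMap {V : Type u} (G : SimpleGraph V) :
    IsCCompactification.{u, u, u} G (tangleMap G) :=
  ⟨(stoneCechSystem G).isOmegaCompactification_map.of_topEquivalent (topEquivalent_tangleMap G),
    stoneCechSystem G, topEquivalent_tangleMap G⟩

end InfGraph

/-! ### The theorem -/

open InfGraph
theorem theorem7p7 {V : Type u} (G : SimpleGraph V) :
    -- `𝒞^Γ` is the least `𝒞`-system
    (∀ 𝒮 : CSystem.{u, w} G, (gamSystem G).Le 𝒮) ∧
    -- the Stone–Čech system is the greatest `𝒞`-system
    (∀ 𝒮 : CSystem.{u, w} G, 𝒮.Le (stoneCechSystem G)) ∧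
    -- `|G|_Γ` is the coarsest `𝒞`-compactification, up to topological equivalence
    (IsCCompactification.{u, u, u} G (gamSystem G).map ∧
      ∀ (K : Type v) [TopologicalSpace K] (h : EndSpace G → K),
        IsCCompactification.{u, v, w} G h →
          Coarser (gamSystem G).map h ∧
          (Coarser h (gamSystem G).map → TopEquivalent h (gamSystem G).map)) ∧
    -- `|G|_Θ` is the finest `𝒞`-compactification, up to topological equivalence
    (IsCCompactification.{u, u, u} G (tangleMap G) ∧
      ∀ (K : Type v) [TopologicalSpace K] (h : EndSpace G → K),
        IsCCompactification.{u, v, w} G h →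
          Coarser h (tangleMap G) ∧
          (Coarser (tangleMap G) h → TopEquivalent h (tangleMap G))) ∧
    -- every `𝒞`-compactification is a quotient of `|G|_Θ`, and has `|G|_Γ` as a quotient
    (∀ (K : Type v) [TopologicalSpace K] (h : EndSpace G → K),
      IsCCompactification.{u, v, w} G h →
        IsQuotientOf (gamSystem G).map h ∧ IsQuotientOf h (tangleMap G)) ∧
    -- `|G|_Γ` and `|G|_Θ / ∼` are topologically equivalent
    TopEquivalent (gamSystem G).map (tangleQuotientMap G) := by
  have hq : ∀ (K : Type v) [TopologicalSpace K] (h : EndSpace G → K),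
      IsCCompactification.{u, v, w} G h →
        IsQuotientOf (gamSystem G).map h ∧ IsQuotientOf h (tangleMap G) := by
    rintro K _ h ⟨-, 𝒮, e⟩
    -- Everything is transported to the space induced by `𝒮`, where the comparisons of systems
    -- provide the quotient maps.
    exact ⟨𝒮.gamSystem_le.isQuotientOf_map.trans e.symm.isQuotientOf,
      (e.isQuotientOf.trans 𝒮.le_stoneCechSystem.isQuotientOf_map).trans
        (topEquivalent_tangleMap G).symm.isQuotientOf⟩
  refine ⟨fun 𝒮 => 𝒮.gamSystem_le, fun 𝒮 => 𝒮.le_stoneCechSystem,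
    ⟨⟨(gamSystem G).isOmegaCompactification_map, gamSystem G, ⟨Homeomorph.refl _, rfl⟩⟩, ?_⟩,
    ⟨isCCompactification_tangleMap G, ?_⟩, hq, topEquivalent_tangleQuotientMap G⟩
  · intro K _ h hh
    have hc := (hq K h hh).1.coarser
    obtain ⟨-, 𝒮, e⟩ := hh
    -- Mutual comparability is moved to two induced spaces, where it forces equivalence.
    exact ⟨hc, fun hc' => e.trans (𝒮.topEquivalent_map_of_coarser (gamSystem G)
      (e.symm.coarser.trans hc') (hc.trans e.coarser))⟩
  · intro K _ h hh
    have hc := (hq K h hh).2.coarser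
    obtain ⟨-, 𝒮, e⟩ := hh
    have e' := topEquivalent_tangleMap G
    exact ⟨hc, fun hc' => (e.trans (𝒮.topEquivalent_map_of_coarser (stoneCechSystem G)
      (e.symm.coarser.trans (hc.trans e'.coarser))
      (e'.symm.coarser.trans (hc'.trans e.coarser)))).trans e'.symm⟩
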